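/- Let $r_0\ge 3$ be an integer and let $\beta\in(0,1)$, $\gamma>0$, $M>0$, $K\ge 0$. There are constants $h_0,c,C>0$, depending only on $r_0,\beta,\gamma,M,K$, such that the following holds. *Setting.* Let $d\ge1$, let $\mathcal N=\mathbb Z^d$ or $\mathcal N=\mathbb N^d$ (with $0\in\mathbb N$), and let $\mathcal Z=\mathcal N\times\{\pm1\}$; for $j=(a,\delta)\in\mathcal Z$ put $\bar j=(a,-\delta)$. Let $\ell^1=\ell^1(\mathcal Z,\mathbb C)$ with $\|z\|_{\ell^1}=\sum_{j}|z_j|$ and $B_M=\{z\in\ell^1:\|z\|_{\ell^1}\le M\}$. Write $\xi_a=z_{(a,1)}$, $\eta_a=z_{(a,-1)}$; $z$ is real if $z_{\bar j}=\overline{z_j}$ for all $j$. For $k\ge2$, $\mathcal P_k$ denotes the set of real polynomial Hamiltonians $$P(z)=\sum_{\ell=2}^{k}\ \sum_{\boldsymbol j\in\mathcal Z^\ell}a_{\boldsymbol j}\,z_{j_1}\cdots z_{j_\ell}$$ with bounded coefficients, $a_{\bar{\boldsymbol j}}=\overline{a_{\boldsymbol j}}$, and zero momentum: for $\boldsymbol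 j=((a_1,\delta_1),\dots,(a_\ell,\delta_\ell))$, $a_{\boldsymbol j}\ne0$ implies $\delta_1a_1+\dots+\delta_\ell a_\ell=0$. Put $\|P\|=\sum_{\ell=2}^k\sup_{\boldsymbol j\in\mathcal Z^\ell}|a_{\boldsymbol j}|$. For a Hamiltonian $F$, $\Phi_F^t$ is the flow in $\ell^1$ of $\dot\xi_a=-i\,\partial F/\partial\eta_a$, $\dot\eta_a=i\,\partial F/\partial\xi_a$. Let $\omega_a\in\mathbb R$ $(a\in\mathcal N)$ be frequencies, let $P\in\mathcal P_{r_0}$ with $\|P\|\le K$, let $0<h\le h_0$, and let $\alpha_h:\mathbb R\to\mathbb R$ be a filter function with $|\alpha_h(x)|\le\gamma h^\beta$ for all $x\in\mathbb R$. Put $\lambda_a=\alpha_h(h\omega_a)$, $A_0=\sum_{a}\lambda_a\xi_a\eta_a$, so that $(\Phi_{A_0}^1(z))_{(a,\delta)}=e^{-i\delta\lambda_a}z_{(a,\delta)}$, and $\Lambda(\boldsymbol j)=\sum_i\delta_i\lambda_{a_i}$ for $\boldsymbol j=((a_i,\delta_i))_i$. Let $$H_h^{(1)}(z)=\sum_{a\in\mathcal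 N}\frac1h\,\alpha_h(h\omega_a)\,\xi_a\eta_a+\sum_{\ell=2}^{r_0}\ \sum_{\boldsymbol j\in\mathcal Z^\ell}\frac{i\Lambda(\boldsymbol j)}{e^{i\Lambda(\boldsymbol j)}-1}\,a_{\boldsymbol j}\,z_{j_1}\cdots z_{j_\ell},$$ where the quotient is $1$ if $\Lambda(\boldsymbol j)=0$. *Conclusion.* There is a modified Hamiltonian $H_h$, belonging to $\mathcal P_k$ for some $k$, such that for all $z\in B_M$ the flows below are defined and $$\|\Phi_P^h\circ\Phi_{A_0}^1(z)-\Phi_{H_h}^h(z)\|_{\ell^1}\le h\,\exp(-(h_0/h)^\beta),$$ and such that, for every sequence $(z^n)_{n\ge0}$ in $\ell^1$ with $z^0=(\xi^0,\overline{\xi^0})$ real, $z^{n+1}=\Phi_P^h\circ\Phi_{A_0}^1(z^n)$ and $z^n\in B_M$ for all $n\ge0$, and for all $n$ with $nh\le\exp(ch^{-\beta})$, $$|H_h(z^n)-H_h(z^0)|\le C\exp(-ch^{-\beta})\qquad\text{and}\qquad |H_h^{(1)}(z^n)-H_h^{(1)}(z^0)|\le C\,h .$$ -/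

import Mathlib

noncomputable section

namespace SplittingBEA

/-- The indices `j = (a, δ)` with `a ∈ 𝒩` and `δ ∈ {1, -1} = ℤˣ`. -/
abbrev ModeIndex {d : ℕ} (𝒩 : Set (Fin d → ℤ)) : Type := 𝒩 × ℤˣ

/-- The conjugate index `(a, -δ)` of `(a, δ)`. -/
def conjIndex {d : ℕ} {𝒩 : Set (Fin d → ℤ)} (j : ModeIndex 𝒩) : ModeIndex 𝒩 := (j.1, -j.2)

/-- The phase space `ℓ¹` of summable families `z = (z_j)`; here `ξ_a = z_(a,1)` and
`η_a = z_(a,-1)`, and `‖z‖ = ∑ |z_j|`. -/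
abbrev EllOne {d : ℕ} (𝒩 : Set (Fin d → ℤ)) : Type := lp (fun _ : ModeIndex 𝒩 => ℂ) 1

/-- `z` is real, i.e. `z = (ξ, ξ̄)`. -/
def IsRealPoint {d : ℕ} {𝒩 : Set (Fin d → ℤ)} (z : EllOne 𝒩) : Prop :=
  ∀ j : ModeIndex 𝒩, z (conjIndex j) = starRingEnd ℂ (z j)

/-- The momentum `a₁ δ₁ + ⋯ + a_ℓ δ_ℓ` of a multi-index. -/
def momentum {d : ℕ} {𝒩 : Set (Fin d → ℤ)} {ℓ : ℕ} (j : Fin ℓ → ModeIndex 𝒩) : Fin d → ℤ :=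
  ∑ i, ((j i).2 : ℤ) • ((j i).1 : Fin d → ℤ)

/-- Real polynomial Hamiltonians of degree at most `k` with a zero of order at least two at the
origin, with zero momentum and bounded coefficients, given by their coefficients
(extended by zero to all multi-indices). -/
structure PolyHam {d : ℕ} (𝒩 : Set (Fin d → ℤ)) (k : ℕ) where
  coeff : (ℓ : ℕ) → (Fin ℓ → ModeIndex 𝒩) → ℂ
  degree_mem : ∀ (ℓ : ℕ) (j : Fin ℓ → ModeIndex 𝒩), coeff ℓ j ≠ 0 → 2 ≤ ℓ ∧ ℓ ≤ k
  momentum_eq_zero : ∀ (ℓ : ℕ) (j : Fin ℓ → ModeIndex 𝒩), coeff ℓ j ≠ 0 → momentum j = 0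
  coeff_conj : ∀ (ℓ : ℕ) (j : Fin ℓ → ModeIndex 𝒩),
    coeff ℓ (fun i => conjIndex (j i)) = starRingEnd ℂ (coeff ℓ j)
  bounded : ∃ B : ℝ, ∀ (ℓ : ℕ) (j : Fin ℓ → ModeIndex 𝒩), ‖coeff ℓ j‖ ≤ B

/-- The norm `‖P‖ = ∑_{ℓ = 2}^k sup_j |a_j|`. -/
def PolyHam.coeffNorm {d : ℕ} {𝒩 : Set (Fin d → ℤ)} {k : ℕ} (P : PolyHam 𝒩 k) : ℝ :=
  ∑ ℓ ∈ Finset.Icc 2 k, ⨆ j : Fin ℓ → ModeIndex 𝒩, ‖P.coeff ℓ j‖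

/-- The value `P(z) = ∑_{ℓ = 2}^k ∑_j a_j z_{j_1} ⋯ z_{j_ℓ}`. -/
def PolyHam.eval {d : ℕ} {𝒩 : Set (Fin d → ℤ)} {k : ℕ} (P : PolyHam 𝒩 k) (z : EllOne 𝒩) : ℂ :=
  ∑ ℓ ∈ Finset.Icc 2 k, ∑' j : Fin ℓ → ModeIndex 𝒩, P.coeff ℓ j * ∏ i, z (j i)

/-- The partial derivative `∂F/∂z_j`. -/
def partialDeriv {d : ℕ} {𝒩 : Set (Fin d → ℤ)} (F : EllOne 𝒩 → ℂ) (z : EllOne 𝒩)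
    (j : ModeIndex 𝒩) : ℂ :=
  lineDeriv ℂ F z (lp.single 1 j (1 : ℂ))

/-- The components of the Hamiltonian vector field: `-i ∂F/∂η_a` at `(a, 1)` and
`i ∂F/∂ξ_a` at `(a, -1)`. -/
def hamField {d : ℕ} {𝒩 : Set (Fin d → ℤ)} (F : EllOne 𝒩 → ℂ) (z : EllOne 𝒩)
    (j : ModeIndex 𝒩) : ℂ :=
  -Complex.I * ((j.2 : ℤ) : ℂ) * partialDeriv F z (conjIndex j)

/-- `FlowsTo F t x y` says that `Φ_F^t(x)` is defined and equal to `y`: there is a solution in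
`ℓ¹`, on `[0, t]`, of the Hamiltonian system of `F` that starts at `x` and ends at `y`. -/
def FlowsTo {d : ℕ} {𝒩 : Set (Fin d → ℤ)} (F : EllOne 𝒩 → ℂ) (t : ℝ) (x y : EllOne 𝒩) : Prop :=
  ∃ u : ℝ → EllOne 𝒩, u 0 = x ∧ u t = y ∧
    ∀ τ ∈ Set.Icc 0 t, ∃ v : EllOne 𝒩,
      HasDerivWithinAt u v (Set.Icc 0 t) τ ∧ ∀ j, v j = hamField F (u τ) j

/-- The time-one flow of `A₀ = ∑_a lam_a ξ_a η_a`: it multiplies `ξ_a` by `exp(-i lam_a)` and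
`η_a` by `exp(i lam_a)`. -/
def linearFlow {d : ℕ} {𝒩 : Set (Fin d → ℤ)} (lam : 𝒩 → ℝ) (z : EllOne 𝒩) : EllOne 𝒩 :=
  ⟨fun j => Complex.exp (-Complex.I * ((j.2 : ℤ) : ℂ) * (lam j.1 : ℂ)) * z j, by
    refine (lp.memℓp z).mono' fun j => le_of_eq ?_
    have h1 : -Complex.I * ((j.2 : ℤ) : ℂ) * (lam j.1 : ℂ)
        = ((-((j.2 : ℤ) : ℝ) * lam j.1 : ℝ) : ℂ) * Complex.I := by
      push_cast; ring
    rw [norm_mul, h1, Complex.norm_exp_ofReal_mul_I, one_mul]⟩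

/-- One step of the splitting scheme: `y = Φ_P^h (Φ_{A₀}^1 (z))`. -/
def SchemeStep {d : ℕ} {𝒩 : Set (Fin d → ℤ)} {k : ℕ} (P : PolyHam 𝒩 k) (lam : 𝒩 → ℝ) (h : ℝ)
    (z y : EllOne 𝒩) : Prop :=
  FlowsTo P.eval h (linearFlow lam z) y

/-- `Λ(j) = δ₁ lam_{a₁} + ⋯ + δ_ℓ lam_{a_ℓ}`. -/
def combFreq {d : ℕ} {𝒩 : Set (Fin d → ℤ)} (lam : 𝒩 → ℝ) {ℓ : ℕ} (j : Fin ℓ → ModeIndex 𝒩) : ℝ :=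
  ∑ i, ((j i).2 : ℤ) * lam (j i).1

/-- `i x / (exp(i x) - 1)`, continued by the value `1` at `x = 0`. -/
def bernoulliFactor (x : ℝ) : ℂ :=
  if x = 0 then 1 else Complex.I * x / (Complex.exp (Complex.I * x) - 1)

/-- The first modified energy
`∑_a h⁻¹ lam_a ξ_a η_a + ∑_{ℓ = 2}^k ∑_j (i Λ(j) / (exp(i Λ(j)) - 1)) a_j z_{j_1} ⋯ z_{j_ℓ}`. -/
def firstModifiedEnergy {d : ℕ} {𝒩 : Set (Fin d → ℤ)} {k : ℕ} (P : PolyHam 𝒩 k) (lam : 𝒩 → ℝ)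
    (h : ℝ) (z : EllOne 𝒩) : ℂ :=
  (∑' a : 𝒩, ((1 / h * lam a : ℝ) : ℂ) * (z (a, 1) * z (a, -1))) +
    ∑ ℓ ∈ Finset.Icc 2 k, ∑' j : Fin ℓ → ModeIndex 𝒩,
      bernoulliFactor (combFreq lam j) * P.coeff ℓ j * ∏ i, z (j i)

end SplittingBEA

end

namespace SplittingBEA

open Finset

noncomputable section

/-! ### Bigraded sequences and the Baker–Campbell–Hausdorff identity -/

/-! One step of the scheme is the time-one map of the linear field `A` (Hamiltonian A₀, of size
O(h^β) on balls) followed by that of the field of `B = hP` (of size O(h)). On functions this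
composition acts as exp(L_A) exp(L_B), formally the exponential of the Lie derivative along the
Baker–Campbell–Hausdorff series Z(A, B). Each bracket costs a derivative, that is, a loss of radius
in Cauchy's estimate. The series is therefore cut at a total degree N of order h^(-β), and the
modified Hamiltonian is h⁻¹ times the truncated sum (`bchSum`, `modifiedHam`).

Algebra. Everything is graded by the pair (degree in A, degree in B). Let E count the degree in B.
Then E(exp z) = exp(z) · ∑ (-ad z)^l (E z) / (l+1)!, so if that sum equals b and z reduces to a in
B-degree zero, the components of exp z satisfy the recursion of exp(a) exp(b) (`coeff_truncExp`).
Solving for E z is a fixed-point problem in which every bracket raises the degree; N iterations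
solve it up to degree N in any real Lie algebra (`bchDeriv_eq`), and the identity is transported to
Lie derivatives by a bracket homomorphism. The part linear in B is ∑ b_n (-ad A)^n B, with
generating function x / (exp x - 1) (`bchTerm_snd_one`).

Analysis. Fields are holomorphic. The component of bidegree p is measured on the ball of radius R -
|p|δ, and a bracket costs a factor 2/δ. The iteration then preserves a small weighted ℓ¹ bound
(`mass_bchTerm_le`). With δ = M/N all terms of degree at most N live on the ball of radius 3M. The
Lie series of the two sides agree in all words of degree at most N; Taylor remainders and longer
words are O(2^(-N)), which gives `splitting_error`. Since N is of order h^(-β), this is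
exponentially small.

Hamiltonian structure. Pairs of a Hamiltonian and its field form a Lie algebra (`bracket`). Zero
momentum makes the field of a polynomial with bounded coefficients map ℓ¹ to itself: once all
indices but one are fixed, at most two values of the last one contribute. Zero momentum is encoded
as invariance under torus rotations and reality as compatibility with a conjugation; both pass to
brackets, and coefficients are recovered from Taylor expansions (`exists_polyHam`).

Energies. The modified Hamiltonian is exactly conserved by its own flow and Lipschitz, so it drifts
exponentially little per step, hence over exponentially long times. On coefficients -ad A₀ is
multiplication by iΛ(j), so the part linear in P carries the factors iΛ/(exp(iΛ) - 1), up to an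
exponentially small tail. The part quadratic in B is O(h²), hence O(h) after division by h. This
compares the modified Hamiltonian with the first modified energy. -/

instance hasAntidiagonalBidegree : HasAntidiagonal (ℕ × ℕ) where
  antidiagonal p := ((antidiagonal p.1) ×ˢ (antidiagonal p.2)).image
    fun q => ((q.1.1, q.2.1), (q.1.2, q.2.2))
  mem_antidiagonal := by
    rintro ⟨n, m⟩ ⟨⟨a, b⟩, ⟨c, e⟩⟩
    simp only [mem_image, mem_product, HasAntidiagonal.mem_antidiagonal, Prod.mk.injEq, Prod.exists,
      Prod.mk_add_mk]
    constructor
    · rintro ⟨_, _, _, _, ⟨rfl, rfl⟩, ⟨rfl, rfl⟩, ⟨rfl, rfl⟩⟩; exact ⟨rfl, rfl⟩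
    · rintro ⟨rfl, rfl⟩; exact ⟨a, c, b, e, ⟨rfl, rfl⟩, ⟨rfl, rfl⟩, ⟨rfl, rfl⟩⟩

/-- The total degree of a bidegree. -/
def totalDeg (p : ℕ × ℕ) : ℕ := p.1 + p.2

lemma totalDeg_add (p q : ℕ × ℕ) : totalDeg (p + q) = totalDeg p + totalDeg q := by
  simp only [totalDeg, Prod.fst_add, Prod.snd_add]; ring

lemma totalDeg_antidiagonal {p : ℕ × ℕ} {q : (ℕ × ℕ) × (ℕ × ℕ)} (hq : q ∈ antidiagonal p) :
    totalDeg q.1 + totalDeg q.2 = totalDeg p := by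
  rw [← totalDeg_add, HasAntidiagonal.mem_antidiagonal.1 hq]

lemma totalDeg_eq_zero {p : ℕ × ℕ} : totalDeg p = 0 ↔ p = 0 := by
  rcases p with ⟨a, b⟩
  simp [totalDeg]

/-- The bidegrees of total degree at most `N`. -/
def bidegLE (N : ℕ) : Finset (ℕ × ℕ) :=
  (range (N + 1) ×ˢ range (N + 1)).filter fun p => totalDeg p ≤ N

lemma mem_bidegLE {N : ℕ} {p : ℕ × ℕ} : p ∈ bidegLE N ↔ totalDeg p ≤ N := by
  rw [bidegLE, Finset.mem_filter, Finset.mem_product, Finset.mem_range, Finset.mem_range]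
  unfold totalDeg
  omega

section BCH

lemma coeff_mul_bi {S : Type*} [Semiring S] (f g : AddMonoidAlgebra S (ℕ × ℕ)) (p : ℕ × ℕ) :
    (f * g).coeff p = ∑ q ∈ antidiagonal p, f.coeff q.1 * g.coeff q.2 :=
  AddMonoidAlgebra.coeff_mul_antidiag _ _ _ _ HasAntidiagonal.mem_antidiagonal

variable {S : Type*} [Ring S] [Algebra ℝ S]

/-- The Euler derivation counting the second degree. -/
def eulerSnd : AddMonoidAlgebra S (ℕ × ℕ) →ₗ[ℝ] AddMonoidAlgebra S (ℕ × ℕ) where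
  toFun f := .ofCoeff (Finsupp.onFinset f.coeff.support (fun p => (p.2 : ℝ) • f.coeff p)
    (fun p hp => by
      rw [Finsupp.mem_support_iff]; intro h0; exact hp (by rw [h0, smul_zero])))
  map_add' f g := by ext p; exact smul_add _ _ _
  map_smul' c f := by ext p; exact smul_comm _ _ _

lemma coeff_eulerSnd (f : AddMonoidAlgebra S (ℕ × ℕ)) (p : ℕ × ℕ) :
    (eulerSnd f).coeff p = (p.2 : ℝ) • f.coeff p := rfl

lemma eulerSnd_mul (f g : AddMonoidAlgebra S (ℕ × ℕ)) :
    eulerSnd (f * g) = eulerSnd f * g + f * eulerSnd g := by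
  ext p
  simp only [coeff_eulerSnd, AddMonoidAlgebra.coeff_add, Finsupp.add_apply, coeff_mul_bi,
    Finset.smul_sum, ← Finset.sum_add_distrib]
  refine Finset.sum_congr rfl fun q hq => ?_
  have h : q.1 + q.2 = p := HasAntidiagonal.mem_antidiagonal.1 hq
  rw [← h, Prod.snd_add, Nat.cast_add, add_smul, smul_mul_assoc, mul_smul_comm]

lemma eulerSnd_one : eulerSnd (1 : AddMonoidAlgebra S (ℕ × ℕ)) = 0 := by
  have := eulerSnd_mul (1 : AddMonoidAlgebra S (ℕ × ℕ)) 1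
  simpa using this

/-- Elements all of whose components have total degree at least `n`. -/
def orderGE (S : Type*) [Ring S] [Algebra ℝ S] (n : ℕ) :
    Submodule ℝ (AddMonoidAlgebra S (ℕ × ℕ)) where
  carrier := {f | ∀ p, totalDeg p < n → f.coeff p = 0}
  add_mem' := fun hf hg p hp => by simp [hf p hp, hg p hp]
  zero_mem' := fun p _ => rfl
  smul_mem' := fun c f hf p hp => by simp [hf p hp]

lemma mul_mem_orderGE {n m : ℕ} {f g : AddMonoidAlgebra S (ℕ × ℕ)} (hf : f ∈ orderGE S n)
    (hg : g ∈ orderGE S m) : f * g ∈ orderGE S (n + m) := by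
  intro p hp
  rw [coeff_mul_bi]
  refine Finset.sum_eq_zero fun q hq => ?_
  have h := totalDeg_antidiagonal hq
  by_cases h1 : totalDeg q.1 < n
  · rw [hf _ h1, zero_mul]
  · rw [hg _ (by omega), mul_zero]

lemma orderGE_mono {n m : ℕ} (h : n ≤ m) : orderGE S m ≤ orderGE S n :=
  fun _ hf p hp => hf p (hp.trans_le h)

lemma eulerSnd_mem_orderGE {n : ℕ} {f : AddMonoidAlgebra S (ℕ × ℕ)} (hf : f ∈ orderGE S n) :
    eulerSnd f ∈ orderGE S n := fun p hp => by rw [coeff_eulerSnd, hf p hp, smul_zero]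

/-- The operator `g ↦ g z - z g`. -/
def negAd (z : AddMonoidAlgebra S (ℕ × ℕ)) : Module.End ℝ (AddMonoidAlgebra S (ℕ × ℕ)) :=
  LinearMap.mulRight ℝ z - LinearMap.mulLeft ℝ z

lemma negAd_apply (z g : AddMonoidAlgebra S (ℕ × ℕ)) : negAd z g = g * z - z * g := rfl

lemma commute_mulLeft_negAd (z : AddMonoidAlgebra S (ℕ × ℕ)) :
    Commute (LinearMap.mulLeft ℝ z) (negAd z) :=
  (LinearMap.commute_mulLeft_right (R := ℝ) z z).sub_right (Commute.refl _)

lemma negAd_pow_mem_orderGE {z f : AddMonoidAlgebra S (ℕ × ℕ)} (hz : z ∈ orderGE S 1) {n : ℕ}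
    (hf : f ∈ orderGE S n) (l : ℕ) : (negAd z ^ l) f ∈ orderGE S (n + l) := by
  induction l with
  | zero => simpa using hf
  | succ l ih =>
    rw [pow_succ', Module.End.mul_apply, negAd_apply]
    refine Submodule.sub_mem _ (mul_mem_orderGE (m := 1) ih hz) ?_
    have := mul_mem_orderGE hz ih
    rwa [add_comm 1] at this

lemma mulLeft_pow_mem_orderGE {z f : AddMonoidAlgebra S (ℕ × ℕ)} (hz : z ∈ orderGE S 1) {n : ℕ}
    (hf : f ∈ orderGE S n) (l : ℕ) : (LinearMap.mulLeft ℝ z ^ l) f ∈ orderGE S (n + l) := by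
  induction l with
  | zero => simpa using hf
  | succ l ih =>
    rw [pow_succ', Module.End.mul_apply, LinearMap.mulLeft_apply]
    have := mul_mem_orderGE hz ih
    rwa [add_comm 1] at this

/-- Noncommutative derivative of a power. Right multiplication by `z` is `negAd z` plus left
multiplication by `z`, and these commute, so the binomial theorem moves all factors `z` to the left
of E z. Pascal's rule closes the induction. -/
lemma eulerSnd_pow (z : AddMonoidAlgebra S (ℕ × ℕ)) (k : ℕ) :
    eulerSnd (z ^ k) = ∑ l ∈ range k, ((k.choose (l + 1) : ℕ) : ℝ) •
      (LinearMap.mulLeft ℝ z ^ (k - 1 - l)) ((negAd z ^ l) (eulerSnd z)) := by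
  induction k with
  | zero => simp [eulerSnd_one]
  | succ k ih =>
    have hR : eulerSnd z * z ^ k = ∑ l ∈ range (k + 1), ((k.choose l : ℕ) : ℝ) •
        (LinearMap.mulLeft ℝ z ^ (k - l)) ((negAd z ^ l) (eulerSnd z)) := by
      have h1 : eulerSnd z * z ^ k = ((negAd z + LinearMap.mulLeft ℝ z) ^ k) (eulerSnd z) := by
        rw [negAd, sub_add_cancel, LinearMap.pow_mulRight, LinearMap.mulRight_apply]
      rw [h1, (commute_mulLeft_negAd z).symm.add_pow, LinearMap.sum_apply]
      refine Finset.sum_congr rfl fun l _ => ?_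
      rw [((commute_mulLeft_negAd z).symm.pow_pow l (k - l)).eq, ← nsmul_eq_mul',
        LinearMap.smul_apply, Module.End.mul_apply, Nat.cast_smul_eq_nsmul]
    rw [pow_succ', eulerSnd_mul, hR, ih, Finset.mul_sum, add_comm]
    have h2 : ∑ l ∈ range k, z * (((k.choose (l + 1) : ℕ) : ℝ) •
        (LinearMap.mulLeft ℝ z ^ (k - 1 - l)) ((negAd z ^ l) (eulerSnd z)))
        = ∑ l ∈ range (k + 1), ((k.choose (l + 1) : ℕ) : ℝ) •
          (LinearMap.mulLeft ℝ z ^ (k - l)) ((negAd z ^ l) (eulerSnd z)) := by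
      rw [Finset.sum_range_succ, Nat.choose_succ_self, Nat.cast_zero, zero_smul, add_zero]
      refine Finset.sum_congr rfl fun l hl => ?_
      have hl' := Finset.mem_range.1 hl
      rw [mul_smul_comm, show k - l = (k - 1 - l) + 1 by omega, pow_succ', Module.End.mul_apply,
        LinearMap.mulLeft_apply]
    rw [h2, ← Finset.sum_add_distrib]
    refine Finset.sum_congr rfl fun l _ => ?_
    rw [← add_smul, Nat.choose_succ_succ, Nat.cast_add, add_comm ((k.choose (l + 1) : ℕ) : ℝ),
      Nat.add_sub_cancel, add_comm]

/-- The truncated exponential series. -/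
def truncExp (N : ℕ) (z : AddMonoidAlgebra S (ℕ × ℕ)) : AddMonoidAlgebra S (ℕ × ℕ) :=
  ∑ k ∈ range (N + 1), ((k.factorial : ℝ)⁻¹) • z ^ k

lemma eulerSnd_truncExp (N : ℕ) (z : AddMonoidAlgebra S (ℕ × ℕ)) :
    eulerSnd (truncExp N z) =
      ∑ x ∈ (range (N + 1) ×ˢ range (N + 1)).filter (fun x => x.1 + x.2 < N),
        ((x.1.factorial : ℝ)⁻¹ * ((x.2 + 1).factorial : ℝ)⁻¹) •
          (LinearMap.mulLeft ℝ z ^ x.1) ((negAd z ^ x.2) (eulerSnd z)) := by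
  simp only [truncExp, map_sum, map_smul, eulerSnd_pow, Finset.smul_sum, smul_smul]
  rw [Finset.sum_sigma']
  refine Finset.sum_nbij' (fun x => (x.1 - 1 - x.2, x.2)) (fun x => ⟨x.1 + x.2 + 1, x.2⟩) ?_ ?_ ?_
    ?_ ?_
  · rintro ⟨k, l⟩ h
    simp only [mem_sigma, mem_range, mem_filter, mem_product] at h ⊢
    omega
  · rintro ⟨j, l⟩ h
    simp only [mem_sigma, mem_range, mem_filter, mem_product] at h ⊢
    omega
  · rintro ⟨k, l⟩ h
    simp only [mem_sigma, mem_range] at h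
    simp only [Sigma.mk.injEq, heq_eq_eq, and_true]
    omega
  · rintro ⟨j, l⟩ h
    simp only [Prod.mk.injEq, and_true]
    omega
  · rintro ⟨k, l⟩ h
    simp only [mem_sigma, mem_range] at h
    -- (1/k!) · C(k, l+1) = 1 / ((k-1-l)! (l+1)!), so the double sum becomes a truncated product of
    -- two exponential-type series.
    have h3 := Nat.choose_mul_factorial_mul_factorial (show l + 1 ≤ k by omega)
    rw [show k - (l + 1) = k - 1 - l by omega] at h3
    congr 1
    rw [← h3]
    push_cast
    have h4 : ((k.choose (l + 1) : ℕ) : ℝ) ≠ 0 := by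
      exact_mod_cast (Nat.choose_pos (show l + 1 ≤ k by omega)).ne'
    field_simp

/-- Truncated form of E(exp z) = exp(z) · ∑ (-ad z)^l (E z)/(l+1)!, combined with the hypothesis
that the last sum is `b` up to degree `N`. -/
lemma eulerSnd_truncExp_sub_mem {N : ℕ} {z b : AddMonoidAlgebra S (ℕ × ℕ)} (hz : z ∈ orderGE S 1)
    (heq : ∑ l ∈ range (N + 1), (((l + 1).factorial : ℝ)⁻¹) • (negAd z ^ l) (eulerSnd z) - b
      ∈ orderGE S (N + 1)) :
    eulerSnd (truncExp N z) - truncExp N z * b ∈ orderGE S (N + 1) := by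
  set W := ∑ l ∈ range (N + 1), (((l + 1).factorial : ℝ)⁻¹) • (negAd z ^ l) (eulerSnd z) with hW
  have hu := eulerSnd_mem_orderGE hz
  have h1 : truncExp N z * W = ∑ x ∈ range (N + 1) ×ˢ range (N + 1),
      ((x.1.factorial : ℝ)⁻¹ * ((x.2 + 1).factorial : ℝ)⁻¹) •
          (LinearMap.mulLeft ℝ z ^ x.1) ((negAd z ^ x.2) (eulerSnd z)) := by
    rw [truncExp, hW, Finset.sum_mul_sum, Finset.sum_product]
    refine Finset.sum_congr rfl fun j _ => Finset.sum_congr rfl fun l _ => ?_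
    rw [smul_mul_smul_comm, LinearMap.pow_mulLeft, LinearMap.mulLeft_apply]
  -- The product contains all pairs of exponents up to `N`, the derivative only those with sum below
  -- `N`. A surplus term contains E z and at least `N` factors `z`, so its order is at least `N +
  -- 1`.
  have h2 : truncExp N z * W - eulerSnd (truncExp N z) ∈ orderGE S (N + 1) := by
    rw [h1, eulerSnd_truncExp, ← Finset.sum_filter_add_sum_filter_not _
      (fun x : ℕ × ℕ => x.1 + x.2 < N), add_sub_cancel_left]
    refine Submodule.sum_mem _ fun x hx => Submodule.smul_mem _ _ ?_
    refine orderGE_mono ?_ (mulLeft_pow_mem_orderGE hz (negAd_pow_mem_orderGE hz hu x.2) x.1)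
    simp only [mem_filter] at hx
    omega
  have h3 : truncExp N z * (W - b) ∈ orderGE S (N + 1) := by
    have h0 : truncExp N z ∈ orderGE S 0 := fun p hp => absurd hp (Nat.not_lt_zero _)
    simpa using mul_mem_orderGE h0 heq
  have h4 := Submodule.sub_mem _ h3 h2
  rwa [mul_sub, sub_sub_sub_cancel_left] at h4

lemma coeff_pow_snd_zero {S : Type*} [Ring S] {z : AddMonoidAlgebra S (ℕ × ℕ)} {a : S} {N : ℕ}
    (hza : ∀ n ≤ N, z.coeff (n, 0) = if n = 1 then a else 0) (k n : ℕ) (hn : n ≤ N) :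
    (z ^ k).coeff (n, 0) = if n = k then a ^ k else 0 := by
  induction k generalizing n with
  | zero =>
    simp [AddMonoidAlgebra.one_def, Finsupp.single_apply, eq_comm (a := (0 : ℕ × ℕ)),
      Prod.ext_iff]
  | succ k ih =>
    rw [pow_succ', coeff_mul_bi]
    have h : ∀ q ∈ antidiagonal ((n, 0) : ℕ × ℕ), z.coeff q.1 * (z ^ k).coeff q.2 =
        if q = ((1, 0), (k, 0)) then a * a ^ k else 0 := by
      rintro ⟨⟨q1, q2⟩, ⟨q3, q4⟩⟩ hq
      have hq' := HasAntidiagonal.mem_antidiagonal.1 hq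
      simp only [Prod.mk_add_mk, Prod.mk.injEq] at hq'
      obtain ⟨h1, h2⟩ := hq'
      obtain ⟨rfl, rfl⟩ : q2 = 0 ∧ q4 = 0 := by omega
      rw [hza q1 (by omega), ih q3 (by omega)]
      simp only [Prod.mk.injEq, and_true]
      by_cases h3 : q1 = 1 <;> by_cases h4 : q3 = k <;> simp [h3, h4]
    rw [Finset.sum_congr rfl h, Finset.sum_ite_eq', pow_succ']
    congr 1
    simp only [HasAntidiagonal.mem_antidiagonal, Prod.mk_add_mk, Prod.mk.injEq, add_zero, and_true,
      eq_iff_iff]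
    omega

/-- If `z` solves the truncated Baker–Campbell–Hausdorff equation, the components of total degree
at most `N` of its exponential are those of `exp a * exp b`. -/
lemma coeff_truncExp {N : ℕ} {z : AddMonoidAlgebra S (ℕ × ℕ)} {a b : S} (hz : z ∈ orderGE S 1)
    (hza : ∀ n ≤ N, z.coeff (n, 0) = if n = 1 then a else 0)
    (heq : ∑ l ∈ range (N + 1), (((l + 1).factorial : ℝ)⁻¹) • (negAd z ^ l) (eulerSnd z)
      - AddMonoidAlgebra.single (0, 1) b ∈ orderGE S (N + 1)) (n m : ℕ) (h : n + m ≤ N) :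
    (truncExp N z).coeff (n, m) =
      ((n.factorial : ℝ)⁻¹ * (m.factorial : ℝ)⁻¹) • (a ^ n * b ^ m) := by
  have key := eulerSnd_truncExp_sub_mem hz heq
  induction m with
  | zero =>
    have h1 : ∀ k ∈ range (N + 1), (((k.factorial : ℝ)⁻¹) • z ^ k).coeff (n, 0) =
        if n = k then ((n.factorial : ℝ)⁻¹) • a ^ n else 0 := by
      intro k _
      rw [AddMonoidAlgebra.coeff_smul_apply, coeff_pow_snd_zero hza k n (by omega)]
      split_ifs with hk
      · rw [hk]
      · rw [smul_zero]
    rw [truncExp, AddMonoidAlgebra.coeff_sum, Finsupp.finsetSum_apply, Finset.sum_congr rfl h1,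
      Finset.sum_ite_eq, if_pos (Finset.mem_range.2 (by omega))]
    simp
  | succ m ih =>
    -- Comparing components in E(exp z) = exp(z) b: (m+1) times the coefficient at (n, m+1) equals
    -- the coefficient at (n, m) times b.
    have h1 := key (n, m + 1) (by simp only [totalDeg]; omega)
    rw [AddMonoidAlgebra.coeff_sub, Finsupp.sub_apply, sub_eq_zero, coeff_eulerSnd,
      AddMonoidAlgebra.coeff_mul_single_eq_coeff_mul (m₂ := (n, m)), ih (by omega)] at h1
    · have h2 : ((m + 1 : ℕ) : ℝ) ≠ 0 := by positivity
      have h3 : (truncExp N z).coeff (n, m + 1) = ((m + 1 : ℕ) : ℝ)⁻¹ •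
          (((m + 1 : ℕ) : ℝ) • (truncExp N z).coeff (n, m + 1)) := by
        rw [smul_smul, inv_mul_cancel₀ h2, one_smul]
      rw [h3, h1, smul_mul_assoc, smul_smul, mul_assoc, ← pow_succ, Nat.factorial_succ]
      congr 1
      push_cast
      rw [mul_inv]
      ring
    · rintro ⟨p1, p2⟩ _
      simp

end BCH

end

end SplittingBEA

namespace SplittingBEA

open Finset

noncomputable section

/-! ### The Baker–Campbell–Hausdorff recursion in a real Lie algebra -/

section Recursion

variable {L : Type*} [AddCommGroup L] [Module ℝ L]

/-- Minus the convolution of two families for the bilinear bracket `br`. -/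
def negBr (br : L →ₗ[ℝ] L →ₗ[ℝ] L) (Z G : ℕ × ℕ → L) (p : ℕ × ℕ) : L :=
  -∑ q ∈ antidiagonal p, br (Z q.1) (G q.2)

/-- The family with Euler derivative `U` and with `A` as its only component of second degree
zero. -/
def eulerPrimitive (A : L) (U : ℕ × ℕ → L) (p : ℕ × ℕ) : L :=
  if p.2 = 0 then (if p.1 = 1 then A else 0) else (p.2 : ℝ)⁻¹ • U p

/-- One step of the fixed-point iteration for the Baker–Campbell–Hausdorff equation. -/
def bchStep (br : L →ₗ[ℝ] L →ₗ[ℝ] L) (A B : L) (N : ℕ) (U : ℕ × ℕ → L) (p : ℕ × ℕ) : L :=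
  (if p = (0, 1) then B else 0) - ∑ l ∈ range N,
    (((l + 2).factorial : ℝ)⁻¹) • (negBr br (eulerPrimitive A U))^[l + 1] U p

/-- The Euler derivative of the Baker–Campbell–Hausdorff series of `A` and `B`, correct up to the
total degree `N`. -/
def bchDeriv (br : L →ₗ[ℝ] L →ₗ[ℝ] L) (A B : L) (N : ℕ) : ℕ × ℕ → L :=
  (bchStep br A B N)^[N] (fun _ => 0)

/-- The Baker–Campbell–Hausdorff series of `A` and `B`, correct up to the total degree `N`. -/
def bchTerm (br : L →ₗ[ℝ] L →ₗ[ℝ] L) (A B : L) (N : ℕ) : ℕ × ℕ → L :=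
  eulerPrimitive A (bchDeriv br A B N)

variable (br : L →ₗ[ℝ] L →ₗ[ℝ] L) (A B : L) (N : ℕ)

lemma eulerPrimitive_zero (U : ℕ × ℕ → L) : eulerPrimitive A U 0 = 0 := by
  simp [eulerPrimitive]

lemma negBr_snd_zero {Z G : ℕ × ℕ → L} (hG : ∀ n, G (n, 0) = 0) (n : ℕ) :
    negBr br Z G (n, 0) = 0 := by
  rw [negBr, neg_eq_zero]
  refine Finset.sum_eq_zero ?_
  rintro ⟨⟨q1, q2⟩, ⟨q3, q4⟩⟩ hq
  have hq' := HasAntidiagonal.mem_antidiagonal.1 hq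
  simp only [Prod.mk_add_mk, Prod.mk.injEq] at hq'
  obtain rfl : q4 = 0 := by omega
  simp [hG]

lemma negBr_iterate_snd_zero {Z G : ℕ × ℕ → L} (hG : ∀ n, G (n, 0) = 0) (l n : ℕ) :
    (negBr br Z)^[l] G (n, 0) = 0 := by
  induction l generalizing n with
  | zero => exact hG n
  | succ l ih => rw [Function.iterate_succ_apply']; exact negBr_snd_zero br ih n

lemma bchStep_snd_zero {U : ℕ × ℕ → L} (hU : ∀ n, U (n, 0) = 0) (n : ℕ) :
    bchStep br A B N U (n, 0) = 0 := by
  rw [bchStep, if_neg (by simp), zero_sub, neg_eq_zero]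
  exact Finset.sum_eq_zero fun l _ => by rw [negBr_iterate_snd_zero br hU, smul_zero]

lemma bchStep_iterate_snd_zero (i n : ℕ) :
    (bchStep br A B N)^[i] (fun _ => 0) (n, 0) = 0 := by
  induction i generalizing n with
  | zero => rfl
  | succ i ih => rw [Function.iterate_succ_apply']; exact bchStep_snd_zero br A B N ih n

/-- A bracket gains one degree of accuracy: both families vanish at bidegree zero, so each factor in
a component of degree at most i+1 has degree at most i. -/
lemma negBr_congr {Z Z' G G' : ℕ × ℕ → L} {i : ℕ} (hZ : ∀ p, totalDeg p ≤ i → Z p = Z' p)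
    (hG : ∀ p, totalDeg p ≤ i → G p = G' p) (hZ0 : Z 0 = 0) (hG0 : G 0 = 0)
    (p : ℕ × ℕ) (hp : totalDeg p ≤ i + 1) : negBr br Z G p = negBr br Z' G' p := by
  have hZ0' : Z' 0 = 0 := by rw [← hZ 0 (by simp [totalDeg]), hZ0]
  have hG0' : G' 0 = 0 := by rw [← hG 0 (by simp [totalDeg]), hG0]
  rw [negBr, negBr, neg_inj]
  refine Finset.sum_congr rfl fun q hq => ?_
  have h := totalDeg_antidiagonal hq
  by_cases h1 : totalDeg q.1 = 0
  · rw [totalDeg_eq_zero.1 h1, hZ0, hZ0']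
    simp
  by_cases h2 : totalDeg q.2 = 0
  · rw [totalDeg_eq_zero.1 h2, hG0, hG0']
    simp
  rw [hZ _ (by omega), hG _ (by omega)]

lemma negBr_iterate_congr {Z Z' G G' : ℕ × ℕ → L} {i : ℕ}
    (hZ : ∀ p, totalDeg p ≤ i → Z p = Z' p)
    (hG : ∀ p, totalDeg p ≤ i → G p = G' p) (hZ0 : Z 0 = 0) (hG0 : ∀ n, G (n, 0) = 0) (l : ℕ)
    (p : ℕ × ℕ) (hp : totalDeg p ≤ i + 1) :
    (negBr br Z)^[l + 1] G p = (negBr br Z')^[l + 1] G' p := by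
  induction l generalizing p with
  | zero => exact negBr_congr br hZ hG hZ0 (hG0 0) p hp
  | succ l ih =>
    rw [Function.iterate_succ_apply' _ (l + 1), Function.iterate_succ_apply' _ (l + 1)]
    exact negBr_congr br hZ (fun p hp => ih p (by omega)) hZ0
      (negBr_iterate_snd_zero br hG0 _ 0) p hp

/-- All terms of `bchStep` except the constant `B` contain a bracket, so each iteration fixes the
components of one further total degree. Hence `N` iterations give a fixed point up to degree `N`. -/
lemma bchStep_iterate_stable (i : ℕ) (p : ℕ × ℕ) (hp : totalDeg p ≤ i) :
    (bchStep br A B N)^[i + 1] (fun _ => 0) p = (bchStep br A B N)^[i] (fun _ => 0) p := by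
  induction i generalizing p with
  | zero =>
    obtain rfl := totalDeg_eq_zero.1 (Nat.le_zero.1 hp)
    exact bchStep_iterate_snd_zero br A B N 1 0
  | succ i ih =>
    rw [Function.iterate_succ_apply' _ (i + 1), Function.iterate_succ_apply' _ i]
    rw [bchStep, bchStep]
    rw [Function.iterate_succ_apply'] at ih
    congr 1
    refine Finset.sum_congr rfl fun l _ => ?_
    congr 1
    refine negBr_iterate_congr br (i := i) (fun q hq => ?_) ih (eulerPrimitive_zero _ _)
      (fun n => ?_) l p hp
    · simp only [eulerPrimitive, ih q hq]
    · rw [← Function.iterate_succ_apply' (bchStep br A B N)]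
      exact bchStep_iterate_snd_zero br A B N _ n

lemma bchDeriv_snd_zero (n : ℕ) : bchDeriv br A B N (n, 0) = 0 :=
  bchStep_iterate_snd_zero br A B N N n

lemma bchTerm_snd_zero (n : ℕ) : bchTerm br A B N (n, 0) = if n = 1 then A else 0 := by
  simp [bchTerm, eulerPrimitive]

lemma smul_bchTerm (p : ℕ × ℕ) : (p.2 : ℝ) • bchTerm br A B N p = bchDeriv br A B N p := by
  rcases p with ⟨n, m⟩
  by_cases h : m = 0
  · subst h
    simp [bchDeriv_snd_zero]
  · have : (m : ℝ) ≠ 0 := by exact_mod_cast h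
    simp [bchTerm, eulerPrimitive, h, smul_smul]

lemma bchDeriv_eq (p : ℕ × ℕ) (hp : totalDeg p ≤ N) :
    ∑ l ∈ range (N + 1), (((l + 1).factorial : ℝ)⁻¹) •
      (negBr br (bchTerm br A B N))^[l] (bchDeriv br A B N) p = if p = (0, 1) then B else 0 := by
  have h := bchStep_iterate_stable br A B N N p hp
  rw [Function.iterate_succ_apply', bchStep, sub_eq_iff_eq_add] at h
  rw [h, Finset.sum_range_succ', add_comm]
  simp [bchDeriv, bchTerm]

lemma sum_antidiagonal_swap_bi {M : Type*} [AddCommMonoid M]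
    (f : (ℕ × ℕ) × (ℕ × ℕ) → M) (p : ℕ × ℕ) :
    ∑ q ∈ antidiagonal p, f q = ∑ q ∈ antidiagonal p, f q.swap :=
  Finset.sum_equiv (Equiv.prodComm _ _) (fun q => by
    rw [HasAntidiagonal.mem_antidiagonal, HasAntidiagonal.mem_antidiagonal, add_comm]; rfl) fun _ _ => by simp

section Transport

variable {S : Type*} [Ring S] [Algebra ℝ S] (D : L →ₗ[ℝ] S)

/-- The truncated image of a family in a bigraded algebra. -/
def famAlg (Z : ℕ × ℕ → L) : AddMonoidAlgebra S (ℕ × ℕ) :=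
  ∑ p ∈ bidegLE N, AddMonoidAlgebra.single p (D (Z p))

lemma coeff_famAlg (Z : ℕ × ℕ → L) (p : ℕ × ℕ) :
    (famAlg N D Z).coeff p = if totalDeg p ≤ N then D (Z p) else 0 := by
  rw [famAlg, AddMonoidAlgebra.coeff_sum, Finsupp.finsetSum_apply]
  simp only [AddMonoidAlgebra.coeff_single, Finsupp.single_apply]
  rw [Finset.sum_ite_eq']
  simp only [mem_bidegLE]

/-- Cutting the image of the series at degree `N` is harmless: a component of degree at most `N` of
a product uses only factors of degree at most `N`. -/
lemma coeff_negAd_pow_famAlg (hD : ∀ x y, D (br x y) = D x * D y - D y * D x)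
    (l : ℕ) (p : ℕ × ℕ) (hp : totalDeg p ≤ N) :
    ((negAd (famAlg N D (bchTerm br A B N)) ^ l)
      (eulerSnd (famAlg N D (bchTerm br A B N)))).coeff p =
      D ((negBr br (bchTerm br A B N))^[l] (bchDeriv br A B N) p) := by
  induction l generalizing p with
  | zero =>
    rw [pow_zero, Module.End.one_apply, coeff_eulerSnd, coeff_famAlg, if_pos hp, ← map_smul,
      smul_bchTerm, Function.iterate_zero, id]
  | succ l ih =>
    rw [pow_succ', Module.End.mul_apply, negAd_apply, AddMonoidAlgebra.coeff_sub,
      Finsupp.sub_apply, coeff_mul_bi, coeff_mul_bi, Function.iterate_succ_apply', negBr, map_neg,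
      map_sum, ← Finset.sum_neg_distrib, sum_antidiagonal_swap_bi,
      ← Finset.sum_sub_distrib]
    refine Finset.sum_congr rfl fun q hq => ?_
    have h := totalDeg_antidiagonal hq
    rw [hD, coeff_famAlg, Prod.fst_swap, Prod.snd_swap, ih q.2 (by omega), coeff_famAlg,
      if_pos (by omega), neg_sub]

/-- Under a map `D` that turns brackets into commutators, the series solves the truncated equation
in the associative algebra. It will be applied to Hamiltonians acting by Lie derivatives; no Jacobi
identity for `br` is needed, only `D`. -/
lemma coeff_truncExp_bch (hD : ∀ x y, D (br x y) = D x * D y - D y * D x)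
    (n m : ℕ) (h : n + m ≤ N) :
    (truncExp N (famAlg N D (bchTerm br A B N))).coeff (n, m) =
      ((n.factorial : ℝ)⁻¹ * (m.factorial : ℝ)⁻¹) • (D A ^ n * D B ^ m) := by
  refine coeff_truncExp (fun p hp => ?_) (fun k hk => ?_) (fun p hp => ?_) n m h
  · rw [totalDeg_eq_zero.1 (by omega : totalDeg p = 0), coeff_famAlg]
    simp [bchTerm, eulerPrimitive_zero]
  · rw [coeff_famAlg, if_pos (by simpa [totalDeg] using hk), bchTerm_snd_zero]
    split_ifs <;> simp
  · have hp' : totalDeg p ≤ N := by omega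
    have h1 := congrArg D (bchDeriv_eq br A B N p hp')
    rw [map_sum] at h1
    rw [AddMonoidAlgebra.coeff_sub, Finsupp.sub_apply, sub_eq_zero, AddMonoidAlgebra.coeff_sum,
      Finsupp.finsetSum_apply, AddMonoidAlgebra.coeff_single, Finsupp.single_apply]
    simp only [AddMonoidAlgebra.coeff_smul_apply]
    rw [Finset.sum_congr rfl fun l _ => by
      rw [coeff_negAd_pow_famAlg br A B N D hD l p hp', ← map_smul], h1]
    simp only [eq_comm (a := p)]
    split_ifs <;> simp

end Transport

/-- The power series `(exp x - 1) / x`. -/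
def expQuotSeries : PowerSeries ℝ := PowerSeries.mk fun l => (((l + 1).factorial : ℝ)⁻¹)

/-- The Taylor coefficients of `x / (exp x - 1)`. -/
def bernoulliCoeff (n : ℕ) : ℝ := PowerSeries.coeff n expQuotSeries⁻¹

lemma sum_bernoulliCoeff (n : ℕ) :
    ∑ l ∈ range (n + 1), (((l + 1).factorial : ℝ)⁻¹) * bernoulliCoeff (n - l) =
      if n = 0 then 1 else 0 := by
  have h : expQuotSeries * expQuotSeries⁻¹ = 1 := PowerSeries.mul_inv_cancel _ (by
    simp [expQuotSeries, ← PowerSeries.coeff_zero_eq_constantCoeff_apply])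
  have h2 := congrArg (PowerSeries.coeff n) h
  rw [PowerSeries.coeff_mul, PowerSeries.coeff_one,
    Finset.Nat.sum_antidiagonal_eq_sum_range_succ_mk] at h2
  simpa [expQuotSeries, bernoulliCoeff] using h2

/-- In B-degree one, and with `G` without B-degree zero, the first factor must have B-degree zero.
The only such component of the series is `A`, so the convolution reduces to -ad A. -/
lemma negBr_snd_one {G : ℕ × ℕ → L} (hG : ∀ n, G (n, 0) = 0) (n : ℕ) :
    negBr br (bchTerm br A B N) G (n, 1) = if n = 0 then 0 else -br A (G (n - 1, 1)) := by
  have h : ∀ q ∈ antidiagonal ((n, 1) : ℕ × ℕ), br (bchTerm br A B N q.1) (G q.2) =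
      if q = ((1, 0), (n - 1, 1)) then br A (G (n - 1, 1)) else 0 := by
    rintro ⟨⟨q1, q2⟩, ⟨q3, q4⟩⟩ hq
    have hq' := HasAntidiagonal.mem_antidiagonal.1 hq
    simp only [Prod.mk_add_mk, Prod.mk.injEq] at hq'
    by_cases h4 : q4 = 0
    · subst h4
      rw [hG, if_neg (by simp)]
      simp
    obtain ⟨rfl, rfl⟩ : q2 = 0 ∧ q4 = 1 := by omega
    rw [bchTerm_snd_zero]
    by_cases h1 : q1 = 1
    · obtain rfl : q3 = n - 1 := by omega
      simp [h1]
    · simp [h1]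
  rw [negBr, Finset.sum_congr rfl h, Finset.sum_ite_eq']
  by_cases hn : n = 0
  · subst hn
    rw [if_neg]
    · simp
    · simp [HasAntidiagonal.mem_antidiagonal]
  · rw [if_pos (HasAntidiagonal.mem_antidiagonal.2 (Prod.ext
      (show 1 + (n - 1) = n by omega) (zero_add 1))), if_neg hn]

lemma negBr_iterate_snd_one (l n : ℕ) :
    (negBr br (bchTerm br A B N))^[l] (bchDeriv br A B N) (n, 1) =
      if l ≤ n then ((-br A) ^ l) (bchDeriv br A B N (n - l, 1)) else 0 := by
  induction l generalizing n with
  | zero => simp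
  | succ l ih =>
    rw [Function.iterate_succ_apply', negBr_snd_one br A B N
      (negBr_iterate_snd_zero br (bchDeriv_snd_zero br A B N) l), ih]
    by_cases hn : n = 0
    · simp [hn]
    · rw [if_neg hn]
      by_cases hl : l + 1 ≤ n
      · rw [if_pos (by omega), if_pos hl, pow_succ', Module.End.mul_apply, LinearMap.neg_apply,
          show n - 1 - l = n - (l + 1) by omega]
      · rw [if_neg (by omega), if_neg hl]
        simp

/-- The part of the Baker–Campbell–Hausdorff series that is linear in `B`. -/
lemma bchTerm_snd_one (n : ℕ) (hn : n + 1 ≤ N) :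
    bchTerm br A B N (n, 1) = bernoulliCoeff n • ((-br A) ^ n) B := by
  have hU : bchTerm br A B N (n, 1) = bchDeriv br A B N (n, 1) := by
    rw [← smul_bchTerm]; simp
  rw [hU]
  clear hU
  induction n using Nat.strong_induction_on with
  | _ n ih =>
    have h := bchDeriv_eq br A B N (n, 1) (by simpa [totalDeg] using hn)
    have h1 : ∀ l ∈ range (N + 1), (((l + 1).factorial : ℝ)⁻¹) •
        (negBr br (bchTerm br A B N))^[l] (bchDeriv br A B N) (n, 1) =
        if l ∈ range (n + 1) then (((l + 1).factorial : ℝ)⁻¹) •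
          ((-br A) ^ l) (bchDeriv br A B N (n - l, 1)) else 0 := by
      intro l _
      rw [negBr_iterate_snd_one]
      simp only [Finset.mem_range, Nat.lt_succ_iff]
      split_ifs <;> simp
    rw [Finset.sum_congr rfl h1, Finset.sum_ite_mem,
      Finset.inter_eq_right.2 (Finset.range_subset_range.2 (by omega)), Finset.sum_range_succ'] at h
    have h2 := sum_bernoulliCoeff n
    rw [Finset.sum_range_succ'] at h2
    have h3 : ∀ l ∈ range n, (((l + 1 + 1).factorial : ℝ)⁻¹) •
        ((-br A) ^ (l + 1)) (bchDeriv br A B N (n - (l + 1), 1)) =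
        ((((l + 1 + 1).factorial : ℝ)⁻¹) * bernoulliCoeff (n - (l + 1))) • ((-br A) ^ n) B := by
      intro l hl
      have hl' := Finset.mem_range.1 hl
      rw [ih (n - (l + 1)) (by omega) (by omega), map_smul, ← Module.End.mul_apply, ← pow_add,
        show l + 1 + (n - (l + 1)) = n by omega, smul_smul]
    rw [Finset.sum_congr rfl h3, ← Finset.sum_smul] at h
    simp only [zero_add, Nat.factorial_one, Nat.cast_one, inv_one, one_smul, pow_zero,
      Module.End.one_apply, Nat.sub_zero, one_mul, Prod.mk.injEq, and_true] at h h2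
    -- The fixed-point equation in B-degree one is the recursion that inverts (exp x - 1)/x,
    -- evaluated at x = -ad A.
    have h5 : bernoulliCoeff n = (if n = 0 then 1 else 0) -
        ∑ l ∈ range n, (((l + 1 + 1).factorial : ℝ)⁻¹) * bernoulliCoeff (n - (l + 1)) := by
      rw [← h2]; ring
    rw [h5, sub_smul, eq_sub_iff_add_eq, add_comm, h]
    split_ifs with h0
    · subst h0; simp
    · simp

end Recursion

end

end SplittingBEA

namespace SplittingBEA

open Finset
open scoped ENNReal ContDiff

noncomputable section

/-! ### Lie derivatives of smooth maps and sup norms on balls -/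

section Smooth

variable (E : Type*) [NormedAddCommGroup E] [NormedSpace ℂ E]

/-- The space of infinitely differentiable maps of a complex normed space to itself. -/
def SmoothMap : Submodule ℝ (E → E) where
  carrier := {f | ContDiff ℂ ∞ f}
  add_mem' hf hg := ContDiff.add (𝕜 := ℂ) (n := ∞) hf hg
  zero_mem' := (contDiff_const : ContDiff ℂ ∞ fun _ : E => (0 : E))
  smul_mem' c f hf := by
    have h := ContDiff.const_smul (c : ℂ) (show ContDiff ℂ ∞ f from hf)
    have h2 : (fun y => (c : ℂ) • f y) = c • f := by
      ext y; exact Complex.coe_smul c (f y)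
    exact h2 ▸ h

variable {E}

instance : CoeFun (SmoothMap E) fun _ => E → E := ⟨fun f => f.1⟩

lemma SmoothMap.contDiff (f : SmoothMap E) : ContDiff ℂ ∞ (f : E → E) := f.2

lemma SmoothMap.differentiable (f : SmoothMap E) : Differentiable ℂ (f : E → E) :=
  (SmoothMap.contDiff f).differentiable (by simp)

@[simp] lemma SmoothMap.add_apply (f g : SmoothMap E) (z : E) : (f + g) z = f z + g z := rfl

@[simp] lemma SmoothMap.sub_apply (f g : SmoothMap E) (z : E) : (f - g) z = f z - g z := rfl

@[simp] lemma SmoothMap.neg_apply (f : SmoothMap E) (z : E) : (-f) z = -f z := rfl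

@[simp] lemma SmoothMap.zero_apply (z : E) : (0 : SmoothMap E) z = 0 := rfl

@[simp] lemma SmoothMap.smul_apply (c : ℝ) (f : SmoothMap E) (z : E) : (c • f) z = c • f z := rfl

lemma SmoothMap.sum_apply {ι : Type*} (s : Finset ι) (f : ι → SmoothMap E) (z : E) :
    (∑ i ∈ s, f i : SmoothMap E) z = ∑ i ∈ s, f i z := by
  rw [AddSubmonoidClass.coe_finsetSum, Finset.sum_apply]

lemma contDiff_fderiv_apply {F : Type*} [NormedAddCommGroup F] [NormedSpace ℂ F] {G : E → F}
    {X : E → E} (hG : ContDiff ℂ ∞ G) (hX : ContDiff ℂ ∞ X) :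
    ContDiff ℂ ∞ fun z => fderiv ℂ G z (X z) :=
  (hG.fderiv_right (m := ∞) (by simp)).clm_apply hX

/-- The Lie derivative along a vector field, as an operator on smooth maps. -/
def lieDer : SmoothMap E →ₗ[ℝ] Module.End ℝ (SmoothMap E) where
  toFun X :=
    { toFun := fun F => ⟨fun z => fderiv ℂ F z (X z), contDiff_fderiv_apply F.2 X.2⟩
      map_add' := fun F G => by
        ext z
        change fderiv ℂ ((F : E → E) + (G : E → E)) z (X z) = _
        rw [fderiv_add (SmoothMap.differentiable F z) (SmoothMap.differentiable G z)]
        rfl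
      map_smul' := fun c F => by
        ext z
        change fderiv ℂ (c • (F : E → E)) z (X z) = _
        rw [fderiv_const_smul (SmoothMap.differentiable F z)]
        rfl }
  map_add' X Y := by
    ext F z
    exact map_add (fderiv ℂ F z) (X z) (Y z)
  map_smul' c X := by
    ext F z
    change fderiv ℂ F z (c • X z) = c • fderiv ℂ F z (X z)
    rw [← Complex.coe_smul, ← Complex.coe_smul, map_smul]

lemma lieDer_apply (X F : SmoothMap E) (z : E) : lieDer X F z = fderiv ℂ F z (X z) := rfl

/-- The second-derivative terms in the commutator cancel because the second derivative of `F` is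
symmetric. -/
lemma lieDer_bracket (X Y : SmoothMap E) :
    lieDer (lieDer X Y - lieDer Y X) = lieDer X * lieDer Y - lieDer Y * lieDer X := by
  ext F z
  have hsymm : IsSymmSndFDerivAt ℂ F z :=
    (SmoothMap.contDiff F).contDiffAt.isSymmSndFDerivAt (by
      rw [minSmoothness_of_isRCLikeNormedField]; exact ENat.LEInfty.out)
  have hd : ∀ Y : SmoothMap E, fderiv ℂ (fun z => fderiv ℂ F z (Y z)) z =
      (fderiv ℂ F z).comp (fderiv ℂ Y z) + (fderiv ℂ (fderiv ℂ F) z).flip (Y z) := fun Y =>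
    fderiv_clm_apply (((SmoothMap.contDiff F).fderiv_right (m := ∞) (by simp)).differentiable (by simp) z)
      (SmoothMap.differentiable Y z)
  change fderiv ℂ F z (fderiv ℂ Y z (X z) - fderiv ℂ X z (Y z)) =
    fderiv ℂ (fun z => fderiv ℂ F z (Y z)) z (X z) - fderiv ℂ (fun z => fderiv ℂ F z (X z)) z (Y z)
  rw [hd X, hd Y, map_sub]
  simp only [_root_.add_apply, ContinuousLinearMap.comp_apply,
    ContinuousLinearMap.flip_apply]
  rw [hsymm.eq (X z) (Y z)]
  abel

section BallNorm

variable {E F : Type*} [NormedAddCommGroup E] [NormedAddCommGroup F]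

/-- The supremum of `‖f‖` on the open ball of radius `r` about the origin. -/
def ballNorm (r : ℝ) (f : E → F) : ℝ≥0∞ := ⨆ z ∈ Metric.ball (0 : E) r, ‖f z‖ₑ

lemma enorm_le_ballNorm {r : ℝ} {f : E → F} {z : E} (hz : z ∈ Metric.ball (0 : E) r) :
    ‖f z‖ₑ ≤ ballNorm r f := le_iSup₂_of_le (f := fun z _ => ‖f z‖ₑ) z hz le_rfl

lemma ballNorm_le {r : ℝ} {f : E → F} {c : ℝ≥0∞}
    (h : ∀ z ∈ Metric.ball (0 : E) r, ‖f z‖ₑ ≤ c) : ballNorm r f ≤ c := iSup₂_le h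

lemma ballNorm_mono {r R : ℝ} (h : r ≤ R) (f : E → F) : ballNorm r f ≤ ballNorm R f :=
  ballNorm_le fun _ hz => enorm_le_ballNorm (Metric.ball_subset_ball h hz)

lemma norm_le_of_ballNorm_le {r c : ℝ} (hc : 0 ≤ c) {f : E → F}
    (h : ballNorm r f ≤ ENNReal.ofReal c) {z : E} (hz : ‖z‖ < r) : ‖f z‖ ≤ c := by
  have h1 := (enorm_le_ballNorm (f := f) (mem_ball_zero_iff.2 hz)).trans h
  rwa [← ofReal_norm, ENNReal.ofReal_le_ofReal_iff hc] at h1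

lemma ballNorm_le_ofReal {r c : ℝ} {f : E → F} (h : ∀ z, ‖z‖ < r → ‖f z‖ ≤ c) :
    ballNorm r f ≤ ENNReal.ofReal c := ballNorm_le fun z hz => by
  rw [← ofReal_norm]
  exact ENNReal.ofReal_le_ofReal (h z (mem_ball_zero_iff.1 hz))

end BallNorm

lemma ballNorm_zero (r : ℝ) : ballNorm r (0 : SmoothMap E) = 0 := by
  rw [← nonpos_iff_eq_zero]
  exact ballNorm_le fun z _ => by simp

lemma ballNorm_add_le (r : ℝ) (f g : SmoothMap E) :
    ballNorm r (f + g : SmoothMap E) ≤ ballNorm r f + ballNorm r g :=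
  ballNorm_le fun _ hz => (enorm_add_le _ _).trans
    (add_le_add (enorm_le_ballNorm hz) (enorm_le_ballNorm hz))

lemma ballNorm_neg (r : ℝ) (f : SmoothMap E) : ballNorm r (-f : SmoothMap E) = ballNorm r f := by
  simp only [ballNorm, SmoothMap.neg_apply, enorm_neg]

lemma ballNorm_sub_le (r : ℝ) (f g : SmoothMap E) :
    ballNorm r (f - g : SmoothMap E) ≤ ballNorm r f + ballNorm r g := by
  rw [sub_eq_add_neg, ← ballNorm_neg r g]
  exact ballNorm_add_le r f (-g)

lemma ballNorm_sum_le {ι : Type*} (r : ℝ) (s : Finset ι) (f : ι → SmoothMap E) :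
    ballNorm r (∑ i ∈ s, f i : SmoothMap E) ≤ ∑ i ∈ s, ballNorm r (f i) := by
  classical
  induction s using Finset.induction_on with
  | empty => exact (ballNorm_zero r).le
  | insert i s hi ih =>
    rw [Finset.sum_insert hi, Finset.sum_insert hi]
    exact (ballNorm_add_le _ _ _).trans (add_le_add le_rfl ih)

lemma ballNorm_smul_le (r c : ℝ) (f : SmoothMap E) :
    ballNorm r (c • f : SmoothMap E) ≤ ‖c‖ₑ * ballNorm r f :=
  ballNorm_le fun z hz => by
    rw [SmoothMap.smul_apply, enorm_smul]
    exact mul_le_mul' le_rfl (enorm_le_ballNorm hz)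

variable {F : Type*} [NormedAddCommGroup F] [NormedSpace ℂ F]

/-- Cauchy's estimate for the derivative. -/
lemma enorm_fderiv_apply_le {f : E → F} (hf : Differentiable ℂ f) {r R δ : ℝ} (hδ : 0 < δ)
    (hR : r + δ ≤ R) {z : E} (hz : z ∈ Metric.ball (0 : E) r) (v : E) :
    ‖fderiv ℂ f z v‖ₑ ≤ ‖v‖ₑ * ballNorm R f / ENNReal.ofReal δ := by
  by_cases hv : v = 0
  · simp [hv]
  by_cases htop : ballNorm R f = ⊤
  · rw [htop, ENNReal.mul_top (by simpa [enorm_eq_zero] using hv), ENNReal.top_div_of_ne_top (by simp)]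
    exact le_top
  have hv' : 0 < ‖v‖ := norm_pos_iff.2 hv
  set C := (ballNorm R f).toReal
  have hC : ballNorm R f = ENNReal.ofReal C := (ENNReal.ofReal_toReal htop).symm
  have hd : ∀ t : ℂ, HasDerivAt (fun t : ℂ => f (z + t • v)) (fderiv ℂ f (z + t • v) v) t := by
    intro t
    have h1 : HasDerivAt (fun t : ℂ => z + t • v) v t := by
      simpa using ((hasDerivAt_id t).smul_const v).const_add z
    exact (hf (z + t • v)).hasFDerivAt.comp_hasDerivAt t h1
  -- The disc |t| ≤ δ/‖v‖ in the complex line through `z` in direction `v` stays inside the ball of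
  -- radius `R`, so the one-variable Cauchy estimate applies.
  have key : ‖deriv (fun t : ℂ => f (z + t • v)) 0‖ ≤ C / (δ / ‖v‖) := by
    refine Complex.norm_deriv_le_of_forall_mem_sphere_norm_le (by positivity)
      (Differentiable.diffContOnCl fun t => (hd t).differentiableAt) fun t ht => ?_
    refine norm_le_of_ballNorm_le ENNReal.toReal_nonneg hC.le ?_
    have ht' : ‖t‖ = δ / ‖v‖ := by simpa using ht
    calc ‖z + t • v‖ ≤ ‖z‖ + ‖t • v‖ := norm_add_le _ _
      _ = ‖z‖ + δ := by rw [norm_smul, ht', div_mul_cancel₀ _ hv'.ne']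
      _ < r + δ := by linarith [mem_ball_zero_iff.1 hz]
      _ ≤ R := hR
  rw [(hd 0).deriv, zero_smul, add_zero] at key
  rw [← ofReal_norm, hC, ← ofReal_norm, ← ENNReal.ofReal_mul hv'.le,
    ← ENNReal.ofReal_div_of_pos hδ]
  refine ENNReal.ofReal_le_ofReal (key.trans (le_of_eq ?_))
  field_simp

lemma ballNorm_lieDer_le (X G : SmoothMap E) {r R δ : ℝ} (hδ : 0 < δ) (hR : r + δ ≤ R) :
    ballNorm r (lieDer X G) ≤ ballNorm r X * ballNorm R G / ENNReal.ofReal δ :=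
  ballNorm_le fun z hz => by
    rw [lieDer_apply]
    refine (enorm_fderiv_apply_le (SmoothMap.differentiable G) hδ hR hz (X z)).trans ?_
    exact ENNReal.div_le_div_right (mul_le_mul' (enorm_le_ballNorm hz) le_rfl) _

/-- Each Lie derivative differentiates its argument once and so shrinks the radius by `δ`. The field
`X` itself is not differentiated and is bounded on the largest ball throughout. -/
lemma ballNorm_lieDer_pow_le (X G : SmoothMap E) {r R δ : ℝ} (hδ : 0 < δ) (hR : r ≤ R) (k : ℕ) :
    ballNorm (r - k * δ) ((lieDer X ^ k) G) ≤
      (ballNorm R X / ENNReal.ofReal δ) ^ k * ballNorm r G := by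
  induction k with
  | zero => simp
  | succ k ih =>
    rw [pow_succ', Module.End.mul_apply]
    refine (ballNorm_lieDer_le X _ (R := r - k * δ) hδ (by push_cast; linarith)).trans ?_
    have h1 : ballNorm (r - (k + 1 : ℕ) * δ) X ≤ ballNorm R X := by
      refine ballNorm_mono ?_ _
      have : 0 ≤ ((k + 1 : ℕ) : ℝ) * δ := by positivity
      linarith
    calc ballNorm (r - (k + 1 : ℕ) * δ) X * ballNorm (r - k * δ) ((lieDer X ^ k) G) /
          ENNReal.ofReal δ
        ≤ ballNorm R X * ((ballNorm R X / ENNReal.ofReal δ) ^ k * ballNorm r G) /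
          ENNReal.ofReal δ := by gcongr
      _ = _ := by rw [pow_succ', div_eq_mul_inv, div_eq_mul_inv]; ring

end Smooth

end

end SplittingBEA

namespace SplittingBEA

open Finset
open scoped ENNReal ContDiff

noncomputable section

lemma tsum_antidiagonal_mul (f g : ℕ × ℕ → ℝ≥0∞) :
    ∑' p : ℕ × ℕ, ∑ q ∈ antidiagonal p, f q.1 * g q.2 = (∑' p, f p) * ∑' p, g p := by
  have h1 : (∑' p, f p) * ∑' p, g p = ∑' q : (ℕ × ℕ) × (ℕ × ℕ), f q.1 * g q.2 := by
    rw [ENNReal.tsum_prod (f := fun a b : ℕ × ℕ => f a * g b), ← ENNReal.tsum_mul_right]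
    exact tsum_congr fun p => ENNReal.tsum_mul_left.symm
  rw [h1, ← (Finset.HasAntidiagonal.sigmaAntidiagonalEquivProd (A := ℕ × ℕ)).tsum_eq, ENNReal.tsum_sigma']
  refine tsum_congr fun p => ?_
  rw [← Finset.tsum_subtype]
  rfl

/-! ### Majorant estimates for the series on shrinking balls -/

section Mass

variable {E : Type*} [NormedAddCommGroup E] [NormedSpace ℂ E]
variable {L : Type*} [AddCommGroup L] [Module ℝ L] (br : L →ₗ[ℝ] L →ₗ[ℝ] L)
  (fld : L →ₗ[ℝ] SmoothMap E)

/-- The weighted sum of the norms of the components of a family, the component of bidegree `p`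
being measured on the ball of radius `R - |p| δ`. -/
def mass (R δ : ℝ) (ρ σ : ℝ≥0∞) (Z : ℕ × ℕ → L) : ℝ≥0∞ :=
  ∑' p : ℕ × ℕ, ρ ^ p.1 * σ ^ p.2 * ballNorm (R - totalDeg p * δ) (fld (Z p))

variable {br} {fld}

lemma ballNorm_br_le (hfld : ∀ x y, fld (br x y) = lieDer (fld x) (fld y) - lieDer (fld y) (fld x))
    {δ r r₁ r₂ : ℝ} (hδ : 0 < δ) (h₁ : r + δ ≤ r₁) (h₂ : r + δ ≤ r₂) (x y : L) :
    ballNorm r (fld (br x y)) ≤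
      2 / ENNReal.ofReal δ * (ballNorm r₁ (fld x) * ballNorm r₂ (fld y)) := by
  rw [hfld]
  refine (ballNorm_sub_le _ _ _).trans ?_
  calc ballNorm r (lieDer (fld x) (fld y)) + ballNorm r (lieDer (fld y) (fld x))
      ≤ ballNorm r₁ (fld x) * ballNorm r₂ (fld y) / ENNReal.ofReal δ +
        ballNorm r₂ (fld y) * ballNorm r₁ (fld x) / ENNReal.ofReal δ := by
        refine add_le_add ((ballNorm_lieDer_le _ _ hδ h₂).trans ?_)
          ((ballNorm_lieDer_le _ _ hδ h₁).trans ?_)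
        · gcongr
          exact ballNorm_mono (by linarith) _
        · gcongr
          exact ballNorm_mono (by linarith) _
    _ = _ := by rw [div_eq_mul_inv, div_eq_mul_inv, div_eq_mul_inv]; ring

/-- Because both families vanish at bidegree zero, each factor of a component of degree |p| has
degree at most |p| - 1 and is controlled on a ball larger by at least `δ`. This pays for the one
derivative in the bracket; the weights are multiplicative, so the sums factor. -/
lemma mass_negBr_le
    (hfld : ∀ x y, fld (br x y) = lieDer (fld x) (fld y) - lieDer (fld y) (fld x))
    {R δ : ℝ} (hδ : 0 < δ) (ρ σ : ℝ≥0∞) {Z G : ℕ × ℕ → L} (hZ : Z 0 = 0) (hG : G 0 = 0) :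
    mass fld R δ ρ σ (negBr br Z G) ≤
      2 / ENNReal.ofReal δ * (mass fld R δ ρ σ Z * mass fld R δ ρ σ G) := by
  rw [mass, mass, mass, ← tsum_antidiagonal_mul, ← ENNReal.tsum_mul_left]
  refine ENNReal.tsum_le_tsum fun p => ?_
  have h1 : ballNorm (R - totalDeg p * δ) (fld (negBr br Z G p)) ≤
      ∑ q ∈ antidiagonal p, 2 / ENNReal.ofReal δ *
        (ballNorm (R - totalDeg q.1 * δ) (fld (Z q.1)) *
          ballNorm (R - totalDeg q.2 * δ) (fld (G q.2))) := by
    rw [negBr, map_neg, map_sum, ballNorm_neg]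
    refine (ballNorm_sum_le _ _ _).trans (Finset.sum_le_sum fun q hq => ?_)
    have hq' := totalDeg_antidiagonal hq
    by_cases h1 : totalDeg q.1 = 0
    · rw [totalDeg_eq_zero.1 h1, hZ, map_zero, LinearMap.zero_apply, map_zero, ballNorm_zero]
      exact zero_le
    by_cases h2 : totalDeg q.2 = 0
    · rw [totalDeg_eq_zero.1 h2, hG, map_zero, map_zero, ballNorm_zero]
      exact zero_le
    refine ballNorm_br_le hfld hδ ?_ ?_ _ _
    · have : ((totalDeg q.1 : ℕ) : ℝ) + 1 ≤ totalDeg p := by exact_mod_cast (by omega)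
      nlinarith
    · have : ((totalDeg q.2 : ℕ) : ℝ) + 1 ≤ totalDeg p := by exact_mod_cast (by omega)
      nlinarith
  refine (mul_le_mul' le_rfl h1).trans (le_of_eq ?_)
  rw [Finset.mul_sum, Finset.mul_sum]
  refine Finset.sum_congr rfl fun q hq => ?_
  have hq' : q.1 + q.2 = p := HasAntidiagonal.mem_antidiagonal.1 hq
  rw [← hq', Prod.fst_add, Prod.snd_add, pow_add, pow_add]
  ring

/-- Passing from E Z back to Z divides by the B-degree, which is at least one, and adds the single
component `A`. -/
lemma mass_eulerPrimitive_le (R δ : ℝ) (ρ σ : ℝ≥0∞) (A : L) (U : ℕ × ℕ → L) :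
    mass fld R δ ρ σ (eulerPrimitive A U) ≤
      ρ * ballNorm (R - δ) (fld A) + mass fld R δ ρ σ U := by
  have h0 : ∑' p : ℕ × ℕ, (if p = (1, 0) then ρ * ballNorm (R - δ) (fld A) else 0) =
      ρ * ballNorm (R - δ) (fld A) := tsum_ite_eq _ _
  rw [← h0, mass, mass, ← ENNReal.tsum_add]
  refine ENNReal.tsum_le_tsum fun p => ?_
  rcases p with ⟨n, m⟩
  by_cases hm : m = 0
  · subst hm
    by_cases hn : n = 1
    · subst hn
      refine le_add_right (le_of_eq ?_)
      simp [eulerPrimitive, totalDeg]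
    · refine le_add_left (mul_le_mul' le_rfl ?_)
      simp only [eulerPrimitive, if_true, hn, if_false, map_zero, ballNorm_zero]
      exact zero_le
  · refine le_add_left (mul_le_mul' le_rfl ?_)
    simp only [eulerPrimitive, hm, if_false, map_smul]
    refine (ballNorm_smul_le _ _ _).trans (mul_le_of_le_one_left' ?_)
    rw [← ofReal_norm, ENNReal.ofReal_le_one, norm_inv, Real.norm_natCast]
    exact inv_le_one_of_one_le₀ (by exact_mod_cast Nat.one_le_iff_ne_zero.2 hm)

lemma mass_negBr_iterate_le
    (hfld : ∀ x y, fld (br x y) = lieDer (fld x) (fld y) - lieDer (fld y) (fld x))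
    {R δ : ℝ} (hδ : 0 < δ) (ρ σ : ℝ≥0∞) {Z G : ℕ × ℕ → L} (hZ : Z 0 = 0)
    (hG : ∀ n, G (n, 0) = 0) (l : ℕ) :
    mass fld R δ ρ σ ((negBr br Z)^[l] G) ≤
      (2 / ENNReal.ofReal δ * mass fld R δ ρ σ Z) ^ l * mass fld R δ ρ σ G := by
  induction l with
  | zero => simp
  | succ l ih =>
    rw [Function.iterate_succ_apply']
    refine (mass_negBr_le hfld hδ ρ σ hZ (negBr_iterate_snd_zero br hG l 0)).trans ?_
    rw [← mul_assoc, pow_succ', mul_assoc (2 / ENNReal.ofReal δ * mass fld R δ ρ σ Z)]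
    exact mul_le_mul' le_rfl ih

lemma sum_two_inv_pow_le (N : ℕ) : ∑ l ∈ range N, (2⁻¹ : ℝ≥0∞) ^ (l + 1) ≤ 1 := by
  have h : ∑ l ∈ range N, (2⁻¹ : ℝ≥0∞) ^ (l + 1) + 2⁻¹ ^ N = 1 := by
    induction N with
    | zero => simp
    | succ N ih =>
      rw [Finset.sum_range_succ, add_assoc, pow_succ, ← mul_add, ENNReal.inv_two_add_inv_two,
        mul_one, ih]
  rw [← h]
  exact le_self_add

/-- In units of δ/2 the bound 1/4 for E Z is invariant under the iteration: then Z has size at most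
1/4 + 1/4 = 1/2, and the new iterate has size at most 1/8 from `B` plus ∑ (1/2)(1/2)^(l+1)(1/4) ≤
1/8 from the brackets. The factor 1/2 is the bound for 1/(l+2)!. -/
lemma mass_bch_aux
    (hfld : ∀ x y, fld (br x y) = lieDer (fld x) (fld y) - lieDer (fld y) (fld x))
    {R δ : ℝ} (hδ : 0 < δ) {ρ σ : ℝ≥0∞} {A B : L}
    (hA : 2 / ENNReal.ofReal δ * (ρ * ballNorm (R - δ) (fld A)) ≤ 4⁻¹)
    (hB : 2 / ENNReal.ofReal δ * (σ * ballNorm (R - δ) (fld B)) ≤ 8⁻¹) (N i : ℕ) :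
    2 / ENNReal.ofReal δ * mass fld R δ ρ σ ((bchStep br A B N)^[i] (fun _ => 0)) ≤ 4⁻¹ ∧
    2 / ENNReal.ofReal δ * mass fld R δ ρ σ
      (eulerPrimitive A ((bchStep br A B N)^[i] (fun _ => 0))) ≤ 2⁻¹ := by
  have hstep : ∀ U : ℕ × ℕ → L, 2 / ENNReal.ofReal δ * mass fld R δ ρ σ U ≤ 4⁻¹ →
      2 / ENNReal.ofReal δ * mass fld R δ ρ σ (eulerPrimitive A U) ≤ 2⁻¹ := by
    intro U hU
    refine (mul_le_mul' le_rfl (mass_eulerPrimitive_le R δ ρ σ A U)).trans ?_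
    rw [mul_add]
    refine (add_le_add hA hU).trans (le_of_eq ?_)
    rw [← two_mul, show (4 : ℝ≥0∞) = 2 * 2 by norm_num, ENNReal.mul_inv (by simp) (by simp),
      ← mul_assoc, ENNReal.mul_inv_cancel (by simp) (by simp), one_mul]
  suffices h : 2 / ENNReal.ofReal δ *
      mass fld R δ ρ σ ((bchStep br A B N)^[i] (fun _ => 0)) ≤ 4⁻¹ from ⟨h, hstep _ h⟩
  induction i with
  | zero =>
    have : mass fld R δ ρ σ (fun _ => (0 : L)) = 0 := by
      simp only [mass, map_zero, ballNorm_zero, mul_zero, tsum_zero]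
    rw [Function.iterate_zero, id, this, mul_zero]
    exact zero_le
  | succ i ih =>
    rw [Function.iterate_succ_apply']
    set U := (bchStep br A B N)^[i] (fun _ => 0) with hUdef
    have hU0 : ∀ n, U (n, 0) = 0 := bchStep_iterate_snd_zero br A B N i
    set Z := eulerPrimitive A U with hZdef
    have hZ := hstep U ih
    have h1 : mass fld R δ ρ σ (bchStep br A B N U) ≤ σ * ballNorm (R - δ) (fld B) +
        ∑ l ∈ range N, 2⁻¹ * mass fld R δ ρ σ ((negBr br Z)^[l + 1] U) := by
      have h0 : ∑' p : ℕ × ℕ, (if p = (0, 1) then σ * ballNorm (R - δ) (fld B) else 0) =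
        σ * ballNorm (R - δ) (fld B) := tsum_ite_eq _ _
      rw [← h0]
      simp only [mass, ← ENNReal.tsum_mul_left]
      rw [← Summable.tsum_finsetSum (fun _ _ => ENNReal.summable), ← ENNReal.tsum_add]
      refine ENNReal.tsum_le_tsum fun p => ?_
      rw [bchStep, map_sub, map_sum]
      refine (mul_le_mul' le_rfl (ballNorm_sub_le _ _ _)).trans ?_
      rw [mul_add]
      refine add_le_add ?_ ?_
      · by_cases hp : p = (0, 1)
        · subst hp
          simp [totalDeg]
        · simp only [hp, if_false, map_zero, ballNorm_zero, mul_zero]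
          exact le_rfl
      · refine (mul_le_mul' le_rfl (ballNorm_sum_le _ _ _)).trans ?_
        rw [Finset.mul_sum]
        refine Finset.sum_le_sum fun l _ => ?_
        rw [map_smul]
        refine (mul_le_mul' le_rfl (ballNorm_smul_le _ _ _)).trans ?_
        have h2 : ‖((l + 2).factorial : ℝ)⁻¹‖ₑ ≤ 2⁻¹ := by
          rw [← ofReal_norm, norm_inv, Real.norm_natCast, ENNReal.ofReal_inv_of_pos
            (by exact_mod_cast Nat.factorial_pos _), ENNReal.ofReal_natCast, ENNReal.inv_le_inv]
          exact_mod_cast (Nat.self_le_factorial (l + 2)).trans' (by omega)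
        calc ρ ^ p.1 * σ ^ p.2 * (‖((l + 2).factorial : ℝ)⁻¹‖ₑ *
              ballNorm (R - totalDeg p * δ) (fld ((negBr br Z)^[l + 1] U p)))
            ≤ ρ ^ p.1 * σ ^ p.2 * (2⁻¹ *
              ballNorm (R - totalDeg p * δ) (fld ((negBr br Z)^[l + 1] U p))) := by gcongr
          _ = _ := by ring
    refine (mul_le_mul' le_rfl h1).trans ?_
    rw [mul_add, Finset.mul_sum]
    have h3 : ∀ l ∈ range N, 2 / ENNReal.ofReal δ *
        (2⁻¹ * mass fld R δ ρ σ ((negBr br Z)^[l + 1] U)) ≤ 8⁻¹ * 2⁻¹ ^ (l + 1) := by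
      intro l _
      calc 2 / ENNReal.ofReal δ * (2⁻¹ * mass fld R δ ρ σ ((negBr br Z)^[l + 1] U))
          ≤ 2 / ENNReal.ofReal δ * (2⁻¹ * ((2 / ENNReal.ofReal δ * mass fld R δ ρ σ Z) ^ (l + 1) *
              mass fld R δ ρ σ U)) := by
            gcongr
            exact mass_negBr_iterate_le hfld hδ ρ σ (eulerPrimitive_zero _ _) hU0 _
        _ = 2⁻¹ * (2 / ENNReal.ofReal δ * mass fld R δ ρ σ Z) ^ (l + 1) *
              (2 / ENNReal.ofReal δ * mass fld R δ ρ σ U) := by ring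
        _ ≤ 2⁻¹ * 2⁻¹ ^ (l + 1) * 4⁻¹ := by gcongr
        _ = 8⁻¹ * 2⁻¹ ^ (l + 1) := by
            rw [show (8 : ℝ≥0∞) = 2 * 4 by norm_num, ENNReal.mul_inv (by simp) (by simp)]; ring
    calc _ ≤ 8⁻¹ + ∑ l ∈ range N, 8⁻¹ * (2⁻¹ : ℝ≥0∞) ^ (l + 1) :=
          add_le_add hB (Finset.sum_le_sum h3)
      _ ≤ 8⁻¹ + 8⁻¹ * 1 := by
          rw [← Finset.mul_sum]
          gcongr
          exact sum_two_inv_pow_le N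
      _ = 4⁻¹ := by
          rw [mul_one, ← two_mul, show (8 : ℝ≥0∞) = 2 * 4 by norm_num,
            ENNReal.mul_inv (by simp) (by simp), ← mul_assoc,
            ENNReal.mul_inv_cancel (by simp) (by simp), one_mul]

/-- The majorant estimate for the Baker–Campbell–Hausdorff series. -/
lemma mass_bchTerm_le
    (hfld : ∀ x y, fld (br x y) = lieDer (fld x) (fld y) - lieDer (fld y) (fld x))
    {R δ : ℝ} (hδ : 0 < δ) {ρ σ : ℝ≥0∞} {A B : L}
    (hA : 2 / ENNReal.ofReal δ * (ρ * ballNorm (R - δ) (fld A)) ≤ 4⁻¹)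
    (hB : 2 / ENNReal.ofReal δ * (σ * ballNorm (R - δ) (fld B)) ≤ 8⁻¹) (N : ℕ) :
    mass fld R δ ρ σ (bchTerm br A B N) ≤ ENNReal.ofReal δ / 4 := by
  have h := (mass_bch_aux hfld hδ hA hB N N).2
  have hδ' : ENNReal.ofReal δ ≠ 0 := by simpa using hδ
  have h2 : ENNReal.ofReal δ / 2 * (2 / ENNReal.ofReal δ *
      mass fld R δ ρ σ (bchTerm br A B N)) = mass fld R δ ρ σ (bchTerm br A B N) := by
    rw [← mul_assoc, ← ENNReal.inv_div (by simp) (by simp), ENNReal.inv_mul_cancel, one_mul]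
    · simp [ENNReal.div_eq_zero_iff]
    · exact ENNReal.div_ne_top (by simp) hδ'
  rw [← h2]
  refine (mul_le_mul' le_rfl h).trans (le_of_eq ?_)
  rw [show (4 : ℝ≥0∞) = 2 * 2 by norm_num, div_eq_mul_inv, div_eq_mul_inv,
    ENNReal.mul_inv (by simp) (by simp), mul_assoc]

end Mass

end

end SplittingBEA

namespace SplittingBEA

open Finset
open scoped ENNReal ContDiff

noncomputable section

/-! ### Products of Lie derivatives graded by bidegree -/

section Words

variable {E : Type*} [NormedAddCommGroup E] [NormedSpace ℂ E]

/-- The sum of all components of an element of a bigraded algebra. -/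
def evalOne (S : Type*) [Ring S] : AddMonoidAlgebra S (ℕ × ℕ) →+* S :=
  AddMonoidAlgebra.liftNCRingHom (RingHom.id S) 1 fun _ _ => Commute.one_right _

lemma evalOne_single {S : Type*} [Ring S] (p : ℕ × ℕ) (x : S) :
    evalOne S (AddMonoidAlgebra.single p x) = x := by
  rw [evalOne, AddMonoidAlgebra.liftNCRingHom_single]
  simp

lemma evalOne_eq_sum {S : Type*} [Ring S] (f : AddMonoidAlgebra S (ℕ × ℕ)) (s : Finset (ℕ × ℕ))
    (hs : f.coeff.support ⊆ s) : evalOne S f = ∑ p ∈ s, f.coeff p := by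
  conv_lhs => rw [← AddMonoidAlgebra.sum_coeff_single f]
  rw [Finsupp.sum, map_sum]
  simp only [evalOne_single]
  refine Finset.sum_subset hs fun p _ hp => ?_
  simpa using hp

lemma evalOne_smul {S : Type*} [Ring S] [Algebra ℝ S] (c : ℝ) (f : AddMonoidAlgebra S (ℕ × ℕ)) :
    evalOne S (c • f) = c • evalOne S f := by
  rw [evalOne_eq_sum _ f.coeff.support
    (by rw [AddMonoidAlgebra.coeff_smul]; exact Finsupp.support_smul),
    evalOne_eq_sum f _ subset_rfl, Finset.smul_sum]
  rfl

lemma evalOne_truncExp {S : Type*} [Ring S] [Algebra ℝ S] (N : ℕ)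
    (z : AddMonoidAlgebra S (ℕ × ℕ)) : evalOne S (truncExp N z) =
      ∑ k ∈ range (N + 1), ((k.factorial : ℝ)⁻¹) • evalOne S z ^ k := by
  simp only [truncExp, map_sum, evalOne_smul, map_pow]

/-- The component of z^k at `p` is the sum of all words of `k` Lie derivatives with bidegrees adding
up to `p`. Each letter costs one radius `δ`, and the weight 2^|p| is multiplicative, so the weighted
sum over words is bounded by a k-th power. -/
lemma tsum_words_le {z : AddMonoidAlgebra (Module.End ℝ (SmoothMap E)) (ℕ × ℕ)}
    {X : ℕ × ℕ → SmoothMap E} (hz : ∀ p, z.coeff p = lieDer (X p)) (G : SmoothMap E) {R δ : ℝ}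
    (hδ : 0 < δ) (k : ℕ) :
    ∑' p : ℕ × ℕ, 2 ^ totalDeg p * ballNorm (R - k * δ) ((z ^ k).coeff p G) ≤
      ((∑' p : ℕ × ℕ, 2 ^ totalDeg p * ballNorm R (X p)) / ENNReal.ofReal δ) ^ k *
        ballNorm R G := by
  induction k with
  | zero =>
    rw [tsum_eq_single 0]
    · simp [AddMonoidAlgebra.one_def, totalDeg]
    · intro p hp
      rw [pow_zero, AddMonoidAlgebra.one_def, AddMonoidAlgebra.coeff_single,
        Finsupp.single_eq_of_ne hp, LinearMap.zero_apply, ballNorm_zero, mul_zero]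
  | succ k ih =>
    rw [pow_succ' (_ / _), mul_assoc]
    refine le_trans ?_ (mul_le_mul' le_rfl ih)
    rw [div_eq_mul_inv, mul_right_comm, ← tsum_antidiagonal_mul, ← ENNReal.tsum_mul_right]
    refine ENNReal.tsum_le_tsum fun p => ?_
    rw [pow_succ', coeff_mul_bi, LinearMap.sum_apply]
    refine (mul_le_mul' le_rfl (ballNorm_sum_le _ _ _)).trans ?_
    rw [Finset.mul_sum, Finset.sum_mul]
    refine Finset.sum_le_sum fun q hq => ?_
    rw [Module.End.mul_apply, hz, ← totalDeg_antidiagonal hq, pow_add]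
    have h1 : ballNorm (R - (k + 1 : ℕ) * δ) (lieDer (X q.1) ((z ^ k).coeff q.2 G)) ≤
        ballNorm R (X q.1) * ballNorm (R - k * δ) ((z ^ k).coeff q.2 G) / ENNReal.ofReal δ := by
      refine (ballNorm_lieDer_le _ _ (R := R - k * δ) hδ (by push_cast; linarith)).trans ?_
      gcongr
      refine ballNorm_mono ?_ _
      have : 0 ≤ ((k + 1 : ℕ) : ℝ) * δ := by positivity
      linarith
    refine (mul_le_mul' le_rfl h1).trans (le_of_eq ?_)
    rw [div_eq_mul_inv]
    ring

lemma enorm_factorial_inv_le_one (k : ℕ) : ‖((k.factorial : ℝ)⁻¹)‖ₑ ≤ 1 := by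
  rw [← ofReal_norm, ENNReal.ofReal_le_one, norm_inv, Real.norm_natCast]
  exact inv_le_one_of_one_le₀ (by exact_mod_cast Nat.one_le_iff_ne_zero.2 (Nat.factorial_ne_zero k))

lemma sum_pow_le_two {x : ℝ≥0∞} (hx : x ≤ 2⁻¹) (N : ℕ) : ∑ k ∈ range (N + 1), x ^ k ≤ 2 := by
  rw [Finset.sum_range_succ', pow_zero]
  refine (add_le_add ((Finset.sum_le_sum fun k _ => ?_).trans (sum_two_inv_pow_le N))
    le_rfl).trans (by norm_num)
  gcongr

/-- The truncated exponential of a bigraded sum of vector fields differs from the part of total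
degree at most `N` by an exponentially small term. -/
lemma enorm_truncExp_sub_le {z : AddMonoidAlgebra (Module.End ℝ (SmoothMap E)) (ℕ × ℕ)}
    {X : ℕ × ℕ → SmoothMap E} (hz : ∀ p, z.coeff p = lieDer (X p)) (G : SmoothMap E)
    {r R δ : ℝ} (hδ : 0 < δ) {N : ℕ} (hr : r + N * δ ≤ R)
    (hX : (∑' p : ℕ × ℕ, 2 ^ totalDeg p * ballNorm R (X p)) / ENNReal.ofReal δ ≤ 2⁻¹)
    {x : E} (hx : x ∈ Metric.ball (0 : E) r) :
    ‖(evalOne (Module.End ℝ (SmoothMap E)) (truncExp N z) G) x -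
      (∑ p ∈ bidegLE N, (truncExp (S := Module.End ℝ (SmoothMap E)) N z).coeff p G :
        SmoothMap E) x‖ₑ
      ≤ 2⁻¹ ^ N * (2 * ballNorm R G) := by
  set Y := truncExp (S := Module.End ℝ (SmoothMap E)) N z with hY
  rw [evalOne_eq_sum Y (bidegLE N ∪ (Y.coeff.support \ bidegLE N)) (by
    rw [Finset.union_sdiff_self_eq_union]; exact Finset.subset_union_right),
    Finset.sum_union Finset.disjoint_sdiff, LinearMap.add_apply, SmoothMap.add_apply,
    LinearMap.sum_apply, add_sub_cancel_left]
  -- On degrees above `N` the weight 2^|p| dominates 2^N. This is the source of the small factor: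
  -- the weighted sum of all words is bounded, and the tail gains 2^(-N).
  have h1 : ∀ p ∈ Y.coeff.support \ bidegLE N, (1 : ℝ≥0∞) ≤ 2⁻¹ ^ N * 2 ^ totalDeg p := by
    intro p hp
    have hp' : N ≤ totalDeg p := by
      have := (Finset.mem_sdiff.1 hp).2
      rw [mem_bidegLE] at this
      omega
    obtain ⟨m, hm⟩ := Nat.exists_eq_add_of_le hp'
    rw [hm, pow_add, ← mul_assoc, ← mul_pow, ENNReal.inv_mul_cancel (by simp) (by simp), one_pow,
      one_mul]
    exact one_le_pow₀ (by norm_num)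
  rw [LinearMap.sum_apply, SmoothMap.sum_apply]
  refine (enorm_sum_le _ _).trans ?_
  have h2 : ∀ p, ballNorm r (Y.coeff p G) ≤
      ∑ k ∈ range (N + 1), ballNorm (R - k * δ) ((z ^ k).coeff p G) := by
    intro p
    rw [hY, truncExp, AddMonoidAlgebra.coeff_sum, Finsupp.finsetSum_apply, LinearMap.sum_apply]
    refine (ballNorm_sum_le _ _ _).trans (Finset.sum_le_sum fun k hk => ?_)
    rw [AddMonoidAlgebra.coeff_smul_apply, LinearMap.smul_apply]
    refine (ballNorm_smul_le _ _ _).trans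
      ((mul_le_mul' (enorm_factorial_inv_le_one k) le_rfl).trans ?_)
    rw [one_mul]
    refine ballNorm_mono ?_ _
    have hk' : (k : ℝ) ≤ N := by exact_mod_cast Nat.lt_succ_iff.1 (Finset.mem_range.1 hk)
    nlinarith
  calc ∑ p ∈ Y.coeff.support \ bidegLE N, ‖(Y.coeff p G) x‖ₑ
      ≤ ∑ p ∈ Y.coeff.support \ bidegLE N,
          2⁻¹ ^ N * (2 ^ totalDeg p *
            ∑ k ∈ range (N + 1), ballNorm (R - k * δ) ((z ^ k).coeff p G)) := by
        refine Finset.sum_le_sum fun p hp => ?_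
        rw [← mul_assoc]
        exact (le_mul_of_one_le_left' (h1 p hp)).trans
          (mul_le_mul' le_rfl ((enorm_le_ballNorm hx).trans (h2 p)))
    _ ≤ ∑' p : ℕ × ℕ, 2⁻¹ ^ N * (2 ^ totalDeg p *
            ∑ k ∈ range (N + 1), ballNorm (R - k * δ) ((z ^ k).coeff p G)) :=
        ENNReal.sum_le_tsum _
    _ = 2⁻¹ ^ N * ∑ k ∈ range (N + 1), ∑' p : ℕ × ℕ,
          2 ^ totalDeg p * ballNorm (R - k * δ) ((z ^ k).coeff p G) := by
        rw [ENNReal.tsum_mul_left]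
        congr 1
        simp only [Finset.mul_sum]
        rw [Summable.tsum_finsetSum (fun _ _ => ENNReal.summable)]
    _ ≤ 2⁻¹ ^ N * ∑ k ∈ range (N + 1),
          (((∑' p : ℕ × ℕ, 2 ^ totalDeg p * ballNorm R (X p)) / ENNReal.ofReal δ) ^ k *
            ballNorm R G) := by
        gcongr with k hk
        exact tsum_words_le hz G hδ k
    _ ≤ 2⁻¹ ^ N * (2 * ballNorm R G) := by
        rw [← Finset.sum_mul]
        gcongr
        exact sum_pow_le_two hX N

end Words

/-! ### Time-one maps: confinement, Lie series and existence -/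

section Flow

variable {E : Type*} [NormedAddCommGroup E] [NormedSpace ℂ E]

/-- The time-one map of the vector field `X` sends `x` to `y`. -/
def TimeOne (X : E → E) (x y : E) : Prop :=
  ∃ u : ℝ → E, u 0 = x ∧ u 1 = y ∧
    ∀ τ ∈ Set.Icc (0 : ℝ) 1, HasDerivWithinAt u (X (u τ)) (Set.Icc 0 1) τ

lemma hasDerivWithinAt_Ici_of_Icc {u : ℝ → E} {v : E} {τ : ℝ} (hτ : τ ∈ Set.Ico (0 : ℝ) 1)
    (h : HasDerivWithinAt u v (Set.Icc 0 1) τ) : HasDerivWithinAt u v (Set.Ici τ) τ :=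
  h.mono_of_mem_nhdsWithin (Icc_mem_nhdsGE_of_mem hτ)

/-- Solutions that start in a smaller ball stay in a ball where the field is small. -/
lemma norm_lt_of_solution {X : E → E} {u : ℝ → E} {m c r : ℝ} (hc : 0 ≤ c)
    (hu : ∀ τ ∈ Set.Icc (0 : ℝ) 1, HasDerivWithinAt u (X (u τ)) (Set.Icc 0 1) τ)
    (h0 : ‖u 0‖ ≤ m) (hX : ∀ z, ‖z‖ < r → ‖X z‖ ≤ c) (hr : m + c < r) {τ : ℝ}
    (hτ : τ ∈ Set.Icc (0 : ℝ) 1) : ‖u τ‖ < r := by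
  -- A slope strictly between the speed `c` and r - m: the barrier m + c't grows faster than the
  -- norm of the solution can and still ends below `r`.
  set c' := (c + (r - m)) / 2 with hc'
  have h1 := image_norm_le_of_norm_deriv_right_lt_deriv_boundary (f := u) (a := 0) (b := 1)
    (f' := fun τ => X (u τ)) (B := fun t => m + c' * t) (B' := fun _ => c')
    (fun τ hτ => (hu τ hτ).continuousWithinAt)
    (fun τ hτ => hasDerivWithinAt_Ici_of_Icc hτ (hu τ (Set.Ico_subset_Icc_self hτ)))
    (by simpa using h0)
    (fun t => by simpa using ((hasDerivAt_id t).const_mul c').const_add m)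
    (fun t ht h => by
      have h3 : ‖u t‖ < r := by
        rw [h]
        nlinarith [ht.1, ht.2]
      have := hX _ h3
      linarith)
  have h2 : ‖u τ‖ ≤ m + c' * τ := h1 hτ
  nlinarith [hτ.1, hτ.2]

/-- Taylor's formula along a flow. -/
lemma norm_lieSeries_sub_le {X F : SmoothMap E} {u : ℝ → E} {r : ℝ}
    (hu : ∀ τ ∈ Set.Icc (0 : ℝ) 1, HasDerivWithinAt u (X (u τ)) (Set.Icc 0 1) τ)
    (hr : ∀ τ ∈ Set.Icc (0 : ℝ) 1, ‖u τ‖ < r) (N : ℕ) :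
    ‖F (u 1) - ∑ i ∈ range (N + 1), ((i.factorial : ℝ)⁻¹) • ((lieDer X ^ i) F) (u 0)‖ₑ ≤
      ballNorm r ((lieDer X ^ (N + 1)) F) := by
  by_cases htop : ballNorm r ((lieDer X ^ (N + 1)) F) = ⊤
  · rw [htop]; exact le_top
  set C := (ballNorm r ((lieDer X ^ (N + 1)) F)).toReal
  have hC : ballNorm r ((lieDer X ^ (N + 1)) F) = ENNReal.ofReal C :=
    (ENNReal.ofReal_toReal htop).symm
  have hG : ∀ (G : SmoothMap E), ∀ τ ∈ Set.Icc (0 : ℝ) 1,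
      HasDerivWithinAt (fun τ => G (u τ)) ((lieDer X G) (u τ)) (Set.Icc 0 1) τ := by
    intro G τ hτ
    have h1 : HasFDerivAt (G : E → E) ((fderiv ℂ G (u τ)).restrictScalars ℝ) (u τ) :=
      (SmoothMap.differentiable G (u τ)).hasFDerivAt.restrictScalars ℝ
    exact h1.comp_hasDerivWithinAt τ (hu τ hτ)
  -- The Taylor polynomial at u(τ), evaluated for the remaining time 1 - τ, has a telescoping
  -- derivative: only the term of order n+1 survives. It equals the Lie series at τ = 0 and F(u 1)
  -- at τ = 1.
  have key : ∀ n : ℕ, ∀ τ ∈ Set.Icc (0 : ℝ) 1,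
      HasDerivWithinAt (fun τ => ∑ i ∈ range (n + 1),
        ((1 - τ) ^ i * (i.factorial : ℝ)⁻¹) • ((lieDer X ^ i) F) (u τ))
        (((1 - τ) ^ n * (n.factorial : ℝ)⁻¹) • ((lieDer X ^ (n + 1)) F) (u τ))
        (Set.Icc 0 1) τ := by
    intro n τ hτ
    induction n with
    | zero => simpa using hG F τ hτ
    | succ n ih =>
      have h1 : HasDerivWithinAt (fun τ : ℝ => (1 - τ) ^ (n + 1) * ((n + 1).factorial : ℝ)⁻¹)
          (-((1 - τ) ^ n * (n.factorial : ℝ)⁻¹)) (Set.Icc 0 1) τ := by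
        have h2 : HasDerivAt (fun τ : ℝ => (1 - τ) ^ (n + 1) * ((n + 1).factorial : ℝ)⁻¹)
            (((n + 1 : ℕ) * (1 - τ) ^ n * (-1)) * ((n + 1).factorial : ℝ)⁻¹) τ := by
          simpa using (((hasDerivAt_id τ).const_sub 1).pow (n + 1)).mul_const
            (((n + 1).factorial : ℝ)⁻¹)
        refine (h2.congr_deriv ?_).hasDerivWithinAt
        rw [Nat.factorial_succ]
        push_cast
        field_simp
      have h3 := ih.add (h1.smul (hG ((lieDer X ^ (n + 1)) F) τ hτ))
      simp only [Finset.sum_range_succ _ (n + 1)]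
      refine h3.congr_deriv ?_
      rw [← Module.End.mul_apply, ← pow_succ', neg_smul]
      abel
  have hbound := norm_image_sub_le_of_norm_deriv_le_segment_01' (C := C) (key N)
    (fun τ hτ => by
      have h1 : ‖((lieDer X ^ (N + 1)) F) (u τ)‖ ≤ C :=
        norm_le_of_ballNorm_le ENNReal.toReal_nonneg hC.le (hr τ (Set.Ico_subset_Icc_self hτ))
      rw [norm_smul, norm_mul, norm_pow, norm_inv, Real.norm_natCast]
      have h2 : ‖1 - τ‖ ≤ 1 := by
        rw [Real.norm_eq_abs, abs_le]; constructor <;> linarith [hτ.1, hτ.2]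
      have h3 : ‖1 - τ‖ ^ N ≤ 1 := pow_le_one₀ (norm_nonneg _) h2
      have h4 : ((N.factorial : ℝ))⁻¹ ≤ 1 := inv_le_one_of_one_le₀
        (by exact_mod_cast Nat.one_le_iff_ne_zero.2 (Nat.factorial_ne_zero N))
      have h5 : 0 ≤ ((N.factorial : ℝ))⁻¹ := by positivity
      calc ‖1 - τ‖ ^ N * ((N.factorial : ℝ))⁻¹ * ‖((lieDer X ^ (N + 1)) F) (u τ)‖
          ≤ 1 * 1 * C := by gcongr
        _ = C := by ring)
  rw [hC, ← ofReal_norm]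
  refine ENNReal.ofReal_le_ofReal ?_
  have e1 : ∑ i ∈ range (N + 1), ((1 - (1 : ℝ)) ^ i * (i.factorial : ℝ)⁻¹) •
      ((lieDer X ^ i) F) (u 1) = F (u 1) := by
    rw [Finset.sum_range_succ']
    simp
  rw [e1] at hbound
  simpa using hbound

lemma norm_sub_le_of_solution {X : E → E} {u : ℝ → E} {c r : ℝ}
    (hu : ∀ τ ∈ Set.Icc (0 : ℝ) 1, HasDerivWithinAt u (X (u τ)) (Set.Icc 0 1) τ)
    (hX : ∀ z, ‖z‖ < r → ‖X z‖ ≤ c) (hr : ∀ τ ∈ Set.Icc (0 : ℝ) 1, ‖u τ‖ < r) :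
    ‖u 1 - u 0‖ ≤ c :=
  norm_image_sub_le_of_norm_deriv_le_segment_01' hu
    fun τ hτ => hX _ (hr τ (Set.Ico_subset_Icc_self hτ))

/-- Existence of the time-one map on a ball where the field is small. -/
lemma exists_timeOne [CompleteSpace E] (X : SmoothMap E) {m c r : ℝ} (hc : 0 ≤ c)
    (hX : ballNorm r X ≤ ENNReal.ofReal c) (hr : m + c < r) {x : E} (hx : ‖x‖ ≤ m) :
    ∃ y, TimeOne X x y := by
  set r' := (m + c + r) / 2 with hr'
  have hδ : 0 < r - r' := by linarith
  -- Cauchy's estimate from the ball of radius `r` to that of radius r' gives the Lipschitz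
  -- constant. A solution of speed at most `c` stays within `c` of `x`, inside the ball of radius
  -- r'.
  set K : NNReal := Real.toNNReal (c / (r - r'))
  have hsub : Metric.closedBall x c ⊆ Metric.ball (0 : E) r' := by
    intro z hz
    rw [mem_ball_zero_iff]
    have h1 : ‖z - x‖ ≤ c := by simpa [dist_eq_norm] using hz
    calc ‖z‖ ≤ ‖x‖ + ‖z - x‖ := by simpa using norm_add_le x (z - x)
      _ < r' := by linarith
  have hlip : LipschitzOnWith K (X : E → E) (Metric.ball (0 : E) r') := by
    refine Convex.lipschitzOnWith_of_nnnorm_fderiv_le (𝕜 := ℂ)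
      (fun z _ => SmoothMap.differentiable X z) (fun z hz => ?_) (convex_ball _ _)
    rw [← NNReal.coe_le_coe, coe_nnnorm, Real.coe_toNNReal _ (by positivity)]
    refine ContinuousLinearMap.opNorm_le_bound _ (by positivity) fun v => ?_
    have h1 := (enorm_fderiv_apply_le (SmoothMap.differentiable X) hδ (by linarith) hz v).trans
      (ENNReal.div_le_div_right (mul_le_mul' le_rfl hX) _)
    rw [← ofReal_norm, ← ofReal_norm, ← ENNReal.ofReal_mul (norm_nonneg _),
      ← ENNReal.ofReal_div_of_pos hδ, ENNReal.ofReal_le_ofReal_iff (by positivity)] at h1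
    exact h1.trans (le_of_eq (by ring))
  have hPL : IsPicardLindelof (fun _ : ℝ => (X : E → E)) (tmin := 0) (tmax := 1)
      ⟨0, by simp⟩ x (Real.toNNReal c) 0 (Real.toNNReal c) K := by
    refine IsPicardLindelof.of_time_independent (fun z hz => ?_) (hlip.mono ?_) ?_
    · rw [Real.coe_toNNReal _ hc] at hz ⊢
      refine norm_le_of_ballNorm_le hc hX ?_
      have := mem_ball_zero_iff.1 (hsub hz)
      linarith
    · rw [Real.coe_toNNReal _ hc]
      exact hsub
    · simp
  obtain ⟨u, hu0, hu⟩ := hPL.exists_eq_forall_mem_Icc_hasDerivWithinAt₀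
  exact ⟨u 1, u, hu0, rfl, hu⟩

end Flow

end

end SplittingBEA

namespace SplittingBEA

open Finset
open scoped ENNReal ContDiff

noncomputable section

/-! ### Exponentially small error of the interpolating flow -/

section SplittingError

variable {E : Type*} [NormedAddCommGroup E] [NormedSpace ℂ E]
variable {L : Type*} [AddCommGroup L] [Module ℝ L] {br : L →ₗ[ℝ] L →ₗ[ℝ] L}
  {fld : L →ₗ[ℝ] SmoothMap E}

/-- The sum of the components of total degree at most `N` of the Baker–Campbell–Hausdorff
series. -/
def bchSum (br : L →ₗ[ℝ] L →ₗ[ℝ] L) (A B : L) (N : ℕ) : L :=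
  ∑ p ∈ bidegLE N, bchTerm br A B N p

/-- The choice δ = M/N allows `N` losses of radius between 4M and 3M, so every component of degree
at most `N` is controlled on the ball of radius 3M. The bounds on `A` and `B` are the thresholds 1/4
and 1/8 of `mass_bchTerm_le` with weights 2, which are needed for the tail estimate of the words. -/
lemma tsum_bch_le
    (hfld : ∀ x y, fld (br x y) = lieDer (fld x) (fld y) - lieDer (fld y) (fld x))
    {A B : L} {M : ℝ} (hM : 0 < M) {N : ℕ} (hN : 1 ≤ N)
    (hA : ballNorm (4 * M) (fld A) ≤ ENNReal.ofReal (M / (16 * N)))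
    (hB : ballNorm (4 * M) (fld B) ≤ ENNReal.ofReal (M / (32 * N))) :
    ∑' p : ℕ × ℕ, 2 ^ totalDeg p * ballNorm (3 * M)
      (if totalDeg p ≤ N then fld (bchTerm br A B N p) else 0 : SmoothMap E) ≤
      ENNReal.ofReal (M / (4 * N)) := by
  have hN' : (0 : ℝ) < N := by exact_mod_cast hN
  have hδ : 0 < M / N := by positivity
  have hsm : ∀ x : L, ballNorm (4 * M - M / N) (fld x) ≤ ballNorm (4 * M) (fld x) := fun x =>
    ballNorm_mono (by linarith) _
  have h2 : (2 : ℝ≥0∞) = ENNReal.ofReal 2 := by simp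
  have h := mass_bchTerm_le hfld (R := 4 * M) hδ (ρ := 2) (σ := 2) (A := A) (B := B) (by
      calc 2 / ENNReal.ofReal (M / N) * (2 * ballNorm (4 * M - M / N) (fld A))
          ≤ 2 / ENNReal.ofReal (M / N) * (2 * ENNReal.ofReal (M / (16 * N))) := by
            gcongr
            exact (hsm A).trans hA
        _ = ENNReal.ofReal (2 / (M / N) * (2 * (M / (16 * N)))) := by
            rw [h2, ← ENNReal.ofReal_div_of_pos hδ, ← ENNReal.ofReal_mul (by norm_num),
              ← ENNReal.ofReal_mul (by positivity)]
        _ = ENNReal.ofReal (4⁻¹) := by congr 1; field_simp; norm_num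
        _ ≤ 4⁻¹ := by rw [ENNReal.ofReal_inv_of_pos (by norm_num)]; simp) (by
      calc 2 / ENNReal.ofReal (M / N) * (2 * ballNorm (4 * M - M / N) (fld B))
          ≤ 2 / ENNReal.ofReal (M / N) * (2 * ENNReal.ofReal (M / (32 * N))) := by
            gcongr
            exact (hsm B).trans hB
        _ = ENNReal.ofReal (2 / (M / N) * (2 * (M / (32 * N)))) := by
            rw [h2, ← ENNReal.ofReal_div_of_pos hδ, ← ENNReal.ofReal_mul (by norm_num),
              ← ENNReal.ofReal_mul (by positivity)]
        _ = ENNReal.ofReal (8⁻¹) := by congr 1; field_simp; norm_num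
        _ ≤ 8⁻¹ := by rw [ENNReal.ofReal_inv_of_pos (by norm_num)]; simp) N
  have h4 : ENNReal.ofReal (M / N) / 4 = ENNReal.ofReal (M / (4 * N)) := by
    rw [show (4 : ℝ≥0∞) = ENNReal.ofReal 4 by simp, ← ENNReal.ofReal_div_of_pos (by norm_num)]
    congr 1
    field_simp
  rw [h4] at h
  refine le_trans (ENNReal.tsum_le_tsum fun p => ?_) h
  rw [totalDeg, pow_add]
  refine mul_le_mul' le_rfl ?_
  split_ifs with hp
  · refine ballNorm_mono ?_ _
    have h5 : ((p.1 + p.2 : ℕ) : ℝ) ≤ N := by exact_mod_cast hp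
    have h6 : ((p.1 + p.2 : ℕ) : ℝ) * (M / N) ≤ N * (M / N) := by gcongr
    have h7 : N * (M / N) = M := by field_simp
    linarith
  · rw [ballNorm_zero]
    exact zero_le

lemma ballNorm_bchSum_le
    (hfld : ∀ x y, fld (br x y) = lieDer (fld x) (fld y) - lieDer (fld y) (fld x))
    {A B : L} {M : ℝ} (hM : 0 < M) {N : ℕ} (hN : 1 ≤ N)
    (hA : ballNorm (4 * M) (fld A) ≤ ENNReal.ofReal (M / (16 * N)))
    (hB : ballNorm (4 * M) (fld B) ≤ ENNReal.ofReal (M / (32 * N))) :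
    ballNorm (3 * M) (fld (bchSum br A B N)) ≤ ENNReal.ofReal (M / (4 * N)) := by
  refine le_trans ?_ (tsum_bch_le hfld hM hN hA hB)
  rw [bchSum, map_sum]
  refine (ballNorm_sum_le _ _ _).trans (le_trans (Finset.sum_le_sum fun p hp => ?_)
    (ENNReal.sum_le_tsum (bidegLE N)))
  rw [if_pos (mem_bidegLE.1 hp)]
  exact le_mul_of_one_le_left' (one_le_pow₀ (by norm_num))

/-- The identity as a smooth map. -/
def smoothId (E : Type*) [NormedAddCommGroup E] [NormedSpace ℂ E] : SmoothMap E :=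
  ⟨fun z => z, (contDiff_id : ContDiff ℂ ∞ fun z : E => z)⟩

lemma ballNorm_smoothId_le {R : ℝ} : ballNorm R (smoothId E) ≤ ENNReal.ofReal R :=
  ballNorm_le_ofReal fun _ hz => hz.le

lemma sum_bidegLE {M : Type*} [AddCommMonoid M] (N : ℕ) (f : ℕ → ℕ → M) :
    ∑ p ∈ bidegLE N, f p.1 p.2 = ∑ j ∈ range (N + 1), ∑ i ∈ range (N - j + 1), f i j := by
  rw [Finset.sum_sigma']
  refine Finset.sum_nbij' (fun p => ⟨p.2, p.1⟩) (fun x => (x.2, x.1)) ?_ ?_ ?_ ?_ ?_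
  · rintro ⟨i, j⟩ h
    simp only [mem_bidegLE, totalDeg, mem_sigma, mem_range] at h ⊢
    omega
  · rintro ⟨j, i⟩ h
    simp only [mem_bidegLE, totalDeg, mem_sigma, mem_range] at h ⊢
    omega
  all_goals intros; rfl

/-- The composition of two time-one maps is given by the product of the Lie series. -/
lemma enorm_composition_sub_le {X Y F : SmoothMap E} {u v : ℝ → E} {r R δ : ℝ} (hδ : 0 < δ)
    {N : ℕ} (hR : r + (N + 1) * δ ≤ R) {c : ℝ≥0∞}
    (hXc : ballNorm R X / ENNReal.ofReal δ ≤ c) (hYc : ballNorm R Y / ENNReal.ofReal δ ≤ c)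
    (hu : ∀ τ ∈ Set.Icc (0 : ℝ) 1, HasDerivWithinAt u (X (u τ)) (Set.Icc 0 1) τ)
    (hur : ∀ τ ∈ Set.Icc (0 : ℝ) 1, ‖u τ‖ < r)
    (hv : ∀ τ ∈ Set.Icc (0 : ℝ) 1, HasDerivWithinAt v (Y (v τ)) (Set.Icc 0 1) τ)
    (hvr : ∀ τ ∈ Set.Icc (0 : ℝ) 1, ‖v τ‖ < r) (huv : u 1 = v 0) :
    ‖F (v 1) - ∑ p ∈ bidegLE N, ((p.1.factorial : ℝ)⁻¹ * (p.2.factorial : ℝ)⁻¹) •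
      ((lieDer X ^ p.1 * lieDer Y ^ p.2) F) (u 0)‖ₑ ≤ (N + 2) * (c ^ (N + 1) * ballNorm R F) := by
  -- All remainders below are words of exactly N+1 letters, for which the radius R - r ≥ (N+1)δ
  -- suffices.
  have hword : ∀ i j : ℕ, i + j = N + 1 →
      ballNorm r ((lieDer X ^ i) ((lieDer Y ^ j) F)) ≤ c ^ (N + 1) * ballNorm R F := by
    intro i j hij
    have hij' : (i : ℝ) + j = N + 1 := by exact_mod_cast hij
    have h0 : ballNorm r ((lieDer X ^ i) ((lieDer Y ^ j) F)) ≤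
        ballNorm (R - j * δ - i * δ) ((lieDer X ^ i) ((lieDer Y ^ j) F)) := by
      refine ballNorm_mono ?_ _
      have : (N + 1) * δ = i * δ + j * δ := by rw [← hij']; ring
      linarith
    refine h0.trans ((ballNorm_lieDer_pow_le X _ hδ (R := R)
      (by linarith [mul_nonneg (Nat.cast_nonneg j : (0 : ℝ) ≤ j) hδ.le]) i).trans ?_)
    rw [← hij, pow_add, mul_assoc]
    gcongr
    refine (ballNorm_lieDer_pow_le Y F hδ le_rfl j).trans ?_
    gcongr
  have h1 : ‖F (v 1) - ∑ j ∈ range (N + 1), ((j.factorial : ℝ)⁻¹) • ((lieDer Y ^ j) F) (v 0)‖ₑ ≤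
      c ^ (N + 1) * ballNorm R F :=
    (norm_lieSeries_sub_le hv hvr N).trans (hword 0 (N + 1) (by omega))
  have h2 : ∀ j ∈ range (N + 1), ‖((lieDer Y ^ j) F) (u 1) -
      ∑ i ∈ range (N - j + 1), ((i.factorial : ℝ)⁻¹) •
        ((lieDer X ^ i) ((lieDer Y ^ j) F)) (u 0)‖ₑ ≤ c ^ (N + 1) * ballNorm R F := by
    intro j hj
    have hj' := Finset.mem_range.1 hj
    exact (norm_lieSeries_sub_le hu hur (N - j)).trans (hword _ _ (by omega))
  -- Expand along the second flow to order `N`, then the j-th term along the first flow to order N -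
  -- j. There is one remainder from the first expansion and N+1 from the second, hence the factor
  -- N+2.
  have h3 : F (v 1) - ∑ p ∈ bidegLE N, ((p.1.factorial : ℝ)⁻¹ * (p.2.factorial : ℝ)⁻¹) •
      ((lieDer X ^ p.1 * lieDer Y ^ p.2) F) (u 0) =
      (F (v 1) - ∑ j ∈ range (N + 1), ((j.factorial : ℝ)⁻¹) • ((lieDer Y ^ j) F) (v 0)) +
      ∑ j ∈ range (N + 1), ((j.factorial : ℝ)⁻¹) • (((lieDer Y ^ j) F) (u 1) -
        ∑ i ∈ range (N - j + 1), ((i.factorial : ℝ)⁻¹) •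
          ((lieDer X ^ i) ((lieDer Y ^ j) F)) (u 0)) := by
    rw [sum_bidegLE N fun i j => ((i.factorial : ℝ)⁻¹ * (j.factorial : ℝ)⁻¹) •
      ((lieDer X ^ i * lieDer Y ^ j) F) (u 0)]
    simp only [smul_sub, Finset.sum_sub_distrib, Finset.smul_sum, smul_smul, huv,
      Module.End.mul_apply, mul_comm]
    abel
  rw [h3]
  have h4 : ∀ j ∈ range (N + 1), ‖((j.factorial : ℝ)⁻¹) • (((lieDer Y ^ j) F) (u 1) -
        ∑ i ∈ range (N - j + 1), ((i.factorial : ℝ)⁻¹) •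
          ((lieDer X ^ i) ((lieDer Y ^ j) F)) (u 0))‖ₑ ≤ c ^ (N + 1) * ballNorm R F := by
    intro j hj
    rw [enorm_smul]
    exact (mul_le_mul' (enorm_factorial_inv_le_one j) (h2 j hj)).trans (by rw [one_mul])
  refine (enorm_add_le _ _).trans ((add_le_add h1 ((enorm_sum_le _ _).trans
    (Finset.sum_le_sum h4))).trans (le_of_eq ?_))
  rw [Finset.sum_const, Finset.card_range, nsmul_eq_mul]
  push_cast
  ring

/-- The truncated Baker–Campbell–Hausdorff field interpolates the composition of the time-one maps
up to an exponentially small error. -/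
theorem splitting_error
    (hfld : ∀ x y, fld (br x y) = lieDer (fld x) (fld y) - lieDer (fld y) (fld x))
    {A B : L} {M : ℝ} (hM : 0 < M) {N : ℕ} (hN : 1 ≤ N)
    (hA : ballNorm (4 * M) (fld A) ≤ ENNReal.ofReal (M / (16 * N)))
    (hB : ballNorm (4 * M) (fld B) ≤ ENNReal.ofReal (M / (32 * N)))
    {z x y w : E} (hz : ‖z‖ ≤ M) (hx : TimeOne (fld A) z x) (hy : TimeOne (fld B) x y)
    (hw : TimeOne (fld (bchSum br A B N)) z w) : ‖y - w‖ ≤ 12 * M * 2⁻¹ ^ N := by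
  have hN' : (1 : ℝ) ≤ N := by exact_mod_cast hN
  have hN0 : (0 : ℝ) < N := by linarith
  obtain ⟨u, hu0, hu1, hu⟩ := hx
  obtain ⟨v, hv0, hv1, hv⟩ := hy
  obtain ⟨q, hq0, hq1, hq⟩ := hw
  have hsmall : ∀ k : ℝ, 4 ≤ k → M / (k * N) ≤ M / 4 := fun k hk => by
    gcongr
    nlinarith
  have hnA : ∀ z, ‖z‖ < 2 * M → ‖fld A z‖ ≤ M / 4 := fun z hz =>
    (norm_le_of_ballNorm_le (by positivity) hA (by linarith)).trans (hsmall 16 (by norm_num))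
  have hnB : ∀ z, ‖z‖ < 2 * M → ‖fld B z‖ ≤ M / 4 := fun z hz =>
    (norm_le_of_ballNorm_le (by positivity) hB (by linarith)).trans (hsmall 32 (by norm_num))
  have hZ := ballNorm_bchSum_le hfld hM hN hA hB
  have hnZ : ∀ z, ‖z‖ < 2 * M → ‖fld (bchSum br A B N) z‖ ≤ M / 4 := fun z hz =>
    (norm_le_of_ballNorm_le (by positivity) hZ (by linarith)).trans (hsmall 4 le_rfl)
  have hur : ∀ τ ∈ Set.Icc (0 : ℝ) 1, ‖u τ‖ < 2 * M := fun τ hτ =>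
    norm_lt_of_solution (m := M) (c := M / 4) (by positivity) hu (hu0 ▸ hz) hnA (by linarith) hτ
  have hx' : ‖x‖ ≤ M + M / 4 := by
    have h1 := norm_sub_le_of_solution hu hnA hur
    rw [hu0, hu1] at h1
    calc ‖x‖ ≤ ‖z‖ + ‖x - z‖ := by simpa using norm_add_le z (x - z)
      _ ≤ _ := by linarith
  have hvr : ∀ τ ∈ Set.Icc (0 : ℝ) 1, ‖v τ‖ < 2 * M := fun τ hτ =>
    norm_lt_of_solution (m := M + M / 4) (c := M / 4) (by positivity) hv (hv0 ▸ hx') hnB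
      (by linarith) hτ
  have hqr : ∀ τ ∈ Set.Icc (0 : ℝ) 1, ‖q τ‖ < 2 * M := fun τ hτ =>
    norm_lt_of_solution (m := M) (c := M / 4) (by positivity) hq (hq0 ▸ hz) hnZ (by linarith) hτ
  -- The solutions stay in radius 2M and the fields are controlled in radius 3M. The Taylor
  -- remainders have N+1 letters, so the gap `M` is divided into N+1 pieces.
  set δ : ℝ := M / (N + 1) with hδdef
  have hδ : 0 < δ := by positivity
  have hδN : (N + 1) * δ = M := by rw [hδdef]; field_simp
  have hI : ballNorm (3 * M) (smoothId E) ≤ ENNReal.ofReal (3 * M) := ballNorm_smoothId_le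
  have hdiv : ∀ k : ℝ, 0 < k → ENNReal.ofReal (M / (k * N)) / ENNReal.ofReal δ ≤
      ENNReal.ofReal (2 / k) := by
    intro k hk
    rw [← ENNReal.ofReal_div_of_pos hδ]
    refine ENNReal.ofReal_le_ofReal ?_
    rw [hδdef, div_div_div_eq, div_le_div_iff₀ (by positivity) (by positivity)]
    nlinarith [mul_pos hM hk]
  have h2i : ENNReal.ofReal (2⁻¹) = 2⁻¹ := by
    rw [ENNReal.ofReal_inv_of_pos (by norm_num)]; simp
  -- composition
  have e1 := enorm_composition_sub_le (X := fld A) (Y := fld B) (F := smoothId E) (u := u) (v := v)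
    (r := 2 * M) (R := 3 * M) hδ (N := N) (by linarith) (c := ENNReal.ofReal (1 / 8))
    ((ENNReal.div_le_div_right ((ballNorm_mono (by linarith) _).trans hA) _).trans
      ((hdiv 16 (by norm_num)).trans (ENNReal.ofReal_le_ofReal (by norm_num))))
    ((ENNReal.div_le_div_right ((ballNorm_mono (by linarith) _).trans hB) _).trans
      ((hdiv 32 (by norm_num)).trans (ENNReal.ofReal_le_ofReal (by norm_num))))
    hu hur hv hvr (hu1.trans hv0.symm)
  -- flow of the interpolating field
  have e2 := (norm_lieSeries_sub_le (F := smoothId E) hq hqr N).trans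
    ((ballNorm_mono (by push_cast; linarith) _).trans (ballNorm_lieDer_pow_le (fld (bchSum br A B N))
      (smoothId E) (r := 3 * M) (R := 3 * M) hδ le_rfl (N + 1)) :
        ballNorm (2 * M) _ ≤ _)
  have e3 := enorm_truncExp_sub_le
    (z := famAlg (S := Module.End ℝ (SmoothMap E)) N (lieDer.comp fld) (bchTerm br A B N))
    (X := fun p => if totalDeg p ≤ N then fld (bchTerm br A B N p) else 0)
    (fun p => by
      rw [coeff_famAlg]
      split_ifs
      · rfl
      · rw [map_zero]) (smoothId E) (r := 2 * M) (R := 3 * M) hδ (N := N) (by linarith)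
    ((ENNReal.div_le_div_right (tsum_bch_le hfld hM hN hA hB) _).trans
      ((hdiv 4 (by norm_num)).trans (by rw [← h2i]; exact ENNReal.ofReal_le_ofReal (by norm_num))))
    (x := z) (mem_ball_zero_iff.2 (by linarith))
  -- Forgetting the grading turns the graded exponential into the truncated exponential of the Lie
  -- derivative along the truncated series, i.e. the Lie series of the interpolating flow.
  have hev : evalOne (Module.End ℝ (SmoothMap E))
      (famAlg (S := Module.End ℝ (SmoothMap E)) N (lieDer.comp fld) (bchTerm br A B N)) = lieDer (fld (bchSum br A B N)) := by
    simp only [famAlg, map_sum, evalOne_single, bchSum]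
    rfl
  have hbr : ∀ x y, (lieDer.comp fld) (br x y) =
      (lieDer.comp fld) x * (lieDer.comp fld) y - (lieDer.comp fld) y * (lieDer.comp fld) x := by
    intro x y
    rw [LinearMap.comp_apply, hfld, lieDer_bracket]
    rfl
  rw [evalOne_truncExp, hev] at e3
  have hsum : (∑ p ∈ bidegLE N, (truncExp N
      (famAlg (S := Module.End ℝ (SmoothMap E)) N (lieDer.comp fld) (bchTerm br A B N))).coeff p (smoothId E) : SmoothMap E) z =
      ∑ p ∈ bidegLE N, ((p.1.factorial : ℝ)⁻¹ * (p.2.factorial : ℝ)⁻¹) •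
      ((lieDer (fld A) ^ p.1 * lieDer (fld B) ^ p.2) (smoothId E)) z := by
    rw [SmoothMap.sum_apply]
    refine Finset.sum_congr rfl fun p hp => ?_
    have hc := coeff_truncExp_bch (S := Module.End ℝ (SmoothMap E)) br A B N (lieDer.comp fld) hbr
      p.1 p.2 (mem_bidegLE.1 hp)
    rw [hc]
    rfl
  rw [hsum] at e3
  rw [hu0, hv1] at e1
  rw [hq0, hq1] at e2
  have hsum2 : ((∑ k ∈ range (N + 1), ((k.factorial : ℝ)⁻¹) •
      lieDer (fld (bchSum br A B N)) ^ k) (smoothId E)) z =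
      ∑ k ∈ range (N + 1), ((k.factorial : ℝ)⁻¹) •
        ((lieDer (fld (bchSum br A B N)) ^ k) (smoothId E)) z := by
    rw [LinearMap.sum_apply, SmoothMap.sum_apply]
    rfl
  rw [hsum2] at e3
  set P1 := ∑ p ∈ bidegLE N, ((p.1.factorial : ℝ)⁻¹ * (p.2.factorial : ℝ)⁻¹) •
      ((lieDer (fld A) ^ p.1 * lieDer (fld B) ^ p.2) (smoothId E)) z
  set P2 := ∑ k ∈ range (N + 1), ((k.factorial : ℝ)⁻¹) •
        ((lieDer (fld (bchSum br A B N)) ^ k) (smoothId E)) z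
  have b1 : ‖y - P1‖ ≤ 3 * M * 2⁻¹ ^ N := by
    have h5 : (N + 2) * (ENNReal.ofReal (1 / 8) ^ (N + 1) * ballNorm (3 * M) (smoothId E)) ≤
        ENNReal.ofReal (((N : ℝ) + 2) * ((1 / 8) ^ (N + 1) * (3 * M))) := by
      rw [ENNReal.ofReal_mul (by positivity), ENNReal.ofReal_mul (by positivity),
        ENNReal.ofReal_pow (by norm_num), ENNReal.ofReal_add (by positivity) (by norm_num),
        ENNReal.ofReal_natCast, ENNReal.ofReal_ofNat]
      gcongr
    have h6 := e1.trans h5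
    rw [← ofReal_norm, ENNReal.ofReal_le_ofReal_iff (by positivity)] at h6
    refine h6.trans ?_
    -- The ratio 1/8 per letter, rather than 1/2, absorbs the number N+2 of remainders.
    have h7 : ((N : ℝ) + 2) * (1 / 8) ^ (N + 1) ≤ 2⁻¹ ^ N := by
      have h8 : ((N : ℝ) + 2) ≤ 4 ^ (N + 1) := by
        have h9 : N + 2 ≤ 4 ^ (N + 1) := Nat.lt_pow_self (n := N + 1) (a := 4) (by norm_num)
        exact_mod_cast h9
      calc ((N : ℝ) + 2) * (1 / 8) ^ (N + 1) ≤ 4 ^ (N + 1) * (1 / 8) ^ (N + 1) := by gcongr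
        _ = 2⁻¹ ^ N * 2⁻¹ := by rw [← mul_pow, ← pow_succ]; norm_num
        _ ≤ 2⁻¹ ^ N := mul_le_of_le_one_right (by positivity) (by norm_num)
    calc ((N : ℝ) + 2) * ((1 / 8) ^ (N + 1) * (3 * M))
        = 3 * M * (((N : ℝ) + 2) * (1 / 8) ^ (N + 1)) := by ring
      _ ≤ _ := by gcongr
  have b2 : ‖w - P2‖ ≤ 3 * M * 2⁻¹ ^ N := by
    have h5 : (ballNorm (3 * M) (fld (bchSum br A B N)) / ENNReal.ofReal δ) ^ (N + 1) *
        ballNorm (3 * M) (smoothId E) ≤ ENNReal.ofReal ((2⁻¹) ^ (N + 1) * (3 * M)) := by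
      rw [ENNReal.ofReal_mul (by positivity), ENNReal.ofReal_pow (by norm_num)]
      gcongr
      exact (ENNReal.div_le_div_right hZ _).trans
        ((hdiv 4 (by norm_num)).trans (ENNReal.ofReal_le_ofReal (by norm_num)))
    have h6 := e2.trans h5
    rw [← ofReal_norm, ENNReal.ofReal_le_ofReal_iff (by positivity)] at h6
    refine h6.trans ?_
    rw [pow_succ, mul_comm]
    gcongr
    exact mul_le_of_le_one_right (by positivity) (by norm_num)
  have b3 : ‖P2 - P1‖ ≤ 6 * M * 2⁻¹ ^ N := by
    have h5 : 2⁻¹ ^ N * (2 * ballNorm (3 * M) (smoothId E)) ≤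
        ENNReal.ofReal ((2⁻¹) ^ N * (2 * (3 * M))) := by
      rw [ENNReal.ofReal_mul (by positivity), ENNReal.ofReal_pow (by norm_num), h2i,
        ENNReal.ofReal_mul (by positivity), ENNReal.ofReal_ofNat]
      gcongr
    have h6 := e3.trans h5
    rw [← ofReal_norm, ENNReal.ofReal_le_ofReal_iff (by positivity)] at h6
    exact h6.trans (le_of_eq (by ring))
  -- Contributions 3 from the composition, 6 from the words of degree above `N`, 3 from the Taylor
  -- remainder of the interpolating flow.
  calc ‖y - w‖ = ‖(y - P1) - (P2 - P1) - (w - P2)‖ := by congr 1; abel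
    _ ≤ ‖y - P1‖ + ‖P2 - P1‖ + ‖w - P2‖ :=
      (norm_sub_le _ _).trans (add_le_add (norm_sub_le _ _) le_rfl)
    _ ≤ _ := by linarith

end SplittingError

end

end SplittingBEA

namespace SplittingBEA

open Finset
open scoped ENNReal ContDiff

noncomputable section

/-! ### Size of single terms and of the part quadratic in the second argument -/

section HigherOrder

variable {E : Type*} [NormedAddCommGroup E] [NormedSpace ℂ E]
variable {L : Type*} [AddCommGroup L] [Module ℝ L] {br : L →ₗ[ℝ] L →ₗ[ℝ] L}
  {fld : L →ₗ[ℝ] SmoothMap E}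

/-- One term is bounded by the whole mass divided by its weight. With δ = M/ν, ν = |p|, the
component `p` is measured on radius exactly 4M - νδ = 3M, and the weights are taken as large as the
smallness conditions 1/4 and 1/8 permit. -/
lemma ballNorm_bchTerm_le
    (hfld : ∀ x y, fld (br x y) = lieDer (fld x) (fld y) - lieDer (fld y) (fld x))
    {A B : L} {M a b : ℝ} (hM : 0 < M) (ha : 0 < a) (hb : 0 < b)
    (hA : ballNorm (4 * M) (fld A) ≤ ENNReal.ofReal a)
    (hB : ballNorm (4 * M) (fld B) ≤ ENNReal.ofReal b) (N : ℕ) (p : ℕ × ℕ)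
    (hp : 1 ≤ totalDeg p) :
    ballNorm (3 * M) (fld (bchTerm br A B N p)) ≤ ENNReal.ofReal
      (M / (4 * totalDeg p) * (8 * totalDeg p * a / M) ^ p.1 * (16 * totalDeg p * b / M) ^ p.2) := by
  set ν : ℝ := (totalDeg p : ℝ) with hν
  have hν0 : 0 < ν := by rw [hν]; exact_mod_cast hp
  have hδ : 0 < M / ν := by positivity
  have key : ∀ s t u : ℝ, 0 < u → 0 < t → s = 2 / (M / ν) * (u * t) → ∀ x : ℝ≥0∞, x ≤ ENNReal.ofReal t →
      2 / ENNReal.ofReal (M / ν) * (ENNReal.ofReal u * x) ≤ ENNReal.ofReal s := by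
    intro s t u hu ht hs x hx
    rw [hs, ENNReal.ofReal_mul (by positivity), ENNReal.ofReal_mul hu.le,
      ENNReal.ofReal_div_of_pos hδ, ENNReal.ofReal_ofNat]
    gcongr
  have hsub : ∀ r : ℝ, 4 * M - M / ν ≤ 4 * M := fun _ => by linarith
  have h1 := mass_bchTerm_le (br := br) (A := A) (B := B) (R := 4 * M) hfld hδ
    (ρ := ENNReal.ofReal (M / (8 * ν * a))) (σ := ENNReal.ofReal (M / (16 * ν * b)))
    (by
      refine (key (1 / 4) a _ (by positivity) ha (by field_simp; norm_num) _
        ((ballNorm_mono (hsub 0) _).trans hA)).trans ?_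
      rw [ENNReal.ofReal_div_of_pos (by norm_num)]; simp)
    (by
      refine (key (1 / 8) b _ (by positivity) hb (by field_simp; norm_num) _
        ((ballNorm_mono (hsub 0) _).trans hB)).trans ?_
      rw [ENNReal.ofReal_div_of_pos (by norm_num)]; simp) N
  have h2 := (ENNReal.le_tsum p).trans h1
  have h3 : 4 * M - (totalDeg p : ℝ) * (M / ν) = 3 * M := by
    rw [← hν]; field_simp; ring
  simp only [h3] at h2
  have e1 : ENNReal.ofReal (8 * ν * a / M) ^ p.1 * ENNReal.ofReal (M / (8 * ν * a)) ^ p.1 = 1 := by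
    rw [← mul_pow, ← ENNReal.ofReal_mul (by positivity)]
    have : 8 * ν * a / M * (M / (8 * ν * a)) = 1 := by field_simp
    rw [this]; simp
  have e2 : ENNReal.ofReal (16 * ν * b / M) ^ p.2 * ENNReal.ofReal (M / (16 * ν * b)) ^ p.2 = 1 := by
    rw [← mul_pow, ← ENNReal.ofReal_mul (by positivity)]
    have : 16 * ν * b / M * (M / (16 * ν * b)) = 1 := by field_simp
    rw [this]; simp
  set x := ballNorm (3 * M) (fld (bchTerm br A B N p))
  calc x = (ENNReal.ofReal (8 * ν * a / M) ^ p.1 * ENNReal.ofReal (M / (8 * ν * a)) ^ p.1) *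
        (ENNReal.ofReal (16 * ν * b / M) ^ p.2 * ENNReal.ofReal (M / (16 * ν * b)) ^ p.2) * x := by
        rw [e1, e2]; simp
    _ = ENNReal.ofReal (8 * ν * a / M) ^ p.1 * ENNReal.ofReal (16 * ν * b / M) ^ p.2 *
        (ENNReal.ofReal (M / (8 * ν * a)) ^ p.1 * ENNReal.ofReal (M / (16 * ν * b)) ^ p.2 * x) := by
        ring
    _ ≤ ENNReal.ofReal (8 * ν * a / M) ^ p.1 * ENNReal.ofReal (16 * ν * b / M) ^ p.2 *
        (ENNReal.ofReal (M / ν) / 4) := by gcongr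
    _ = _ := by
        rw [ENNReal.ofReal_mul (by positivity), ENNReal.ofReal_mul (by positivity),
          ENNReal.ofReal_pow (by positivity), ENNReal.ofReal_pow (by positivity)]
        have : M / (4 * ν) = M / ν / 4 := by field_simp
        rw [this, ENNReal.ofReal_div_of_pos (y := 4) (by norm_num), ENNReal.ofReal_ofNat]
        ring

/-- The part of the truncated series that is at least quadratic in `B`. -/
def bchRemainder (br : L →ₗ[ℝ] L →ₗ[ℝ] L) (A B : L) (N : ℕ) : L :=
  ∑ p ∈ bidegLE N with 2 ≤ p.2, bchTerm br A B N p

lemma bchSum_eq (A B : L) {N : ℕ} (hN : 1 ≤ N) :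
    bchSum br A B N = A + ∑ n ∈ range N, bernoulliCoeff n • ((-br A) ^ n) B +
      bchRemainder br A B N := by
  have h1 : ∀ m, ∑ n ∈ range (N + 1 - m), bchTerm br A B N (n, m) =
      ∑ p ∈ bidegLE N with p.2 = m, bchTerm br A B N p := by
    intro m
    refine sum_bij (fun n _ => (n, m)) ?_ ?_ ?_ ?_
    · intro n hn
      simp only [mem_range] at hn
      simp only [mem_filter, mem_bidegLE, totalDeg, and_true]
      lia
    · intro a _ b _ h
      exact congrArg Prod.fst h
    · rintro ⟨n, m'⟩ hp
      simp only [mem_filter, mem_bidegLE, totalDeg] at hp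
      obtain ⟨h1, rfl⟩ := hp
      exact ⟨n, by simp only [mem_range]; lia, rfl⟩
    · intros; rfl
  have h2 : bchSum br A B N = ∑ p ∈ bidegLE N with p.2 = 0, bchTerm br A B N p +
      ∑ p ∈ bidegLE N with p.2 = 1, bchTerm br A B N p + bchRemainder br A B N := by
    rw [bchSum, bchRemainder, sum_filter, sum_filter, sum_filter, ← sum_add_distrib,
      ← sum_add_distrib]
    refine sum_congr rfl fun p _ => ?_
    rcases Nat.lt_or_ge p.2 2 with h | h
    · have : p.2 = 0 ∨ p.2 = 1 := by lia
      rcases this with h | h <;> simp [h]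
    · have h0 : p.2 ≠ 0 := by lia
      have h1 : p.2 ≠ 1 := by lia
      simp [h, h0, h1]
  rw [h2, ← h1, ← h1]
  congr 2
  · rw [sum_congr rfl fun n _ => bchTerm_snd_zero br A B N n, sum_ite_eq']
    simp; lia
  · exact sum_congr rfl fun n hn => bchTerm_snd_one br A B N n (Nat.succ_le_of_lt (mem_range.1 hn))

lemma sum_geometric_bidegLE_le (N : ℕ) :
    ∑ p ∈ bidegLE N, (4⁻¹ : ℝ) ^ totalDeg p ≤ 2 := by
  have h0 : ∑ n ∈ range (N + 1), (4⁻¹ : ℝ) ^ n ≤ 4 / 3 := by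
    have h := (geom_sum_eq (x := (4⁻¹ : ℝ)) (by norm_num) (N + 1))
    rw [h]
    have : 0 ≤ (4⁻¹ : ℝ) ^ (N + 1) := by positivity
    rw [div_le_iff_of_neg (by norm_num)]
    linarith
  calc ∑ p ∈ bidegLE N, (4⁻¹ : ℝ) ^ totalDeg p
      ≤ ∑ p ∈ range (N + 1) ×ˢ range (N + 1), (4⁻¹ : ℝ) ^ totalDeg p := by
        refine sum_le_sum_of_subset_of_nonneg ?_ fun _ _ _ => by positivity
        intro p hp
        simp only [mem_bidegLE, totalDeg] at hp
        simp only [mem_product, mem_range]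
        lia
    _ = (∑ n ∈ range (N + 1), (4⁻¹ : ℝ) ^ n) * ∑ n ∈ range (N + 1), (4⁻¹ : ℝ) ^ n := by
        rw [sum_mul_sum, sum_product]
        simp only [totalDeg, pow_add]
    _ ≤ (4 / 3) * (4 / 3) := by gcongr
    _ ≤ 2 := by norm_num

/-- Two factors `b` are extracted from each term. All remaining factors are at most 1/8 per degree,
since |p| ≤ `N`, so the sum converges geometrically with a constant independent of `N`. -/
lemma ballNorm_bchRemainder_le
    (hfld : ∀ x y, fld (br x y) = lieDer (fld x) (fld y) - lieDer (fld y) (fld x))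
    {A B : L} {M a b : ℝ} (hM : 0 < M) (ha : 0 < a) (hb : 0 < b)
    (hA : ballNorm (4 * M) (fld A) ≤ ENNReal.ofReal a)
    (hB : ballNorm (4 * M) (fld B) ≤ ENNReal.ofReal b) {N : ℕ}
    (haN : 64 * N * a ≤ M) (hbN : 128 * N * b ≤ M) :
    ballNorm (3 * M) (fld (bchRemainder br A B N)) ≤ ENNReal.ofReal (8192 * b ^ 2 / M) := by
  rw [bchRemainder, map_sum]
  have hterm : ∀ p ∈ (bidegLE N).filter (fun p => 2 ≤ p.2),
      ballNorm (3 * M) (fld (bchTerm br A B N p)) ≤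
        ENNReal.ofReal (4096 * b ^ 2 / M * 4⁻¹ ^ totalDeg p) := by
    intro p hp
    simp only [mem_filter, mem_bidegLE] at hp
    have hp1 : 1 ≤ totalDeg p := by simp only [totalDeg]; lia
    refine (ballNorm_bchTerm_le hfld hM ha hb hA hB N p hp1).trans (ENNReal.ofReal_le_ofReal ?_)
    obtain ⟨m, hm⟩ : ∃ m, p.2 = m + 2 := ⟨p.2 - 2, by lia⟩
    set ν : ℝ := (totalDeg p : ℝ) with hν
    have hν0 : 0 < ν := by rw [hν]; exact_mod_cast hp1
    have hνN : ν ≤ N := by rw [hν]; exact_mod_cast hp.1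
    have h1 : 8 * ν * a / M ≤ 8⁻¹ := by
      rw [div_le_iff₀ hM]
      nlinarith [mul_le_mul_of_nonneg_right hνN ha.le]
    have h2 : 16 * ν * b / M ≤ 8⁻¹ := by
      rw [div_le_iff₀ hM]
      nlinarith [mul_le_mul_of_nonneg_right hνN hb.le]
    have h3 : ν ≤ 2 ^ totalDeg p := by
      rw [hν]; exact_mod_cast (Nat.lt_two_pow_self).le
    have hdeg : totalDeg p = p.1 + m + 2 := by simp only [totalDeg]; lia
    calc M / (4 * ν) * (8 * ν * a / M) ^ p.1 * (16 * ν * b / M) ^ p.2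
        = M / (4 * ν) * (8 * ν * a / M) ^ p.1 * (16 * ν * b / M) ^ m * (16 * ν * b / M) ^ 2 := by
          rw [hm]; ring
      _ ≤ M / (4 * ν) * 8⁻¹ ^ p.1 * 8⁻¹ ^ m * (16 * ν * b / M) ^ 2 := by gcongr
      -- Here 16²/4 = 64 from the extracted square, and another 8² = 64 from completing the power of
      -- 1/8 to |p|. The leftover factor ν is at most 2^|p|, leaving the ratio 1/4.
      _ = 4096 * b ^ 2 / M * (ν * 8⁻¹ ^ totalDeg p) := by
          rw [hdeg]; field_simp; ring
      _ ≤ 4096 * b ^ 2 / M * (2 ^ totalDeg p * 8⁻¹ ^ totalDeg p) := by gcongr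
      _ = 4096 * b ^ 2 / M * 4⁻¹ ^ totalDeg p := by rw [← mul_pow]; norm_num
  refine (ballNorm_sum_le _ _ _).trans ((sum_le_sum hterm).trans ?_)
  rw [← ENNReal.ofReal_sum_of_nonneg fun _ _ => by positivity]
  refine ENNReal.ofReal_le_ofReal ?_
  rw [← mul_sum]
  calc 4096 * b ^ 2 / M * ∑ p ∈ bidegLE N with 2 ≤ p.2, (4⁻¹ : ℝ) ^ totalDeg p
      ≤ 4096 * b ^ 2 / M * 2 := by
        gcongr
        exact (sum_le_sum_of_subset_of_nonneg (filter_subset _ _) fun _ _ _ => by positivity).trans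
          (sum_geometric_bidegLE_le N)
    _ = _ := by ring

end HigherOrder

/-! ### The Bernoulli coefficients -/

lemma inv_factorial_succ_le (l : ℕ) : ((l + 1).factorial : ℝ)⁻¹ ≤ 2⁻¹ ^ l := by
  rw [inv_pow]
  gcongr
  have : ∀ l : ℕ, 2 ^ l ≤ (l + 1).factorial := by
    intro l
    induction l with
    | zero => simp
    | succ l ih =>
      rw [Nat.factorial_succ, pow_succ, mul_comm]
      exact Nat.mul_le_mul (by lia) ih
  exact_mod_cast this l

/-- Strong induction on b_n = -∑ b_(n-l-1)/(l+2)!, with the reciprocal factorials dominated by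
2^(-(l+1)), whose sum is below one. The crude bound gives convergence with geometric ratio 1/2 for
|x| ≤ 1/2. -/
lemma abs_bernoulliCoeff_le (n : ℕ) : |bernoulliCoeff n| ≤ 1 := by
  induction n using Nat.strong_induction_on with
  | _ n ih =>
    have h := sum_bernoulliCoeff n
    rw [sum_range_succ'] at h
    simp only [zero_add, Nat.factorial_one, Nat.cast_one, inv_one, one_mul, Nat.sub_zero] at h
    rcases Nat.eq_zero_or_pos n with rfl | hn
    · simp at h; simp [h]
    rw [if_neg hn.ne'] at h
    have h2 : bernoulliCoeff n = -∑ l ∈ range n,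
        ((l + 1 + 1).factorial : ℝ)⁻¹ * bernoulliCoeff (n - (l + 1)) := by linarith
    rw [h2, abs_neg]
    calc _ ≤ ∑ l ∈ range n, |((l + 1 + 1).factorial : ℝ)⁻¹ * bernoulliCoeff (n - (l + 1))| :=
          abs_sum_le_sum_abs _ _
      _ ≤ ∑ l ∈ range n, (2⁻¹ : ℝ) ^ (l + 1) := by
          refine sum_le_sum fun l hl => ?_
          simp only [mem_range] at hl
          rw [abs_mul, abs_of_nonneg (by positivity)]
          calc _ ≤ (2⁻¹ : ℝ) ^ (l + 1) * 1 := by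
                gcongr
                · exact inv_factorial_succ_le (l + 1)
                · exact ih _ (by lia)
            _ = _ := mul_one _
      _ ≤ 1 := by
          have : ∀ n : ℕ, ∑ l ∈ range n, (2⁻¹ : ℝ) ^ (l + 1) = 1 - 2⁻¹ ^ n := by
            intro n
            induction n with
            | zero => simp
            | succ n ih => rw [sum_range_succ, ih, pow_succ]; ring
          rw [this]
          have : 0 ≤ (2⁻¹ : ℝ) ^ n := by positivity
          linarith

lemma norm_bernoulliCoeff_mul_pow_le {x : ℂ} (hx : ‖x‖ ≤ 1 / 2) (n : ℕ) :
    ‖(bernoulliCoeff n : ℂ) * x ^ n‖ ≤ 2⁻¹ ^ n := by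
  rw [norm_mul, norm_pow, Complex.norm_real, Real.norm_eq_abs]
  calc |bernoulliCoeff n| * ‖x‖ ^ n ≤ 1 * (1 / 2) ^ n := by
        gcongr
        exact abs_bernoulliCoeff_le n
    _ = 2⁻¹ ^ n := by norm_num

lemma tsum_bernoulliCoeff {x : ℂ} (hx : ‖x‖ ≤ 1 / 2) :
    (∑' n : ℕ, (bernoulliCoeff n : ℂ) * x ^ n) * (Complex.exp x - 1) = x := by
  have hgeo : Summable fun n : ℕ => (2⁻¹ : ℝ) ^ n :=
    summable_geometric_of_lt_one (by norm_num) (by norm_num)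
  have hb : Summable fun n : ℕ => ‖(bernoulliCoeff n : ℂ) * x ^ n‖ :=
    hgeo.of_nonneg_of_le (fun _ => norm_nonneg _) (norm_bernoulliCoeff_mul_pow_le hx)
  have hg : Summable fun n : ℕ => ‖((((n + 1).factorial : ℝ)⁻¹ : ℝ) : ℂ) * x ^ n‖ := by
    refine hgeo.of_nonneg_of_le (fun _ => norm_nonneg _) fun n => ?_
    rw [norm_mul, norm_pow, Complex.norm_real, Real.norm_eq_abs, abs_of_nonneg (by positivity)]
    calc _ ≤ (2⁻¹ : ℝ) ^ n * 1 := by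
          gcongr
          · exact inv_factorial_succ_le n
          · exact pow_le_one₀ (norm_nonneg _) (by linarith)
      _ = _ := mul_one _
  have hexp : Complex.exp x - 1 = (∑' n : ℕ, ((((n + 1).factorial : ℝ)⁻¹ : ℝ) : ℂ) * x ^ n) * x := by
    have h := NormedSpace.expSeries_div_hasSum_exp (𝔸 := ℂ) x
    rw [← Complex.exp_eq_exp_ℂ, ← hasSum_nat_add_iff' 1] at h
    simp only [range_one, sum_singleton, pow_zero, Nat.factorial_zero, Nat.cast_one, div_one] at h
    rw [← h.tsum_eq, ← tsum_mul_right]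
    refine tsum_congr fun n => ?_
    push_cast
    rw [pow_succ]
    ring
  rw [hexp, ← mul_assoc, mul_comm (∑' n : ℕ, (bernoulliCoeff n : ℂ) * x ^ n),
    tsum_mul_tsum_eq_tsum_sum_range_of_summable_norm hg hb]
  have hcoef : ∀ n : ℕ, ∑ l ∈ range (n + 1), ((((l + 1).factorial : ℝ)⁻¹ : ℝ) : ℂ) * x ^ l *
      ((bernoulliCoeff (n - l) : ℂ) * x ^ (n - l)) = if n = 0 then 1 else 0 := by
    intro n
    have h := congrArg (fun t : ℝ => (t : ℂ) * x ^ n) (sum_bernoulliCoeff n)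
    simp only [Complex.ofReal_sum, Complex.ofReal_mul, sum_mul] at h
    refine Eq.trans (sum_congr rfl fun l hl => ?_) (h.trans ?_)
    · have : x ^ n = x ^ l * x ^ (n - l) := by
        rw [← pow_add]; congr 1; simp only [mem_range] at hl; lia
      rw [this]; ring
    · split_ifs with h0 <;> simp [h0]
  rw [tsum_congr hcoef, tsum_ite_eq, one_mul]

/-- The truncated generating series of the Bernoulli coefficients approximates `x / (exp x - 1)`. -/
lemma norm_sum_bernoulliCoeff_sub_le {t : ℝ} (ht : |t| ≤ 1 / 2) (N : ℕ) :
    ‖∑ n ∈ range N, (bernoulliCoeff n : ℂ) * (Complex.I * t) ^ n - bernoulliFactor t‖ ≤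
      2 * 2⁻¹ ^ N := by
  have hx : ‖Complex.I * t‖ ≤ 1 / 2 := by simpa using ht
  have hS : bernoulliFactor t = ∑' n : ℕ, (bernoulliCoeff n : ℂ) * (Complex.I * t) ^ n := by
    rw [bernoulliFactor]
    split_ifs with h0
    · subst h0
      rw [tsum_eq_single 0 fun n hn => by simp [hn]]
      have := sum_bernoulliCoeff 0
      simp only [zero_add, range_one, sum_singleton, Nat.factorial_one, Nat.cast_one, inv_one,
        one_mul, Nat.sub_self, if_true] at this
      simp [this]
    · have h := tsum_bernoulliCoeff hx
      have hne : Complex.exp (Complex.I * t) - 1 ≠ 0 := by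
        intro h1
        rw [h1, mul_zero] at h
        exact mul_ne_zero Complex.I_ne_zero (by exact_mod_cast h0) h.symm
      exact (eq_div_of_mul_eq hne h).symm
  have hgeo : HasSum (fun n : ℕ => (2⁻¹ : ℝ) ^ (n + N)) (2 * 2⁻¹ ^ N) := by
    have h := (hasSum_geometric_of_lt_one (r := (2⁻¹ : ℝ)) (by norm_num) (by norm_num)).mul_right
      ((2⁻¹ : ℝ) ^ N)
    simp only [← pow_add] at h
    rwa [show (1 - 2⁻¹ : ℝ)⁻¹ = 2 by norm_num] at h
  have hsum : Summable fun n : ℕ => (bernoulliCoeff n : ℂ) * (Complex.I * t) ^ n :=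
    Summable.of_norm_bounded (summable_geometric_of_lt_one (r := (2⁻¹ : ℝ)) (by norm_num) (by norm_num))
      (norm_bernoulliCoeff_mul_pow_le hx)
  rw [hS, ← hsum.sum_add_tsum_nat_add N, sub_add_cancel_left, norm_neg]
  exact tsum_of_norm_bounded hgeo fun n => norm_bernoulliCoeff_mul_pow_le hx _

end

end SplittingBEA

namespace SplittingBEA

open Finset
open scoped ENNReal ContDiff

noncomputable section

/-! ### Polynomial maps -/

section Polynomial

variable {E F : Type*} [NormedAddCommGroup E] [NormedSpace ℂ E]
  [NormedAddCommGroup F] [NormedSpace ℂ F]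

/-- `f` is smooth and homogeneous of degree `ℓ`. -/
def IsHomogeneousMap (ℓ : ℕ) (f : E → F) : Prop :=
  ContDiff ℂ ∞ f ∧ ∀ (t : ℂ) (z : E), f (t • z) = t ^ ℓ • f z

variable (E F) in
/-- Sums of smooth homogeneous maps of degree at least `m`. -/
def polyMaps (m : ℕ) : Submodule ℂ (E → F) :=
  Submodule.span ℂ {f | ∃ ℓ, m ≤ ℓ ∧ IsHomogeneousMap ℓ f}

lemma IsHomogeneousMap.mem_polyMaps {m ℓ : ℕ} {f : E → F} (hf : IsHomogeneousMap ℓ f) (h : m ≤ ℓ) :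
    f ∈ polyMaps E F m := Submodule.subset_span ⟨ℓ, h, hf⟩

lemma contDiff_of_mem_polyMaps {m : ℕ} {f : E → F} (hf : f ∈ polyMaps E F m) : ContDiff ℂ ∞ f := by
  induction hf using Submodule.span_induction with
  | mem f hf => obtain ⟨ℓ, -, h⟩ := hf; exact h.1
  | zero => exact contDiff_const
  | add f g _ _ hf hg => exact hf.add hg
  | smul c f _ hf => exact hf.const_smul c

lemma differentiable_of_mem_polyMaps {m : ℕ} {f : E → F} (hf : f ∈ polyMaps E F m) :
    Differentiable ℂ f := (contDiff_of_mem_polyMaps hf).differentiable (by simp)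

lemma IsHomogeneousMap.fderiv_smul {ℓ : ℕ} {f : E → F} (hf : IsHomogeneousMap ℓ f) (t : ℂ)
    (z v : E) : fderiv ℂ f (t • z) (t • v) = t ^ ℓ • fderiv ℂ f z v := by
  have hd : Differentiable ℂ f := hf.1.differentiable (by simp)
  have h1 : HasFDerivAt (fun z => f (t • z))
      ((fderiv ℂ f (t • z)).comp (t • ContinuousLinearMap.id ℂ E)) z :=
    (hd (t • z)).hasFDerivAt.comp z ((hasFDerivAt_id z).const_smul t)
  have h2 : HasFDerivAt (fun z => f (t • z)) (t ^ ℓ • fderiv ℂ f z) z := by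
    simp only [hf.2 t]
    exact (hd z).hasFDerivAt.const_smul _
  simpa using DFunLike.congr_fun (h1.unique h2) v

/-- By linearity in both arguments it suffices to take homogeneous maps: differentiation lowers the
degree by one and `X` has degree at least one, so the order `m` at the origin is not lowered. -/
lemma fderiv_apply_mem_polyMaps {m : ℕ} {G : E → F} {X : E → E} (hG : G ∈ polyMaps E F m)
    (hX : X ∈ polyMaps E E 1) : (fun z => fderiv ℂ G z (X z)) ∈ polyMaps E F m := by
  induction hG using Submodule.span_induction with
  | zero =>
    have : (fun z => fderiv ℂ (0 : E → F) z (X z)) = 0 := by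
      ext z; simp
    rw [this]; exact Submodule.zero_mem _
  | add f g hf hg ihf ihg =>
    have : (fun z => fderiv ℂ (f + g) z (X z)) =
        (fun z => fderiv ℂ f z (X z)) + fun z => fderiv ℂ g z (X z) := by
      ext z
      rw [fderiv_add (differentiable_of_mem_polyMaps hf z) (differentiable_of_mem_polyMaps hg z)]
      rfl
    rw [this]; exact Submodule.add_mem _ ihf ihg
  | smul c f hf ihf =>
    have : (fun z => fderiv ℂ (c • f) z (X z)) = c • fun z => fderiv ℂ f z (X z) := by
      ext z
      rw [fderiv_const_smul (differentiable_of_mem_polyMaps hf z)]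
      rfl
    rw [this]; exact Submodule.smul_mem _ _ ihf
  | mem f hf =>
    obtain ⟨ℓ, hℓ, hf⟩ := hf
    induction hX using Submodule.span_induction with
    | zero =>
      have : (fun z => fderiv ℂ f z ((0 : E → E) z)) = 0 := by
        ext z; simp
      rw [this]; exact Submodule.zero_mem _
    | add X Y _ _ hX hY =>
      have : (fun z => fderiv ℂ f z ((X + Y) z)) =
          (fun z => fderiv ℂ f z (X z)) + fun z => fderiv ℂ f z (Y z) := by
        ext z; simp
      rw [this]; exact Submodule.add_mem _ hX hY
    | smul c X _ hX =>
      have : (fun z => fderiv ℂ f z ((c • X) z)) = c • fun z => fderiv ℂ f z (X z) := by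
        ext z; simp
      rw [this]; exact Submodule.smul_mem _ _ hX
    | mem X hX =>
      obtain ⟨n, hn, hX⟩ := hX
      obtain ⟨n, rfl⟩ : ∃ k, n = k + 1 := ⟨n - 1, by lia⟩
      refine IsHomogeneousMap.mem_polyMaps (ℓ := ℓ + n)
        ⟨contDiff_fderiv_apply hf.1 hX.1, fun t z => ?_⟩ (by lia)
      change fderiv ℂ f (t • z) (X (t • z)) = t ^ (ℓ + n) • fderiv ℂ f z (X z)
      rw [hX.2, pow_succ, mul_smul, map_smul, hf.fderiv_smul, smul_smul, ← pow_add, add_comm]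

lemma eq_zero_of_mem_polyMaps {m : ℕ} (hm : 1 ≤ m) {f : E → F} (hf : f ∈ polyMaps E F m) :
    f 0 = 0 := by
  induction hf using Submodule.span_induction with
  | mem f hf =>
    obtain ⟨ℓ, hℓ, hf⟩ := hf
    have h := hf.2 0 0
    rwa [zero_smul, zero_pow (by lia), zero_smul] at h
  | zero => rfl
  | add f g _ _ hf hg => rw [Pi.add_apply, hf, hg, add_zero]
  | smul c f _ hf => rw [Pi.smul_apply, hf, smul_zero]

end Polynomial

/-! ### Hamiltonians and their vector fields -/

/-- A strong form of a symplectic structure, together with a set of symplectic symmetries and a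
compatible conjugation. -/
structure SymplecticSpace (E : Type*) [NormedAddCommGroup E] [NormedSpace ℂ E] where
  form : E →L[ℂ] E →L[ℂ] ℂ
  antisymm : ∀ u v, form u v = -form v u
  norm_le : ∀ u v, ‖form u v‖ ≤ ‖u‖ * ‖v‖
  nondegenerate : ∀ u, (∀ v, form u v = 0) → u = 0
  symmetries : Set (E →L[ℂ] E)
  symmetries_surjective : ∀ T ∈ symmetries, Function.Surjective T
  form_symmetries : ∀ T ∈ symmetries, ∀ u v, form (T u) (T v) = form u v
  conj : E →ₛₗ[starRingEnd ℂ] E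
  conj_surjective : Function.Surjective conj
  form_conj : ∀ u v, form (conj u) (conj v) = starRingEnd ℂ (form u v)

namespace SymplecticSpace

variable {E : Type*} [NormedAddCommGroup E] [NormedSpace ℂ E] (S : SymplecticSpace E)

/-- `F` is an invariant real polynomial Hamiltonian with vector field `X`. -/
structure IsHam (F : E → ℂ) (X : E → E) : Prop where
  mem_fst : F ∈ polyMaps E ℂ 2
  mem_snd : X ∈ polyMaps E E 1
  fderiv_eq : ∀ z v, fderiv ℂ F z v = S.form (X z) v
  symm : ∀ T ∈ S.symmetries, ∀ z, F (T z) = F z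
  conj : ∀ z, F (S.conj z) = starRingEnd ℂ (F z)

variable {S} {F G : E → ℂ} {X Y : E → E}

lemma ext_form {u v : E} (h : ∀ w, S.form u w = S.form v w) : u = v := by
  rw [← sub_eq_zero]
  refine S.nondegenerate _ fun w => ?_
  rw [map_sub, sub_apply, h, sub_self]

lemma IsHam.differentiable (h : S.IsHam F X) : Differentiable ℂ F :=
  differentiable_of_mem_polyMaps h.mem_fst

/-- The symplectic form is nondegenerate, so the differential determines the field. -/
lemma IsHam.field_unique (h : S.IsHam F X) (h' : S.IsHam F Y) : X = Y := by
  funext z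
  exact ext_form (S := S) fun w => by rw [← h.fderiv_eq, ← h'.fderiv_eq]

lemma IsHam.add (hF : S.IsHam F X) (hG : S.IsHam G Y) : S.IsHam (F + G) (X + Y) where
  mem_fst := Submodule.add_mem _ hF.mem_fst hG.mem_fst
  mem_snd := Submodule.add_mem _ hF.mem_snd hG.mem_snd
  fderiv_eq z v := by
    rw [fderiv_add (hF.differentiable z) (hG.differentiable z), add_apply,
      hF.fderiv_eq, hG.fderiv_eq, Pi.add_apply, map_add, add_apply]
  symm T hT z := by simp [hF.symm T hT, hG.symm T hT]
  conj z := by simp [hF.conj, hG.conj]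

lemma IsHam.zero : S.IsHam 0 0 where
  mem_fst := Submodule.zero_mem _
  mem_snd := Submodule.zero_mem _
  fderiv_eq z v := by simp
  symm T hT z := by simp
  conj z := by simp

lemma IsHam.smul (c : ℝ) (hF : S.IsHam F X) : S.IsHam (c • F) (c • X) := by
  have h1 : c • F = (c : ℂ) • F := by ext z; simp
  have h2 : c • X = (c : ℂ) • X := by ext z; exact (Complex.coe_smul c (X z)).symm
  rw [h1, h2]
  exact
  { mem_fst := Submodule.smul_mem _ _ hF.mem_fst
    mem_snd := Submodule.smul_mem _ _ hF.mem_snd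
    fderiv_eq := fun z v => by
      rw [fderiv_const_smul (hF.differentiable z), smul_apply,
        hF.fderiv_eq, Pi.smul_apply, map_smul, smul_apply]
    symm := fun T hT z => by simp [hF.symm T hT]
    conj := fun z => by simp [hF.conj] }

lemma IsHam.fderiv_symm (hF : S.IsHam F X) {T : E →L[ℂ] E} (hT : T ∈ S.symmetries) (z v : E) :
    fderiv ℂ F (T z) (T v) = fderiv ℂ F z v := by
  have h1 : HasFDerivAt (fun z => F (T z)) ((fderiv ℂ F (T z)).comp T) z :=
    (hF.differentiable (T z)).hasFDerivAt.comp z T.hasFDerivAt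
  have h2 : (fun z => F (T z)) = F := funext (hF.symm T hT)
  rw [h2] at h1
  rw [h1.fderiv]
  rfl

lemma IsHam.field_symm (hF : S.IsHam F X) {T : E →L[ℂ] E} (hT : T ∈ S.symmetries) (z : E) :
    X (T z) = T (X z) := by
  refine ext_form (S := S) fun w => ?_
  obtain ⟨w, rfl⟩ := S.symmetries_surjective T hT w
  rw [← hF.fderiv_eq, hF.fderiv_symm hT, hF.fderiv_eq, S.form_symmetries T hT]

lemma IsHam.fderiv_conj (hF : S.IsHam F X) (z v : E) :
    fderiv ℂ F (S.conj z) (S.conj v) = starRingEnd ℂ (fderiv ℂ F z v) := by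
  -- The conjugation is antilinear, so the chain rule over ℂ is not available. Derivatives are
  -- compared along real lines, on which it commutes with the parameter.
  have hline : ∀ z v : E, HasDerivAt (fun t : ℝ => F (z + (t : ℂ) • v)) (fderiv ℂ F z v) 0 := by
    intro z v
    have h0 : HasDerivAt (fun t : ℂ => z + t • v) v 0 := by
      simpa using ((hasDerivAt_id (0 : ℂ)).smul_const v).const_add z
    have h1 : HasDerivAt (fun t : ℂ => F (z + t • v)) (fderiv ℂ F z v) 0 := by
      have h2 : HasFDerivAt F (fderiv ℂ F z) (z + (0 : ℂ) • v) := by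
        rw [zero_smul, add_zero]; exact (hF.differentiable z).hasFDerivAt
      exact h2.comp_hasDerivAt 0 h0
    have h3 : HasDerivAt (fun t : ℂ => F (z + t • v)) (fderiv ℂ F z v) ((0 : ℝ) : ℂ) := by
      simpa using h1
    exact h3.comp_ofReal
  have h1 := hline (S.conj z) (S.conj v)
  have h2 : (fun t : ℝ => F (S.conj z + (t : ℂ) • S.conj v)) =
      fun t : ℝ => starRingEnd ℂ (F (z + (t : ℂ) • v)) := by
    funext t
    rw [← hF.conj, map_add, map_smulₛₗ, Complex.conj_ofReal]
  rw [h2] at h1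
  have h3 : HasDerivAt (fun t : ℝ => starRingEnd ℂ (F (z + (t : ℂ) • v)))
      (starRingEnd ℂ (fderiv ℂ F z v)) 0 := by
    exact (Complex.conjCLE.toContinuousLinearMap.hasFDerivAt).comp_hasDerivAt (0 : ℝ) (hline z v)
  exact h1.unique h3

lemma IsHam.field_conj (hF : S.IsHam F X) (z : E) : X (S.conj z) = S.conj (X z) := by
  refine ext_form (S := S) fun w => ?_
  obtain ⟨w, rfl⟩ := S.conj_surjective w
  rw [← hF.fderiv_eq, hF.fderiv_conj, hF.fderiv_eq, S.form_conj]

/-- Symmetry of the second derivative of `G`, since dG is the form applied to `Y`. This is the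
identity that makes the commutator of fields Hamiltonian. -/
lemma IsHam.second_symm (hG : S.IsHam G Y) (z v w : E) :
    S.form (fderiv ℂ Y z v) w = S.form (fderiv ℂ Y z w) v := by
  have hY : Differentiable ℂ Y := differentiable_of_mem_polyMaps hG.mem_snd
  have h1 : ∀ z, HasFDerivAt G (S.form (Y z)) z := fun z => by
    have : fderiv ℂ G z = S.form (Y z) := by ext v; exact hG.fderiv_eq z v
    rw [← this]; exact (hG.differentiable z).hasFDerivAt
  have h2 : HasFDerivAt (fun z => S.form (Y z)) (S.form.comp (fderiv ℂ Y z)) z :=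
    S.form.hasFDerivAt.comp z (hY z).hasFDerivAt
  exact second_derivative_symmetric (𝕜 := ℂ) h1 h2 v w

/-- The Poisson bracket. -/
lemma IsHam.bracket (hF : S.IsHam F X) (hG : S.IsHam G Y) :
    S.IsHam (fun z => fderiv ℂ G z (X z))
      ((fun z => fderiv ℂ Y z (X z)) - fun z => fderiv ℂ X z (Y z)) where
  mem_fst := fderiv_apply_mem_polyMaps hG.mem_fst hF.mem_snd
  mem_snd := Submodule.sub_mem _ (fderiv_apply_mem_polyMaps hG.mem_snd hF.mem_snd)
    (fderiv_apply_mem_polyMaps hF.mem_snd hG.mem_snd)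
  fderiv_eq z v := by
    have hY : Differentiable ℂ Y := differentiable_of_mem_polyMaps hG.mem_snd
    have hX : Differentiable ℂ X := differentiable_of_mem_polyMaps hF.mem_snd
    have h1 : (fun z => fderiv ℂ G z (X z)) = fun z => S.form (Y z) (X z) := by
      funext z; exact hG.fderiv_eq z _
    have h2 : HasFDerivAt (fun z => S.form (Y z)) (S.form.comp (fderiv ℂ Y z)) z :=
      S.form.hasFDerivAt.comp z (hY z).hasFDerivAt
    rw [h1, (h2.clm_apply (hX z).hasFDerivAt).fderiv]
    simp only [add_apply, ContinuousLinearMap.comp_apply,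
      ContinuousLinearMap.flip_apply, Pi.sub_apply, map_sub, sub_apply]
    -- The differential of form(Y, X) in direction v is form(DY v, X) + form(Y, DX v); symmetry of
    -- both second derivatives moves v to the last slot.
    rw [hG.second_symm z v, S.antisymm (Y z), hF.second_symm z v]
    ring
  symm T hT z := by rw [hF.field_symm hT, hG.fderiv_symm hT]
  conj z := by rw [hF.field_conj, hG.fderiv_conj]

variable (S) in
/-- The Lie algebra of pairs of a Hamiltonian and its vector field. -/
def hamPairs : Submodule ℝ ((E → ℂ) × (E → E)) where
  carrier := {p | S.IsHam p.1 p.2}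
  add_mem' hF hG := hF.add hG
  zero_mem' := IsHam.zero
  smul_mem' c _ hF := hF.smul c

variable (S) in
/-- The type of pairs of a Hamiltonian and its vector field. -/
def Ham : Type _ := S.hamPairs

instance : AddCommGroup S.Ham := inferInstanceAs (AddCommGroup S.hamPairs)

instance : Module ℝ S.Ham := inferInstanceAs (Module ℝ S.hamPairs)

/-- A Hamiltonian together with its vector field. -/
def IsHam.toHam (h : S.IsHam F X) : S.Ham := (⟨(F, X), h⟩ : S.hamPairs)

lemma Ham.isHam (x : S.Ham) : S.IsHam x.1.1 x.1.2 := x.2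

lemma fderiv_real_smul {F : Type*} [NormedAddCommGroup F] [NormedSpace ℂ F] {f : E → F} {z : E}
    (hf : DifferentiableAt ℂ f z) (c : ℝ) (v : E) :
    fderiv ℂ (c • f) z v = c • fderiv ℂ f z v := by
  have h1 : c • f = (c : ℂ) • f := by ext z; exact (Complex.coe_smul c (f z)).symm
  rw [h1, fderiv_const_smul hf, smul_apply, Complex.coe_smul]

lemma map_real_smul {F : Type*} [NormedAddCommGroup F] [NormedSpace ℂ F] (f : E →L[ℂ] F) (c : ℝ)
    (v : E) : f (c • v) = c • f v := by
  rw [← Complex.coe_smul, map_smul, Complex.coe_smul]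

variable (S) in
/-- The bracket of Hamiltonians, as a bilinear map. -/
def bracket : S.Ham →ₗ[ℝ] S.Ham →ₗ[ℝ] S.Ham :=
  LinearMap.mk₂ ℝ (fun x y => ((Ham.isHam x).bracket (Ham.isHam y)).toHam)
    (fun x x' y => by
      have hx := differentiable_of_mem_polyMaps (Ham.isHam x).mem_snd
      have hx' := differentiable_of_mem_polyMaps (Ham.isHam x').mem_snd
      refine Subtype.ext (Prod.ext (funext fun z => ?_) (funext fun z => ?_))
      · exact map_add (fderiv ℂ y.1.1 z) _ _
      · change fderiv ℂ y.1.2 z (x.1.2 z + x'.1.2 z) - fderiv ℂ (x.1.2 + x'.1.2) z (y.1.2 z) =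
          (fderiv ℂ y.1.2 z (x.1.2 z) - fderiv ℂ x.1.2 z (y.1.2 z)) +
            (fderiv ℂ y.1.2 z (x'.1.2 z) - fderiv ℂ x'.1.2 z (y.1.2 z))
        rw [fderiv_add (hx z) (hx' z), map_add, add_apply]
        abel)
    (fun c x y => by
      have hx := differentiable_of_mem_polyMaps (Ham.isHam x).mem_snd
      refine Subtype.ext (Prod.ext (funext fun z => ?_) (funext fun z => ?_))
      · exact map_real_smul (fderiv ℂ y.1.1 z) c _
      · change fderiv ℂ y.1.2 z (c • x.1.2 z) - fderiv ℂ (c • x.1.2) z (y.1.2 z) =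
          c • (fderiv ℂ y.1.2 z (x.1.2 z) - fderiv ℂ x.1.2 z (y.1.2 z))
        rw [fderiv_real_smul (hx z), map_real_smul, smul_sub])
    (fun x y y' => by
      have hy := differentiable_of_mem_polyMaps (Ham.isHam y).mem_snd
      have hy' := differentiable_of_mem_polyMaps (Ham.isHam y').mem_snd
      refine Subtype.ext (Prod.ext (funext fun z => ?_) (funext fun z => ?_))
      · change fderiv ℂ (y.1.1 + y'.1.1) z (x.1.2 z) =
          fderiv ℂ y.1.1 z (x.1.2 z) + fderiv ℂ y'.1.1 z (x.1.2 z)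
        rw [fderiv_add ((Ham.isHam y).differentiable z) ((Ham.isHam y').differentiable z)]
        rfl
      · change fderiv ℂ (y.1.2 + y'.1.2) z (x.1.2 z) - fderiv ℂ x.1.2 z (y.1.2 z + y'.1.2 z) =
          (fderiv ℂ y.1.2 z (x.1.2 z) - fderiv ℂ x.1.2 z (y.1.2 z)) +
            (fderiv ℂ y'.1.2 z (x.1.2 z) - fderiv ℂ x.1.2 z (y'.1.2 z))
        rw [fderiv_add (hy z) (hy' z), map_add, add_apply]
        abel)
    (fun c x y => by
      have hy := differentiable_of_mem_polyMaps (Ham.isHam y).mem_snd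
      refine Subtype.ext (Prod.ext (funext fun z => ?_) (funext fun z => ?_))
      · exact fderiv_real_smul ((Ham.isHam y).differentiable z) c _
      · change fderiv ℂ (c • y.1.2) z (x.1.2 z) - fderiv ℂ x.1.2 z (c • y.1.2 z) =
          c • (fderiv ℂ y.1.2 z (x.1.2 z) - fderiv ℂ x.1.2 z (y.1.2 z))
        rw [fderiv_real_smul (hy z), map_real_smul, smul_sub])

variable (S) in
/-- The vector field of a Hamiltonian. -/
def field : S.Ham →ₗ[ℝ] SmoothMap E where
  toFun x := ⟨x.1.2, contDiff_of_mem_polyMaps (Ham.isHam x).mem_snd⟩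
  map_add' _ _ := rfl
  map_smul' _ _ := rfl

variable (S) in
/-- The value of a Hamiltonian. -/
def value : S.Ham →ₗ[ℝ] (E → ℂ) where
  toFun x := x.1.1
  map_add' _ _ := rfl
  map_smul' _ _ := rfl

lemma value_bracket (x y : S.Ham) (z : E) :
    S.value (S.bracket x y) z = fderiv ℂ (S.value y) z (S.field x z) := rfl

lemma field_bracket (x y : S.Ham) :
    S.field (S.bracket x y) = lieDer (S.field x) (S.field y) - lieDer (S.field y) (S.field x) := rfl

lemma isHam_value (x : S.Ham) : S.IsHam (S.value x) (S.field x) := Ham.isHam x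

/-- Identities between Hamiltonians with their fields need only be checked on values. -/
lemma value_injective : Function.Injective S.value := by
  intro x y h
  refine Subtype.ext (Prod.ext h ((isHam_value x).field_unique ?_))
  rw [h]
  exact isHam_value y

/-- The differential is form(X, ·), of norm at most ‖X‖, so a bound for the field on a ball is a
Lipschitz constant for the Hamiltonian there. -/
lemma norm_value_sub_le (x : S.Ham) {r c : ℝ} (hc : ∀ z, ‖z‖ < r → ‖S.field x z‖ ≤ c)
    {u v : E} (hu : ‖u‖ < r) (hv : ‖v‖ < r) :
    ‖S.value x v - S.value x u‖ ≤ c * ‖v - u‖ := by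
  have hc0 : 0 ≤ c := (norm_nonneg _).trans (hc u hu)
  refine (convex_ball (0 : E) r).norm_image_sub_le_of_norm_fderiv_le (𝕜 := ℂ)
    (fun z _ => (isHam_value x).differentiable z) (fun z hz => ?_)
    (mem_ball_zero_iff.2 hu) (mem_ball_zero_iff.2 hv)
  refine ContinuousLinearMap.opNorm_le_bound _ hc0 fun w => ?_
  rw [(isHam_value x).fderiv_eq]
  refine (S.norm_le _ _).trans ?_
  gcongr
  exact hc z (mem_ball_zero_iff.1 hz)

lemma norm_value_le (x : S.Ham) {r c : ℝ} (hr : 0 < r)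
    (hc : ∀ z, ‖z‖ < r → ‖S.field x z‖ ≤ c) {u : E} (hu : ‖u‖ < r) :
    ‖S.value x u‖ ≤ c * ‖u‖ := by
  have h := norm_value_sub_le x hc (u := 0) (v := u) (by simpa using hr) hu
  have h0 : S.value x 0 = 0 := eq_zero_of_mem_polyMaps (by norm_num) (isHam_value x).mem_fst
  rwa [h0, sub_zero, sub_zero] at h

/-- The Hamiltonian is constant along its flow. -/
lemma value_eq_of_timeOne (x : S.Ham) {u v : E} (h : TimeOne (S.field x) u v) :
    S.value x v = S.value x u := by
  obtain ⟨w, rfl, rfl, hw⟩ := h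
  have h1 : ∀ τ ∈ Set.Icc (0 : ℝ) 1,
      HasDerivWithinAt (fun τ => S.value x (w τ)) 0 (Set.Icc 0 1) τ := by
    intro τ hτ
    have h2 := ((isHam_value x).differentiable (w τ)).hasFDerivAt.restrictScalars ℝ
    have h3 := h2.comp_hasDerivWithinAt τ (hw τ hτ)
    have h4 : (fderiv ℂ (S.value x) (w τ)).restrictScalars ℝ (S.field x (w τ)) = 0 := by
      change fderiv ℂ (S.value x) (w τ) (S.field x (w τ)) = 0
      rw [(isHam_value x).fderiv_eq]
      have h5 := S.antisymm (S.field x (w τ)) (S.field x (w τ))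
      linear_combination (1 / 2 : ℂ) * h5
    rwa [h4] at h3
  exact constant_of_has_deriv_right_zero (fun τ hτ => (h1 τ hτ).continuousWithinAt)
    (fun τ hτ => (h1 τ (Set.Ico_subset_Icc_self hτ)).mono_of_mem_nhdsWithin
      (Icc_mem_nhdsGE_of_mem hτ)) 1 ⟨zero_le_one, le_rfl⟩

end SymplecticSpace

end

end SplittingBEA

namespace SplittingBEA

open Finset Filter Topology
open scoped ENNReal ContDiff

noncomputable section

/-! ### Multilinear maps on `ℓ¹` -/

section SumSpace

/-- The space `ℓ¹(J)` of summable families. -/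
abbrev SumSpace (J : Type*) : Type _ := lp (fun _ : J => ℂ) 1

variable {J : Type*}

lemma SumSpace.hasSum_norm (z : SumSpace J) : HasSum (fun j => ‖z j‖) ‖z‖ := by
  simpa using lp.hasSum_norm (p := 1) (by simp) z

lemma SumSpace.memℓp {f : J → ℂ} (h : Summable fun j => ‖f j‖) : Memℓp f 1 :=
  memℓp_gen (by simpa using h)

lemma SumSpace.norm_apply_le (z : SumSpace J) (j : J) : ‖z j‖ ≤ ‖z‖ :=
  lp.norm_apply_le_norm (by simp) z j

lemma SumSpace.norm_le {z : SumSpace J} {C : ℝ} (h : ∀ s : Finset J, ∑ j ∈ s, ‖z j‖ ≤ C) :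
    ‖z‖ ≤ C :=
  hasSum_le_of_sum_le (SumSpace.hasSum_norm z) h

/-- The basis vectors of `ℓ¹`. -/
def SumSpace.basis [DecidableEq J] (j : J) : SumSpace J := lp.single 1 j (1 : ℂ)

lemma SumSpace.basis_apply [DecidableEq J] (j k : J) :
    SumSpace.basis j k = if k = j then 1 else 0 := by
  rw [SumSpace.basis, lp.single_apply, Pi.single_apply]

lemma SumSpace.hasSum_basis [DecidableEq J] (z : SumSpace J) :
    HasSum (fun j => z j • SumSpace.basis j) z := by
  have h : (fun j => z j • SumSpace.basis j) = fun j => lp.single 1 j (z j) := by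
    funext j
    rw [SumSpace.basis, ← lp.single_smul, smul_eq_mul, mul_one]
  rw [h]
  exact lp.hasSum_single (p := 1) (by simp) z

/-- Cubes s^ℓ are cofinal among finite sets of multi-indices. Sums of summable families may thus be
computed over cubes, where sums of products factor. -/
lemma tendsto_piFinset (ℓ : ℕ) :
    Tendsto (fun s : Finset J => Fintype.piFinset fun _ : Fin ℓ => s) atTop atTop := by
  classical
  refine tendsto_atTop_finset_of_monotone (fun s t h => Fintype.piFinset_subset _ _ fun _ => h)
    fun x => ⟨univ.image x, ?_⟩
  rw [Fintype.mem_piFinset]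
  exact fun i => mem_image_of_mem _ (mem_univ i)

lemma summable_prod_pi {ℓ : ℕ} {g : Fin ℓ → J → ℝ} (h0 : ∀ i j, 0 ≤ g i j)
    (hg : ∀ i, Summable (g i)) :
    HasSum (fun k : Fin ℓ → J => ∏ i, g i (k i)) (∏ i, ∑' j, g i j) := by
  classical
  have hs : Summable fun k : Fin ℓ → J => ∏ i, g i (k i) := by
    refine summable_of_sum_le (c := ∏ i, ∑' j, g i j)
      (fun k => prod_nonneg fun i _ => h0 i _) fun u => ?_
    obtain ⟨s, hs⟩ := (eventually_atTop.1 ((tendsto_piFinset (J := J) ℓ).eventually_ge_atTop u))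
    calc ∑ k ∈ u, ∏ i, g i (k i) ≤ ∑ k ∈ Fintype.piFinset fun _ : Fin ℓ => s, ∏ i, g i (k i) :=
          sum_le_sum_of_subset_of_nonneg (hs s le_rfl) fun k _ _ => prod_nonneg fun i _ => h0 i _
      _ = ∏ i, ∑ j ∈ s, g i j := (prod_univ_sum (fun _ => s) fun i j => g i j).symm
      _ ≤ ∏ i, ∑' j, g i j := prod_le_prod (fun i _ => sum_nonneg fun j _ => h0 i j)
          fun i _ => (hg i).sum_le_tsum s fun j _ => h0 i j
  have h1 : Tendsto (fun s : Finset J => ∑ k ∈ Fintype.piFinset fun _ : Fin ℓ => s, ∏ i, g i (k i))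
      atTop (𝓝 (∑' k : Fin ℓ → J, ∏ i, g i (k i))) := hs.hasSum.comp (tendsto_piFinset ℓ)
  have h2 : Tendsto (fun s : Finset J => ∑ k ∈ Fintype.piFinset fun _ : Fin ℓ => s, ∏ i, g i (k i))
      atTop (𝓝 (∏ i, ∑' j, g i j)) := by
    have : (fun s : Finset J => ∑ k ∈ Fintype.piFinset fun _ : Fin ℓ => s, ∏ i, g i (k i)) =
        fun s => ∏ i, ∑ j ∈ s, g i j :=
      funext fun s => (prod_univ_sum (fun _ => s) fun i j => g i j).symm
    rw [this]
    exact tendsto_finsetProd _ fun i _ => (hg i).hasSum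
  rw [← tendsto_nhds_unique h1 h2]
  exact hs.hasSum

lemma hasSum_norm_prod {ℓ : ℕ} (z : Fin ℓ → SumSpace J) :
    HasSum (fun k : Fin ℓ → J => ∏ i, ‖z i (k i)‖) (∏ i, ‖z i‖) := by
  have h := summable_prod_pi (g := fun i j => ‖z i j‖) (fun _ _ => norm_nonneg _)
    fun i => (SumSpace.hasSum_norm (z i)).summable
  simpa only [(SumSpace.hasSum_norm (z _)).tsum_eq] using h

variable {G : Type*} [NormedAddCommGroup G] [NormedSpace ℂ G] [CompleteSpace G]

lemma summable_coeff {ℓ : ℕ} {b : (Fin ℓ → J) → G} {B : ℝ} (hb : ∀ k, ‖b k‖ ≤ B)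
    (z : Fin ℓ → SumSpace J) : Summable fun k : Fin ℓ → J => (∏ i, z i (k i)) • b k := by
  refine Summable.of_norm_bounded ((hasSum_norm_prod z).summable.mul_right B) fun k => ?_
  rw [norm_smul, norm_prod]
  gcongr
  exact hb k

lemma prod_update_apply {ℓ : ℕ} [DecidableEq (Fin ℓ)] (z : Fin ℓ → SumSpace J) (i : Fin ℓ)
    (x : SumSpace J) (k : Fin ℓ → J) :
    ∏ i', Function.update z i x i' (k i') = x (k i) * ∏ i' ∈ univ.erase i, z i' (k i') := by
  rw [← mul_prod_erase univ _ (mem_univ i), Function.update_self]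
  congr 1
  refine prod_congr rfl fun i' hi' => ?_
  rw [Function.update_of_ne (ne_of_mem_erase hi')]

/-- The multilinear map on `ℓ¹` with given bounded coefficients. -/
def coeffMap {ℓ : ℕ} (b : (Fin ℓ → J) → G) (B : ℝ) (hb : ∀ k, ‖b k‖ ≤ B) :
    ContinuousMultilinearMap ℂ (fun _ : Fin ℓ => SumSpace J) G :=
  MultilinearMap.mkContinuous
    { toFun := fun z => ∑' k : Fin ℓ → J, (∏ i, z i (k i)) • b k
      map_update_add' := fun {inst} z i x y => by
        rw [← (summable_coeff hb _).tsum_add (summable_coeff hb _)]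
        refine tsum_congr fun k => ?_
        rw [← add_smul, prod_update_apply, prod_update_apply, prod_update_apply, ← add_mul]
        rfl
      map_update_smul' := fun {inst} z i c x => by
        rw [← (summable_coeff hb _).tsum_const_smul]
        refine tsum_congr fun k => ?_
        rw [smul_smul, prod_update_apply, prod_update_apply, ← mul_assoc]
        rfl }
    B fun z => by
      refine tsum_of_norm_bounded ((hasSum_norm_prod z).mul_left B) fun k => ?_
      rw [norm_smul, norm_prod, mul_comm]
      gcongr
      exact hb k

lemma coeffMap_apply {ℓ : ℕ} {b : (Fin ℓ → J) → G} {B : ℝ} (hb : ∀ k, ‖b k‖ ≤ B)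
    (z : Fin ℓ → SumSpace J) : coeffMap b B hb z = ∑' k : Fin ℓ → J, (∏ i, z i (k i)) • b k := rfl

lemma norm_coeffMap_le {ℓ : ℕ} {b : (Fin ℓ → J) → G} {B : ℝ} (hb : ∀ k, ‖b k‖ ≤ B)
    (z : Fin ℓ → SumSpace J) : ‖coeffMap b B hb z‖ ≤ B * ∏ i, ‖z i‖ := by
  rw [coeffMap_apply]
  refine tsum_of_norm_bounded ((hasSum_norm_prod z).mul_left B) fun k => ?_
  rw [norm_smul, norm_prod, mul_comm]
  gcongr
  exact hb k

/-- Every continuous multilinear map on `ℓ¹` is determined by its coefficients. -/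
lemma hasSum_multilinear [DecidableEq J] {ℓ : ℕ}
    (f : ContinuousMultilinearMap ℂ (fun _ : Fin ℓ => SumSpace J) G) (z : Fin ℓ → SumSpace J) :
    HasSum (fun k : Fin ℓ → J => (∏ i, z i (k i)) • f fun i => SumSpace.basis (k i)) (f z) := by
  have hb : ∀ k : Fin ℓ → J, ‖f fun i => SumSpace.basis (k i)‖ ≤ ‖f‖ := fun k => by
    refine (f.le_opNorm _).trans (le_of_eq ?_)
    have : ∀ j : J, ‖SumSpace.basis j‖ = 1 := fun j => by
      rw [SumSpace.basis, lp.norm_single (by simp), norm_one]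
    simp [this]
  have hs := summable_coeff hb z
  have h1 := hs.hasSum.comp (tendsto_piFinset (J := J) ℓ)
  have h2 : Tendsto (fun s : Finset J => f fun i => ∑ j ∈ s, z i j • SumSpace.basis j) atTop
      (𝓝 (f z)) := by
    refine (f.cont.tendsto z).comp (tendsto_pi_nhds.2 fun i => ?_)
    exact SumSpace.hasSum_basis (z i)
  have h3 : (fun s : Finset J => f fun i => ∑ j ∈ s, z i j • SumSpace.basis j) =
      fun s => ∑ k ∈ Fintype.piFinset fun _ : Fin ℓ => s,
        (∏ i, z i (k i)) • f fun i => SumSpace.basis (k i) := by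
    funext s
    have := f.toMultilinearMap.map_sum_finset (fun i j => z i j • SumSpace.basis j) fun _ => s
    refine this.trans (sum_congr rfl fun k _ => ?_)
    exact f.toMultilinearMap.map_smul_univ (fun i => z i (k i)) fun i => SumSpace.basis (k i)
  rw [h3] at h2
  rw [← tendsto_nhds_unique h1 h2]
  exact hs.hasSum

end SumSpace

end

end SplittingBEA

namespace SplittingBEA

open Finset Filter Topology
open scoped ENNReal ContDiff

noncomputable section

/-! ### The symplectic structure of the phase space -/

section PhaseSpace

variable {d : ℕ} {𝒩 : Set (Fin d → ℤ)}

lemma conjIndex_conjIndex (j : ModeIndex 𝒩) : conjIndex (conjIndex j) = j := by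
  simp [conjIndex]

/-- Conjugation of indices as a permutation. -/
def conjEquiv : ModeIndex 𝒩 ≃ ModeIndex 𝒩 :=
  ⟨conjIndex, conjIndex, conjIndex_conjIndex, conjIndex_conjIndex⟩

/-- The sign of an index. -/
def modeSign (j : ModeIndex 𝒩) : ℂ := ((j.2 : ℤ) : ℂ)

lemma modeSign_conjIndex (j : ModeIndex 𝒩) : modeSign (conjIndex j) = -modeSign j := by
  simp [modeSign, conjIndex]

lemma modeSign_mul_self (j : ModeIndex 𝒩) : modeSign j * modeSign j = 1 := by
  rcases Int.units_eq_one_or j.2 with h | h <;> simp [modeSign, h]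

lemma norm_modeSign (j : ModeIndex 𝒩) : ‖modeSign j‖ = 1 := by
  rcases Int.units_eq_one_or j.2 with h | h <;> simp [modeSign, h]

lemma conj_modeSign (j : ModeIndex 𝒩) : starRingEnd ℂ (modeSign j) = modeSign j := by
  simp [modeSign]

lemma hasSum_form_bound (u v : EllOne 𝒩) :
    HasSum (fun j => ‖u‖ * ‖v j‖) (‖u‖ * ‖v‖) := (SumSpace.hasSum_norm v).mul_left _

lemma norm_form_term_le (u v : EllOne 𝒩) (j : ModeIndex 𝒩) :
    ‖-Complex.I * (modeSign j * u (conjIndex j) * v j)‖ ≤ ‖u‖ * ‖v j‖ := by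
  rw [norm_mul, norm_mul, norm_mul, norm_modeSign, norm_neg, Complex.norm_I, one_mul, one_mul]
  gcongr
  exact SumSpace.norm_apply_le u _

lemma summable_form (u v : EllOne 𝒩) :
    Summable fun j => -Complex.I * (modeSign j * u (conjIndex j) * v j) :=
  Summable.of_norm_bounded (hasSum_form_bound u v).summable (norm_form_term_le u v)

/-- The symplectic form on `ℓ¹`. -/
def sympForm : EllOne 𝒩 →L[ℂ] EllOne 𝒩 →L[ℂ] ℂ :=
  LinearMap.mkContinuous₂
    (LinearMap.mk₂ ℂ
      (fun u v => ∑' j, -Complex.I * (modeSign j * u (conjIndex j) * v j))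
      (fun u u' v => by
        rw [← (summable_form u v).tsum_add (summable_form u' v)]
        refine tsum_congr fun j => ?_
        rw [lp.coeFn_add, Pi.add_apply]; ring)
      (fun c u v => by
        rw [smul_eq_mul, ← tsum_mul_left]
        refine tsum_congr fun j => ?_
        rw [lp.coeFn_smul, Pi.smul_apply, smul_eq_mul]; ring)
      (fun u v v' => by
        rw [← (summable_form u v).tsum_add (summable_form u v')]
        refine tsum_congr fun j => ?_
        rw [lp.coeFn_add, Pi.add_apply]; ring)
      (fun c u v => by
        rw [smul_eq_mul, ← tsum_mul_left]
        refine tsum_congr fun j => ?_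
        rw [lp.coeFn_smul, Pi.smul_apply, smul_eq_mul]; ring))
    1 fun u v => by
      rw [one_mul]
      exact tsum_of_norm_bounded (hasSum_form_bound u v) (norm_form_term_le u v)

lemma sympForm_apply (u v : EllOne 𝒩) :
    sympForm u v = ∑' j, -Complex.I * (modeSign j * u (conjIndex j) * v j) := rfl

lemma sympForm_basis (u : EllOne 𝒩) (j : ModeIndex 𝒩) :
    sympForm u (SumSpace.basis j) = -Complex.I * (modeSign j * u (conjIndex j)) := by
  rw [sympForm_apply, tsum_eq_single j fun k hk => by rw [SumSpace.basis_apply, if_neg hk]; ring,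
    SumSpace.basis_apply, if_pos rfl, mul_one]

lemma norm_linearFlow_apply (lam : 𝒩 → ℝ) (z : EllOne 𝒩) (j : ModeIndex 𝒩) :
    ‖linearFlow lam z j‖ = ‖z j‖ := by
  change ‖Complex.exp (-Complex.I * ((j.2 : ℤ) : ℂ) * (lam j.1 : ℂ)) * z j‖ = _
  have h1 : -Complex.I * ((j.2 : ℤ) : ℂ) * (lam j.1 : ℂ)
      = ((-((j.2 : ℤ) : ℝ) * lam j.1 : ℝ) : ℂ) * Complex.I := by
    push_cast; ring
  rw [norm_mul, h1, Complex.norm_exp_ofReal_mul_I, one_mul]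

lemma norm_linearFlow (lam : 𝒩 → ℝ) (z : EllOne 𝒩) : ‖linearFlow lam z‖ = ‖z‖ := by
  rw [← (SumSpace.hasSum_norm z).tsum_eq, ← (SumSpace.hasSum_norm (linearFlow lam z)).tsum_eq]
  exact tsum_congr fun j => norm_linearFlow_apply lam z j

lemma linearFlow_apply (lam : 𝒩 → ℝ) (z : EllOne 𝒩) (j : ModeIndex 𝒩) :
    linearFlow lam z j = Complex.exp (-Complex.I * modeSign j * (lam j.1 : ℂ)) * z j := rfl

/-- The linear flow as a continuous linear map. -/
def linearFlowCLM (lam : 𝒩 → ℝ) : EllOne 𝒩 →L[ℂ] EllOne 𝒩 :=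
  LinearMap.mkContinuous
    { toFun := linearFlow lam
      map_add' := fun z w => lp.ext (funext fun j => by
        rw [lp.coeFn_add, Pi.add_apply, linearFlow_apply, linearFlow_apply, linearFlow_apply,
          lp.coeFn_add, Pi.add_apply, mul_add])
      map_smul' := fun c z => lp.ext (funext fun j => by
        rw [RingHom.id_apply, lp.coeFn_smul, Pi.smul_apply, linearFlow_apply, linearFlow_apply,
          lp.coeFn_smul, Pi.smul_apply, smul_eq_mul, smul_eq_mul]; ring) }
    1 fun z => by rw [one_mul]; exact (norm_linearFlow lam z).le

lemma linearFlowCLM_apply (lam : 𝒩 → ℝ) (z : EllOne 𝒩) : linearFlowCLM lam z = linearFlow lam z :=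
  rfl

/-- The conjugation whose fixed points are the real points. -/
def conjMap : EllOne 𝒩 →ₛₗ[starRingEnd ℂ] EllOne 𝒩 where
  toFun z := ⟨fun j => starRingEnd ℂ (z (conjIndex j)), SumSpace.memℓp (by
    simp only [RCLike.norm_conj]
    exact (conjEquiv.summable_iff (f := fun j => ‖z j‖)).2 (SumSpace.hasSum_norm z).summable)⟩
  map_add' z w := lp.ext (funext fun j => by
    change starRingEnd ℂ ((z + w) (conjIndex j)) = _
    rw [lp.coeFn_add, Pi.add_apply, map_add]; rfl)
  map_smul' c z := lp.ext (funext fun j => by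
    change starRingEnd ℂ ((c • z) (conjIndex j)) = _
    rw [lp.coeFn_smul, Pi.smul_apply, smul_eq_mul, map_mul]; rfl)

lemma conjMap_apply (z : EllOne 𝒩) (j : ModeIndex 𝒩) :
    conjMap z j = starRingEnd ℂ (z (conjIndex j)) := rfl

lemma conjMap_conjMap (z : EllOne 𝒩) : conjMap (conjMap z) = z :=
  lp.ext (funext fun j => by
    rw [conjMap_apply, conjMap_apply, Complex.conj_conj, conjIndex_conjIndex])

variable (𝒩) in
/-- The symplectic structure of `ℓ¹`, with the symmetries that express conservation of momentum. -/
def phaseSpace : SymplecticSpace (EllOne 𝒩) where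
  form := sympForm
  antisymm u v := by
    rw [sympForm_apply, sympForm_apply, ← tsum_neg, ← conjEquiv.tsum_eq]
    refine tsum_congr fun j => ?_
    change -Complex.I * (modeSign (conjIndex j) * u (conjIndex (conjIndex j)) * v (conjIndex j)) = _
    rw [modeSign_conjIndex, conjIndex_conjIndex]
    ring
  norm_le u v := tsum_of_norm_bounded (hasSum_form_bound u v) (norm_form_term_le u v)
  nondegenerate u h := lp.ext (funext fun j => by
    have h1 := h (SumSpace.basis (conjIndex j))
    rw [sympForm_basis, conjIndex_conjIndex] at h1
    have h2 : modeSign (conjIndex j) ≠ 0 := fun h0 => by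
      have := norm_modeSign (conjIndex j)
      rw [h0, norm_zero] at this
      exact zero_ne_one this
    simpa [h2] using h1)
  symmetries := {T | ∃ (k : Fin d) (θ : ℝ), T = linearFlowCLM fun a => θ * (a : Fin d → ℤ) k}
  symmetries_surjective := by
    rintro _ ⟨k, θ, rfl⟩ z
    refine ⟨linearFlow (fun a => -(θ * (a : Fin d → ℤ) k)) z, lp.ext (funext fun j => ?_)⟩
    rw [linearFlowCLM_apply, linearFlow_apply, linearFlow_apply, ← mul_assoc, ← Complex.exp_add]
    simp
  form_symmetries := by
    rintro _ ⟨k, θ, rfl⟩ u v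
    rw [sympForm_apply, sympForm_apply]
    refine tsum_congr fun j => ?_
    rw [linearFlowCLM_apply, linearFlowCLM_apply, linearFlow_apply, linearFlow_apply]
    have h : Complex.exp (-Complex.I * modeSign (conjIndex j) *
          ((θ * ((conjIndex j).1 : Fin d → ℤ) k : ℝ) : ℂ)) *
        Complex.exp (-Complex.I * modeSign j * ((θ * (j.1 : Fin d → ℤ) k : ℝ) : ℂ)) = 1 := by
      rw [← Complex.exp_add, modeSign_conjIndex]
      simp [conjIndex]
    linear_combination (-Complex.I * (modeSign j * u (conjIndex j) * v j)) * h
  conj := conjMap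
  conj_surjective z := ⟨conjMap z, conjMap_conjMap z⟩
  form_conj u v := by
    rw [sympForm_apply, sympForm_apply, Complex.conj_tsum, ← conjEquiv.tsum_eq]
    refine tsum_congr fun j => ?_
    change -Complex.I * (modeSign (conjIndex j) * conjMap u (conjIndex (conjIndex j)) *
      conjMap v (conjIndex j)) = _
    rw [modeSign_conjIndex, conjMap_apply, conjMap_apply]
    simp only [conjIndex_conjIndex, map_mul, map_neg, Complex.conj_I, conj_modeSign]
    ring

/-- A real polynomial Hamiltonian together with its vector field. -/
abbrev HamAlg (𝒩 : Set (Fin d → ℤ)) : Type := (phaseSpace 𝒩).Ham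

/-- Pairing with a basis vector reads off one component of the field, so the abstract field defined
by the form is the coordinate field of Hamilton's equations. -/
lemma hamField_eq {F : EllOne 𝒩 → ℂ} {X : EllOne 𝒩 → EllOne 𝒩} (h : (phaseSpace 𝒩).IsHam F X)
    (z : EllOne 𝒩) (j : ModeIndex 𝒩) : hamField F z j = X z j := by
  have h1 : partialDeriv F z (conjIndex j) = fderiv ℂ F z (SumSpace.basis (conjIndex j)) :=
    (h.differentiable z).lineDeriv_eq_fderiv
  have h2 : fderiv ℂ F z (SumSpace.basis (conjIndex j)) =
      -Complex.I * (modeSign (conjIndex j) * X z (conjIndex (conjIndex j))) := by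
    rw [h.fderiv_eq]
    exact sympForm_basis _ _
  rw [hamField, h1, h2, modeSign_conjIndex, conjIndex_conjIndex]
  change -Complex.I * modeSign j * _ = _
  linear_combination (Complex.I * Complex.I * -X z j) * modeSign_mul_self j - X z j * Complex.I_mul_I

/-- The flow of a Hamiltonian for time `h` is the time-one map of `h` times its field. -/
lemma flowsTo_iff {F : EllOne 𝒩 → ℂ} (x : HamAlg 𝒩) (hF : (phaseSpace 𝒩).value x = F) {h : ℝ}
    (hh : 0 < h) (z w : EllOne 𝒩) :
    FlowsTo F h z w ↔ TimeOne ((phaseSpace 𝒩).field (h • x)) z w := by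
  have hx : (phaseSpace 𝒩).IsHam F ((phaseSpace 𝒩).field x) :=
    hF ▸ SymplecticSpace.isHam_value x
  have hmul : ∀ τ, h • (phaseSpace 𝒩).field x τ = (phaseSpace 𝒩).field (h • x) τ := fun τ => by
    rw [map_smul, SmoothMap.smul_apply]
    rfl
  constructor
  · rintro ⟨u, hu0, hu1, hu⟩
    refine ⟨fun τ => u (h * τ), by simpa using hu0, by simpa using hu1, fun τ hτ => ?_⟩
    have hτ' : h * τ ∈ Set.Icc 0 h := ⟨by have := hτ.1; positivity, by nlinarith [hτ.2]⟩
    obtain ⟨v, hv, hvj⟩ := hu (h * τ) hτ'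
    have hvX : v = (phaseSpace 𝒩).field x (u (h * τ)) :=
      lp.ext (funext fun j => by rw [hvj, hamField_eq hx])
    subst hvX
    have h1 : HasDerivWithinAt (fun τ : ℝ => h * τ) h (Set.Icc 0 1) τ := by
      simpa using (hasDerivWithinAt_id τ (Set.Icc 0 1)).const_mul h
    have h2 := HasDerivWithinAt.scomp (t' := Set.Icc 0 h) τ hv h1 (fun s hs =>
      ⟨by have := hs.1; positivity, by nlinarith [hs.2]⟩)
    rw [← hmul]
    exact h2
  · rintro ⟨u, hu0, hu1, hu⟩
    refine ⟨fun τ => u (h⁻¹ * τ), by simpa using hu0, by simpa [hh.ne'] using hu1, fun τ hτ => ?_⟩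
    have hτ' : ∀ s ∈ Set.Icc 0 h, h⁻¹ * s ∈ Set.Icc (0 : ℝ) 1 := fun s hs => 
      ⟨by have := hs.1; positivity, by
        rw [inv_mul_le_iff₀ hh]; simpa using hs.2⟩
    refine ⟨(phaseSpace 𝒩).field x (u (h⁻¹ * τ)), ?_, fun j => by rw [hamField_eq hx]⟩
    have h1 : HasDerivWithinAt (fun τ : ℝ => h⁻¹ * τ) h⁻¹ (Set.Icc 0 h) τ := by
      simpa using (hasDerivWithinAt_id τ (Set.Icc 0 h)).const_mul h⁻¹
    have h2 := HasDerivWithinAt.scomp (t' := Set.Icc 0 1) τ (hu _ (hτ' τ hτ)) h1 hτ'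
    rw [← hmul, smul_smul, inv_mul_cancel₀ hh.ne', one_smul] at h2
    exact h2

end PhaseSpace

end

end SplittingBEA

namespace SplittingBEA

open Finset Filter Topology
open scoped ENNReal ContDiff

noncomputable section

/-! ### Polynomial Hamiltonians and their vector fields -/

section Multilinear

variable {E G : Type*} [NormedAddCommGroup E] [NormedSpace ℂ E]
  [NormedAddCommGroup G] [NormedSpace ℂ G]

lemma isHomogeneousMap_diag {ℓ : ℕ} (f : ContinuousMultilinearMap ℂ (fun _ : Fin ℓ => E) G) :
    IsHomogeneousMap ℓ fun z => f fun _ => z := by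
  refine ⟨f.contDiff.comp (contDiff_pi.2 fun _ => contDiff_id), fun t z => ?_⟩
  have h := f.toMultilinearMap.map_smul_univ (fun _ : Fin ℓ => t) fun _ => z
  simpa using h

lemma fderiv_diag {ℓ : ℕ} (f : ContinuousMultilinearMap ℂ (fun _ : Fin ℓ => E) G) (z v : E) :
    fderiv ℂ (fun z => f fun _ => z) z v = ∑ i, f (Function.update (fun _ => z) i v) := by
  have h1 : HasFDerivAt (fun z : E => fun _ : Fin ℓ => z)
      (ContinuousLinearMap.pi fun _ => ContinuousLinearMap.id ℂ E) z :=
    hasFDerivAt_pi.2 fun _ => hasFDerivAt_id z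
  have h2 := (f.hasFDerivAt (fun _ => z)).comp z h1
  rw [show (fun z => f fun _ => z) = f ∘ fun z : E => fun _ : Fin ℓ => z from rfl, h2.fderiv,
    ContinuousLinearMap.comp_apply, ContinuousMultilinearMap.linearDeriv_apply]
  rfl

end Multilinear

section Hamiltonian

variable {d : ℕ} {𝒩 : Set (Fin d → ℤ)}

lemma momentum_insertNth {m : ℕ} (i : Fin (m + 1)) (j : ModeIndex 𝒩) (k : Fin m → ModeIndex 𝒩) :
    momentum (i.insertNth (α := fun _ => ModeIndex 𝒩) j k) =
      (j.2 : ℤ) • (j.1 : Fin d → ℤ) + momentum k := by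
  rw [momentum, Fin.sum_univ_succAbove _ i]
  simp [momentum]

/-- With the other indices fixed, zero momentum prescribes δa; once the sign δ is known, a is
determined. So at most two indices contribute, one for each sign. -/
lemma injOn_snd_of_momentum {m : ℕ} (i : Fin (m + 1)) (k : Fin m → ModeIndex 𝒩)
    {c : (Fin (m + 1) → ModeIndex 𝒩) → ℂ} (hmom : ∀ j, c j ≠ 0 → momentum j = 0) :
    Set.InjOn (fun j : ModeIndex 𝒩 => j.2)
      {j | c (i.insertNth (α := fun _ => ModeIndex 𝒩) (conjIndex j) k) ≠ 0} := by
  intro j hj j' hj' h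
  have h1 := hmom _ hj
  have h2 := hmom _ hj'
  rw [momentum_insertNth] at h1 h2
  have h3 : ((conjIndex j).2 : ℤ) • ((conjIndex j).1 : Fin d → ℤ) =
      ((conjIndex j').2 : ℤ) • ((conjIndex j').1 : Fin d → ℤ) := by
    rw [eq_neg_of_add_eq_zero_left h1, eq_neg_of_add_eq_zero_left h2]
  have h' : j.2 = j'.2 := h
  have h4 : (j.1 : Fin d → ℤ) = j'.1 := by
    simp only [conjIndex, h'] at h3
    exact smul_right_injective _ (Units.ne_zero (-j'.2)) h3
  exact Prod.ext (Subtype.ext h4) h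

lemma sum_norm_le_two_mul {m : ℕ} (i : Fin (m + 1)) (k : Fin m → ModeIndex 𝒩)
    {c : (Fin (m + 1) → ModeIndex 𝒩) → ℂ} {B : ℝ} (hB : 0 ≤ B) (hc : ∀ j, ‖c j‖ ≤ B)
    (hmom : ∀ j, c j ≠ 0 → momentum j = 0) (s : Finset (ModeIndex 𝒩)) :
    ∑ j ∈ s, ‖-Complex.I * modeSign j *
      c (i.insertNth (α := fun _ => ModeIndex 𝒩) (conjIndex j) k)‖ ≤ 2 * B := by
  classical
  have h1 : ∀ j : ModeIndex 𝒩, ‖-Complex.I * modeSign j *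
      c (i.insertNth (α := fun _ => ModeIndex 𝒩) (conjIndex j) k)‖ =
      ‖c (i.insertNth (α := fun _ => ModeIndex 𝒩) (conjIndex j) k)‖ := fun j => by
    rw [norm_mul, norm_mul, norm_neg, Complex.norm_I, norm_modeSign, one_mul, one_mul]
  set t := s.filter fun j => c (i.insertNth (α := fun _ => ModeIndex 𝒩) (conjIndex j) k) ≠ 0
  have h2 : t.card ≤ 2 := by
    refine (card_le_card_of_injOn (t := (univ : Finset ℤˣ)) (fun j => j.2) (fun _ _ => mem_univ _)
      ((injOn_snd_of_momentum i k hmom).mono ?_)).trans (le_of_eq rfl)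
    intro j hj
    exact (mem_filter.1 hj).2
  calc _ = ∑ j ∈ t, ‖c (i.insertNth (α := fun _ => ModeIndex 𝒩) (conjIndex j) k)‖ := by
        rw [sum_filter, sum_congr rfl fun j _ => h1 j]
        refine sum_congr rfl fun j _ => ?_
        split_ifs with h
        · rfl
        · rw [not_not.1 h, norm_zero]
    _ ≤ t.card • B := sum_le_card_nsmul _ _ _ fun j _ => hc _
    _ ≤ 2 * B := by
        rw [nsmul_eq_mul]
        gcongr
        exact_mod_cast h2

/-- The coefficients of the vector field of a monomial Hamiltonian. -/
def fieldCoeff {m : ℕ} (i : Fin (m + 1)) {c : (Fin (m + 1) → ModeIndex 𝒩) → ℂ} {B : ℝ} (hB : 0 ≤ B)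
    (hc : ∀ j, ‖c j‖ ≤ B) (hmom : ∀ j, c j ≠ 0 → momentum j = 0) (k : Fin m → ModeIndex 𝒩) :
    EllOne 𝒩 :=
  ⟨fun j => -Complex.I * modeSign j * c (i.insertNth (α := fun _ => ModeIndex 𝒩) (conjIndex j) k),
    SumSpace.memℓp (summable_of_sum_le (fun _ => norm_nonneg _)
      (sum_norm_le_two_mul i k hB hc hmom))⟩

lemma norm_fieldCoeff_le {m : ℕ} (i : Fin (m + 1)) {c : (Fin (m + 1) → ModeIndex 𝒩) → ℂ} {B : ℝ}
    (hB : 0 ≤ B) (hc : ∀ j, ‖c j‖ ≤ B) (hmom : ∀ j, c j ≠ 0 → momentum j = 0)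
    (k : Fin m → ModeIndex 𝒩) : ‖fieldCoeff i hB hc hmom k‖ ≤ 2 * B :=
  SumSpace.norm_le (sum_norm_le_two_mul i k hB hc hmom)

lemma coeffMap_update_basis {m : ℕ} (i : Fin (m + 1)) {c : (Fin (m + 1) → ModeIndex 𝒩) → ℂ} {B : ℝ}
    (hc : ∀ j, ‖c j‖ ≤ B) (z : EllOne 𝒩) (j : ModeIndex 𝒩) :
    coeffMap c B hc (Function.update (fun _ => z) i (SumSpace.basis j)) =
      ∑' k : Fin m → ModeIndex 𝒩,
        (∏ i', z (k i')) * c (i.insertNth (α := fun _ => ModeIndex 𝒩) j k) := by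
  rw [coeffMap_apply]
  have hinj : Function.Injective fun k : Fin m → ModeIndex 𝒩 =>
      i.insertNth (α := fun _ => ModeIndex 𝒩) j k := Fin.insertNth_right_injective (α := fun _ => ModeIndex 𝒩) j
  rw [← hinj.tsum_eq]
  · refine tsum_congr fun k => ?_
    rw [Fin.prod_univ_succAbove _ i, smul_eq_mul]
    simp [SumSpace.basis_apply]
  · intro k hk
    rw [Function.mem_support, prod_update_apply, SumSpace.basis_apply] at hk
    have h : k i = j := by
      by_contra h
      rw [if_neg h, zero_mul, zero_smul] at hk
      exact hk rfl
    refine ⟨fun i' => k (i.succAbove i'), ?_⟩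
    subst h
    exact Fin.insertNth_self_removeNth i k

/-- Inserting `v` in the i-th slot is a continuous functional of `v`; both sides are compared on
basis vectors. Summed over i, this identifies the differential of a homogeneous Hamiltonian with the
form applied to an ℓ¹-valued multilinear map. -/
lemma sympForm_fieldCoeff {m : ℕ} (i : Fin (m + 1)) {c : (Fin (m + 1) → ModeIndex 𝒩) → ℂ} {B : ℝ}
    (hB : 0 ≤ B) (hc : ∀ j, ‖c j‖ ≤ B) (hmom : ∀ j, c j ≠ 0 → momentum j = 0) (z v : EllOne 𝒩) :
    coeffMap c B hc (Function.update (fun _ => z) i v) =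
      sympForm (coeffMap (fieldCoeff i hB hc hmom) (2 * B) (norm_fieldCoeff_le i hB hc hmom)
        fun _ => z) v := by
  set f := (coeffMap c B hc).toContinuousLinearMap (fun _ => z) i
  suffices h : f = sympForm (coeffMap (fieldCoeff i hB hc hmom) (2 * B)
      (norm_fieldCoeff_le i hB hc hmom) fun _ => z) from DFunLike.congr_fun h v
  have hext : ∀ g g' : EllOne 𝒩 →L[ℂ] ℂ, (∀ j, g (SumSpace.basis j) = g' (SumSpace.basis j)) →
      g = g' := by
    intro g g' h
    ext v
    have h1 := (SumSpace.hasSum_basis v).mapL g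
    have h2 := (SumSpace.hasSum_basis v).mapL g'
    simp only [map_smul, h] at h1 h2
    exact h1.unique h2
  refine hext _ _ fun j => ?_
  refine (coeffMap_update_basis i hc z j).trans ?_
  rw [sympForm_basis]
  have h1 := (summable_coeff (norm_fieldCoeff_le i hB hc hmom) fun _ => z).hasSum.mapL
    (lp.evalCLM ℂ (fun _ : ModeIndex 𝒩 => ℂ) 1 (conjIndex j))
  rw [← coeffMap_apply (norm_fieldCoeff_le i hB hc hmom)] at h1
  have h2 : (coeffMap (fieldCoeff i hB hc hmom) (2 * B) (norm_fieldCoeff_le i hB hc hmom)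
      fun _ => z) (conjIndex j) = ∑' k : Fin m → ModeIndex 𝒩, (∏ i', z (k i')) *
        (-Complex.I * modeSign (conjIndex j) *
          c (i.insertNth (α := fun _ => ModeIndex 𝒩) (conjIndex (conjIndex j)) k)) :=
    h1.tsum_eq.symm
  rw [h2, ← tsum_mul_left, ← tsum_mul_left]
  refine tsum_congr fun k => ?_
  rw [conjIndex_conjIndex, modeSign_conjIndex]
  set x := c (i.insertNth (α := fun _ => ModeIndex 𝒩) j k)
  set y := ∏ i', z (k i')
  linear_combination (y * x) * (Complex.I * Complex.I * modeSign_mul_self j) + (y * x) * Complex.I_mul_I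

/-- The vector field of a homogeneous Hamiltonian with zero momentum. -/
lemma exists_field {ℓ : ℕ} (hℓ : 2 ≤ ℓ) {c : (Fin ℓ → ModeIndex 𝒩) → ℂ} {B : ℝ} (hB : 0 ≤ B)
    (hc : ∀ j, ‖c j‖ ≤ B) (hmom : ∀ j, c j ≠ 0 → momentum j = 0) :
    ∃ X : EllOne 𝒩 → EllOne 𝒩, IsHomogeneousMap (ℓ - 1) X ∧
      (∀ z v, fderiv ℂ (fun z => coeffMap c B hc fun _ => z) z v = sympForm (X z) v) ∧
      ∀ z, ‖X z‖ ≤ 2 * ℓ * B * ‖z‖ ^ (ℓ - 1) := by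
  obtain ⟨m, rfl⟩ : ∃ m, ℓ = m + 1 := ⟨ℓ - 1, by lia⟩
  rw [Nat.add_sub_cancel]
  set f := fun i => coeffMap (fieldCoeff i hB hc hmom) (2 * B) (norm_fieldCoeff_le i hB hc hmom)
  refine ⟨fun z => (∑ i, f i) fun _ => z, isHomogeneousMap_diag _, fun z v => ?_, fun z => ?_⟩
  · change _ = sympForm ((∑ i, f i) fun _ => z) v
    rw [fderiv_diag, _root_.sum_apply, map_sum, _root_.sum_apply]
    exact sum_congr rfl fun i _ => sympForm_fieldCoeff i hB hc hmom z v
  · change ‖(∑ i, f i) fun _ => z‖ ≤ _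
    rw [_root_.sum_apply]
    refine (norm_sum_le_of_le univ (n := fun _ => 2 * B * ‖z‖ ^ m) fun i _ => ?_).trans
      (le_of_eq ?_)
    · have h := norm_coeffMap_le (norm_fieldCoeff_le i hB hc hmom) fun _ => z
      simpa using h
    · simp; ring

namespace PolyHam

variable {k : ℕ} (P : PolyHam 𝒩 k)

/-- The supremum of the coefficients of degree `ℓ`. -/
def degNorm (ℓ : ℕ) : ℝ := ⨆ j : Fin ℓ → ModeIndex 𝒩, ‖P.coeff ℓ j‖

lemma norm_coeff_le (ℓ : ℕ) (j : Fin ℓ → ModeIndex 𝒩) : ‖P.coeff ℓ j‖ ≤ P.degNorm ℓ := by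
  obtain ⟨B, hB⟩ := P.bounded
  exact le_ciSup (f := fun j : Fin ℓ → ModeIndex 𝒩 => ‖P.coeff ℓ j‖)
    ⟨B, by rintro _ ⟨j, rfl⟩; exact hB ℓ j⟩ j

lemma degNorm_nonneg (ℓ : ℕ) : 0 ≤ P.degNorm ℓ := Real.iSup_nonneg fun _ => norm_nonneg _

/-- The homogeneous part of degree `ℓ` as a multilinear map. -/
def part (ℓ : ℕ) : ContinuousMultilinearMap ℂ (fun _ : Fin ℓ => EllOne 𝒩) ℂ :=
  coeffMap (P.coeff ℓ) (P.degNorm ℓ) (P.norm_coeff_le ℓ)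

lemma part_apply (ℓ : ℕ) (z : Fin ℓ → EllOne 𝒩) :
    P.part ℓ z = ∑' j : Fin ℓ → ModeIndex 𝒩, P.coeff ℓ j * ∏ i, z i (j i) := by
  rw [part, coeffMap_apply]
  exact tsum_congr fun j => by rw [smul_eq_mul, mul_comm]

lemma eval_eq_sum : P.eval = ∑ ℓ ∈ Icc 2 k, fun z => P.part ℓ fun _ => z := by
  funext z
  rw [eval, Finset.sum_apply]
  exact sum_congr rfl fun ℓ _ => (P.part_apply ℓ _).symm

lemma eval_conj (z : EllOne 𝒩) : P.eval (conjMap z) = starRingEnd ℂ (P.eval z) := by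
  rw [eval, eval, map_sum]
  refine sum_congr rfl fun ℓ _ => ?_
  rw [Complex.conj_tsum, ← (Equiv.arrowCongr (Equiv.refl (Fin ℓ)) conjEquiv).tsum_eq]
  refine tsum_congr fun j => ?_
  change P.coeff ℓ (fun i => conjIndex (j i)) * ∏ i, conjMap z (conjIndex (j i)) = _
  rw [P.coeff_conj, map_mul, map_prod]
  simp only [conjMap_apply, conjIndex_conjIndex]

/-- Rotation by the k'-th coordinate multiplies a monomial by exp(-iθ times the k'-th momentum),
which is one on the support of the coefficients. -/
lemma eval_linearFlow (z : EllOne 𝒩) (k' : Fin d) (θ : ℝ) :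
    P.eval (linearFlow (fun a => θ * (a : Fin d → ℤ) k') z) = P.eval z := by
  rw [eval, eval]
  refine sum_congr rfl fun ℓ _ => tsum_congr fun j => ?_
  by_cases h0 : P.coeff ℓ j = 0
  · rw [h0, zero_mul, zero_mul]
  have hm := congrFun (P.momentum_eq_zero ℓ j h0) k'
  simp only [linearFlow_apply]
  rw [prod_mul_distrib, ← Complex.exp_sum]
  have : ∑ i, -Complex.I * modeSign (j i) * ((θ * ((j i).1 : Fin d → ℤ) k' : ℝ) : ℂ) =
      -Complex.I * θ * ((momentum j k' : ℤ) : ℂ) := by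
    rw [momentum, Finset.sum_apply, Int.cast_sum, mul_sum]
    refine sum_congr rfl fun i _ => ?_
    simp only [modeSign, Pi.smul_apply, smul_eq_mul]
    push_cast
    ring
  rw [this, hm]
  simp

lemma exists_isHam : ∃ X : EllOne 𝒩 → EllOne 𝒩, (phaseSpace 𝒩).IsHam P.eval X ∧
    ∀ z, ‖X z‖ ≤ ∑ ℓ ∈ Icc 2 k, 2 * ℓ * P.degNorm ℓ * ‖z‖ ^ (ℓ - 1) := by
  have h1 : ∀ ℓ, ∃ X : EllOne 𝒩 → EllOne 𝒩, 2 ≤ ℓ → IsHomogeneousMap (ℓ - 1) X ∧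
      (∀ z v, fderiv ℂ (fun z => P.part ℓ fun _ => z) z v = sympForm (X z) v) ∧
      ∀ z, ‖X z‖ ≤ 2 * ℓ * P.degNorm ℓ * ‖z‖ ^ (ℓ - 1) := by
    intro ℓ
    by_cases hℓ : 2 ≤ ℓ
    · obtain ⟨X, hX⟩ := exists_field hℓ (P.degNorm_nonneg ℓ) (P.norm_coeff_le ℓ)
        (P.momentum_eq_zero ℓ)
      exact ⟨X, fun _ => hX⟩
    · exact ⟨0, fun h => absurd h hℓ⟩
  choose X hX using h1
  refine ⟨∑ ℓ ∈ Icc 2 k, X ℓ, ⟨?_, ?_, fun z v => ?_, ?_, P.eval_conj⟩, fun z => ?_⟩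
  · rw [eval_eq_sum]
    exact Submodule.sum_mem _ fun ℓ hℓ =>
      (isHomogeneousMap_diag (P.part ℓ)).mem_polyMaps (mem_Icc.1 hℓ).1
  · refine Submodule.sum_mem _ fun ℓ hℓ => ?_
    have := (mem_Icc.1 hℓ).1
    exact ((hX ℓ this).1).mem_polyMaps (by lia)
  · have hd : ∀ ℓ ∈ Icc 2 k, DifferentiableAt ℂ (fun z => P.part ℓ fun _ => z) z := fun ℓ _ =>
      (isHomogeneousMap_diag (P.part ℓ)).1.differentiable (by simp) z
    rw [eval_eq_sum, fderiv_sum hd, _root_.sum_apply, Finset.sum_apply, map_sum, _root_.sum_apply]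
    exact sum_congr rfl fun ℓ hℓ => (hX ℓ (mem_Icc.1 hℓ).1).2.1 z v
  · rintro _ ⟨k', θ, rfl⟩ z
    exact P.eval_linearFlow z k' θ
  · rw [Finset.sum_apply]
    exact norm_sum_le_of_le _ fun ℓ hℓ => (hX ℓ (mem_Icc.1 hℓ).1).2.2 z

/-- The Hamiltonian with its vector field. -/
def toPair : HamAlg 𝒩 := P.exists_isHam.choose_spec.1.toHam

lemma value_toPair : (phaseSpace 𝒩).value P.toPair = P.eval := rfl

lemma norm_field_toPair_le {R : ℝ} {z : EllOne 𝒩} (hz : ‖z‖ ≤ R) :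
    ‖(phaseSpace 𝒩).field P.toPair z‖ ≤ 2 * k * (1 + R) ^ k * P.coeffNorm := by
  refine (P.exists_isHam.choose_spec.2 z).trans ?_
  rw [coeffNorm, mul_sum]
  refine sum_le_sum fun ℓ hℓ => ?_
  have h1 : ‖z‖ ^ (ℓ - 1) ≤ (1 + R) ^ k := by
    have h0 := norm_nonneg z
    calc ‖z‖ ^ (ℓ - 1) ≤ (1 + R) ^ (ℓ - 1) := by gcongr; linarith
      _ ≤ (1 + R) ^ k := by
        have := (mem_Icc.1 hℓ).2
        exact pow_le_pow_right₀ (by linarith) (by lia)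
  have h2 : (ℓ : ℝ) ≤ k := by exact_mod_cast (mem_Icc.1 hℓ).2
  have h3 := P.degNorm_nonneg ℓ
  calc 2 * ℓ * P.degNorm ℓ * ‖z‖ ^ (ℓ - 1) ≤ 2 * k * P.degNorm ℓ * (1 + R) ^ k := by gcongr
    _ = _ := by rw [degNorm]; ring

end PolyHam

end Hamiltonian

end

end SplittingBEA

namespace SplittingBEA

open Finset Filter Topology
open scoped ENNReal ContDiff

noncomputable section

/-! ### Coefficients of invariant polynomial Hamiltonians -/

section Taylor

variable {E : Type*} [NormedAddCommGroup E] [NormedSpace ℂ E]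

/-- The homogeneous part of degree `ℓ` of the Taylor expansion at the origin. -/
def taylorPart (F : E → ℂ) (ℓ : ℕ) : ContinuousMultilinearMap ℂ (fun _ : Fin ℓ => E) ℂ :=
  ((ℓ.factorial : ℂ)⁻¹) • iteratedFDeriv ℂ ℓ F 0

/-- On the complex line through `z` the map is t^n F(z), whose Taylor coefficients at zero are
explicit. -/
lemma IsHomogeneousMap.taylorPart_diag {n : ℕ} {F : E → ℂ} (hF : IsHomogeneousMap n F) (ℓ : ℕ)
    (z : E) : taylorPart F ℓ (fun _ => z) = if ℓ = n then F z else 0 := by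
  have h1 := (ContinuousLinearMap.toSpanSingleton ℂ z).iteratedFDeriv_comp_right
    (hF.1.of_le (m := ((ℓ : ℕ) : ℕ∞ω)) (by exact_mod_cast le_top)) (0 : ℂ) (i := ℓ) le_rfl
  have h2 : F ∘ ContinuousLinearMap.toSpanSingleton ℂ z = fun t : ℂ => t ^ n * F z := by
    funext t
    simpa using hF.2 t z
  have h3 : iteratedDeriv ℓ (fun t : ℂ => t ^ n * F z) 0 = iteratedFDeriv ℂ ℓ F 0 fun _ => z := by
    rw [iteratedDeriv, ← h2, h1]
    simp
  rw [taylorPart, _root_.smul_apply, ← h3, iteratedDeriv_mul_const_field, iteratedDeriv_fun_pow_zero]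
  split_ifs with h
  · subst h
    have : ((ℓ.factorial : ℕ) : ℂ) ≠ 0 := by exact_mod_cast ℓ.factorial_ne_zero
    simp [this]
  · simp

/-- The expansion is claimed for every sufficiently large cutoff, so that two polynomials of
different degrees can be added. -/
lemma exists_eq_sum_taylorPart {F : E → ℂ} {m : ℕ} (hF : F ∈ polyMaps E ℂ m) :
    ∃ k, ∀ K, k ≤ K → ∀ z, F z = ∑ ℓ ∈ Icc m K, taylorPart F ℓ fun _ => z := by
  induction hF using Submodule.span_induction with
  | mem F hF =>
    obtain ⟨n, hn, hF⟩ := hF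
    refine ⟨n, fun K hK z => ?_⟩
    simp [hF.taylorPart_diag, hn, hK]
  | zero =>
    refine ⟨0, fun K _ z => ?_⟩
    have : ∀ ℓ, taylorPart (0 : E → ℂ) ℓ = 0 := fun ℓ => by
      rw [taylorPart, show (0 : E → ℂ) = fun _ => 0 from rfl, iteratedFDeriv_fun_zero]
      simp
    simp [this]
  | add F G hF hG ihF ihG =>
    obtain ⟨k, hk⟩ := ihF
    obtain ⟨k', hk'⟩ := ihG
    refine ⟨max k k', fun K hK z => ?_⟩
    rw [Pi.add_apply, hk K (le_of_max_le_left hK), hk' K (le_of_max_le_right hK),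
      ← sum_add_distrib]
    refine sum_congr rfl fun ℓ _ => ?_
    have hle : ((ℓ : ℕ) : ℕ∞ω) ≤ (∞ : ℕ∞ω) := by exact_mod_cast le_top
    rw [taylorPart, taylorPart, taylorPart, iteratedFDeriv_add_apply
      ((contDiff_of_mem_polyMaps hF).of_le hle).contDiffAt
      ((contDiff_of_mem_polyMaps hG).of_le hle).contDiffAt, smul_add]
    rfl
  | smul c F hF ihF =>
    obtain ⟨k, hk⟩ := ihF
    refine ⟨k, fun K hK z => ?_⟩
    rw [Pi.smul_apply, hk K hK, smul_sum]
    refine sum_congr rfl fun ℓ _ => ?_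
    have hle : ((ℓ : ℕ) : ℕ∞ω) ≤ (∞ : ℕ∞ω) := by exact_mod_cast le_top
    rw [taylorPart, taylorPart, iteratedFDeriv_const_smul_apply
      ((contDiff_of_mem_polyMaps hF).of_le hle).contDiffAt, smul_comm]
    rfl

lemma taylorPart_comp {F : E → ℂ} (hF : ContDiff ℂ ∞ F) {T : E →L[ℂ] E} (hT : ∀ z, F (T z) = F z)
    (ℓ : ℕ) (v : Fin ℓ → E) : taylorPart F ℓ (fun i => T (v i)) = taylorPart F ℓ v := by
  have h1 := T.iteratedFDeriv_comp_right
    (hF.of_le (m := ((ℓ : ℕ) : ℕ∞ω)) (by exact_mod_cast le_top)) (0 : E) (i := ℓ) le_rfl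
  rw [show F ∘ T = F from funext hT, map_zero] at h1
  rw [taylorPart, _root_.smul_apply, _root_.smul_apply]
  conv_rhs => rw [h1]
  rfl

end Taylor

section Extraction

variable {d : ℕ} {𝒩 : Set (Fin d → ℤ)}

lemma momentum_conjIndex {ℓ : ℕ} (j : Fin ℓ → ModeIndex 𝒩) :
    momentum (fun i => conjIndex (j i)) = -momentum j := by
  simp [momentum, conjIndex]

lemma linearFlow_basis (lam : 𝒩 → ℝ) (j : ModeIndex 𝒩) :
    linearFlow lam (SumSpace.basis j) =
      Complex.exp (-Complex.I * modeSign j * (lam j.1 : ℂ)) • SumSpace.basis j :=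
  lp.ext (funext fun i => by
    rw [linearFlow_apply, lp.coeFn_smul, Pi.smul_apply, smul_eq_mul, SumSpace.basis_apply]
    split_ifs with h
    · rw [h]
    · rw [mul_zero, mul_zero])

lemma taylorPart_eq_zero {F : EllOne 𝒩 → ℂ} {X : EllOne 𝒩 → EllOne 𝒩}
    (hF : (phaseSpace 𝒩).IsHam F X) {ℓ : ℕ} {j : Fin ℓ → ModeIndex 𝒩} (hj : momentum j ≠ 0) :
    taylorPart F ℓ (fun i => SumSpace.basis (j i)) = 0 := by
  obtain ⟨k, hk⟩ := Function.ne_iff.1 hj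
  have hk : momentum j k ≠ 0 := hk
  -- The angle for which the rotation multiplies this coefficient by -1; invariance then forces it
  -- to vanish.
  set θ : ℝ := Real.pi / (momentum j k : ℝ)
  have h1 := taylorPart_comp (contDiff_of_mem_polyMaps hF.mem_fst)
    (hF.symm (linearFlowCLM fun a => θ * (a : Fin d → ℤ) k) ⟨k, θ, rfl⟩) ℓ
    fun i => SumSpace.basis (j i)
  simp only [linearFlowCLM_apply, linearFlow_basis] at h1
  have h2 := (taylorPart F ℓ).toMultilinearMap.map_smul_univ
    (fun i => Complex.exp (-Complex.I * modeSign (j i) *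
      ((θ * ((j i).1 : Fin d → ℤ) k : ℝ) : ℂ))) fun i => SumSpace.basis (j i)
  have h3 : ∏ i, Complex.exp (-Complex.I * modeSign (j i) *
      ((θ * ((j i).1 : Fin d → ℤ) k : ℝ) : ℂ)) = -1 := by
    rw [← Complex.exp_sum]
    have : ∑ i, -Complex.I * modeSign (j i) * ((θ * ((j i).1 : Fin d → ℤ) k : ℝ) : ℂ) =
        -Complex.I * ((θ * momentum j k : ℝ) : ℂ) := by
      rw [momentum, Finset.sum_apply, Int.cast_sum, mul_sum, Complex.ofReal_sum, mul_sum]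
      refine sum_congr rfl fun i _ => ?_
      simp only [modeSign, Pi.smul_apply, smul_eq_mul]
      push_cast
      ring
    rw [this]
    have h4 : θ * momentum j k = Real.pi := div_mul_cancel₀ _ (by exact_mod_cast hk)
    rw [h4, neg_mul, Complex.exp_neg, mul_comm, Complex.exp_pi_mul_I]
    norm_num
  rw [h3] at h2
  have h5 : (-1 : ℂ) • taylorPart F ℓ (fun i => SumSpace.basis (j i)) =
      taylorPart F ℓ fun i => SumSpace.basis (j i) := h2.symm.trans h1
  rw [neg_one_smul] at h5
  linear_combination (-1 / 2 : ℂ) * h5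

lemma norm_basis {J : Type*} [DecidableEq J] (j : J) : ‖SumSpace.basis j‖ = 1 := by
  rw [SumSpace.basis, lp.norm_single (by simp), norm_one]

lemma norm_taylorPart_basis_le (F : EllOne 𝒩 → ℂ) (ℓ : ℕ) (j : Fin ℓ → ModeIndex 𝒩) :
    ‖taylorPart F ℓ fun i => SumSpace.basis (j i)‖ ≤ ‖taylorPart F ℓ‖ := by
  refine ((taylorPart F ℓ).le_opNorm _).trans (le_of_eq ?_)
  simp [norm_basis]

/-- The real zero-momentum polynomial with the Taylor coefficients of `F`. -/
def taylorHam {F : EllOne 𝒩 → ℂ} {X : EllOne 𝒩 → EllOne 𝒩} (hF : (phaseSpace 𝒩).IsHam F X) (k : ℕ) :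
    PolyHam 𝒩 k where
  -- Averaging with the conjugated coefficient at the conjugate index makes the reality condition
  -- automatic. The value is unchanged because F already commutes with the conjugation.
  coeff ℓ j := if 2 ≤ ℓ ∧ ℓ ≤ k then
    2⁻¹ * (taylorPart F ℓ (fun i => SumSpace.basis (j i)) +
      starRingEnd ℂ (taylorPart F ℓ fun i => SumSpace.basis (conjIndex (j i)))) else 0
  degree_mem ℓ j h := by
    by_contra h'
    exact h (if_neg h')
  momentum_eq_zero ℓ j h := by
    by_contra h'
    refine h ?_
    rw [taylorPart_eq_zero hF h', taylorPart_eq_zero hF (j := fun i => conjIndex (j i))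
      (by rw [momentum_conjIndex]; simpa using h')]
    simp
  coeff_conj ℓ j := by
    simp only [conjIndex_conjIndex]
    split_ifs
    · simp only [map_mul, map_add, Complex.conj_conj, map_inv₀, map_ofNat]
      ring
    · simp
  bounded := by
    refine ⟨∑ ℓ ∈ Icc 2 k, ‖taylorPart F ℓ‖, fun ℓ j => ?_⟩
    have h0 : 0 ≤ ∑ ℓ ∈ Icc 2 k, ‖taylorPart F ℓ‖ := sum_nonneg fun _ _ => norm_nonneg _
    split_ifs with h
    · refine le_trans ?_ (single_le_sum (fun ℓ _ => norm_nonneg (taylorPart F ℓ)) (mem_Icc.2 h))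
      rw [norm_mul]
      have h1 := norm_taylorPart_basis_le F ℓ j
      have h2 := norm_taylorPart_basis_le F ℓ fun i => conjIndex (j i)
      have h3 := norm_add_le (taylorPart F ℓ fun i => SumSpace.basis (j i))
        (starRingEnd ℂ (taylorPart F ℓ fun i => SumSpace.basis (conjIndex (j i))))
      rw [RCLike.norm_conj] at h3
      have h4 : ‖(2⁻¹ : ℂ)‖ = 2⁻¹ := by simp
      rw [h4]
      linarith
    · simpa using h0

/-- Every invariant real polynomial Hamiltonian is given by bounded coefficients. -/
lemma exists_polyHam (x : HamAlg 𝒩) :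
    ∃ (k : ℕ) (H : PolyHam 𝒩 k), H.eval = (phaseSpace 𝒩).value x := by
  have hx := SymplecticSpace.isHam_value x
  set F := (phaseSpace 𝒩).value x
  obtain ⟨k, hk⟩ := exists_eq_sum_taylorPart hx.mem_fst
  refine ⟨k, taylorHam hx k, funext fun z => ?_⟩
  have h1 : ∀ ℓ ∈ Icc 2 k, ∑' j : Fin ℓ → ModeIndex 𝒩, (taylorHam hx k).coeff ℓ j * ∏ i, z (j i) =
      2⁻¹ * (taylorPart F ℓ (fun _ => z) + starRingEnd ℂ (taylorPart F ℓ fun _ => conjMap z)) := by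
    intro ℓ hℓ
    have e1 := hasSum_multilinear (taylorPart F ℓ) fun _ => z
    have e2 := (hasSum_multilinear (taylorPart F ℓ) fun _ => conjMap z).mapL
      Complex.conjCLE.toContinuousLinearMap
    have e3 := (Equiv.arrowCongr (Equiv.refl (Fin ℓ)) (conjEquiv (𝒩 := 𝒩))).hasSum_iff.2 e2
    refine Eq.trans (tsum_congr fun j => ?_) ((e1.add e3).mul_left 2⁻¹).tsum_eq
    have e4 : (taylorHam hx k).coeff ℓ j = 2⁻¹ * (taylorPart F ℓ (fun i => SumSpace.basis (j i)) +
        starRingEnd ℂ (taylorPart F ℓ fun i => SumSpace.basis (conjIndex (j i)))) :=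
      if_pos (mem_Icc.1 hℓ)
    have e5 : starRingEnd ℂ ((∏ i, conjMap z (conjIndex (j i))) •
        taylorPart F ℓ fun i => SumSpace.basis (conjIndex (j i))) =
        (∏ i, z (j i)) *
          starRingEnd ℂ (taylorPart F ℓ fun i => SumSpace.basis (conjIndex (j i))) := by
      rw [smul_eq_mul, map_mul, map_prod]
      simp only [conjMap_apply, conjIndex_conjIndex, Complex.conj_conj]
    rw [e4, smul_eq_mul]
    refine Eq.trans ?_ (congrArg (fun t => 2⁻¹ * ((∏ i, z (j i)) *
      taylorPart F ℓ (fun i => SumSpace.basis (j i)) + t)) e5.symm)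
    ring
  rw [PolyHam.eval, sum_congr rfl h1, ← mul_sum, sum_add_distrib, ← map_sum, ← hk k le_rfl,
    ← hk k le_rfl]
  have h2 : F (conjMap z) = starRingEnd ℂ (F z) := hx.conj z
  rw [h2, Complex.conj_conj]
  ring

end Extraction

end

end SplittingBEA

namespace SplittingBEA

open Finset Filter Topology
open scoped ENNReal ContDiff

noncomputable section

/-! ### The linear part -/

section Linear

variable {d : ℕ} {𝒩 : Set (Fin d → ℤ)} {lam : 𝒩 → ℝ} {b : ℝ}

lemma norm_linearField_term_le (hlam : ∀ a, |lam a| ≤ b) (z : EllOne 𝒩) (j : ModeIndex 𝒩) :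
    ‖-Complex.I * modeSign j * (lam j.1 : ℂ) * z j‖ ≤ b * ‖z j‖ := by
  rw [norm_mul, norm_mul, norm_mul, norm_neg, Complex.norm_I, norm_modeSign, Complex.norm_real,
    one_mul, one_mul, Real.norm_eq_abs]
  gcongr
  exact hlam j.1

lemma SumSpace.norm_le_mul {J : Type*} {z w : SumSpace J} {b : ℝ}
    (h : ∀ j, ‖w j‖ ≤ b * ‖z j‖) : ‖w‖ ≤ b * ‖z‖ :=
  hasSum_le h (SumSpace.hasSum_norm w) ((SumSpace.hasSum_norm z).mul_left b)

/-- The vector field of `∑_a lam_a ξ_a η_a`. -/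
def linearField (hlam : ∀ a, |lam a| ≤ b) : EllOne 𝒩 →L[ℂ] EllOne 𝒩 :=
  LinearMap.mkContinuous
    { toFun := fun z => ⟨fun j => -Complex.I * modeSign j * (lam j.1 : ℂ) * z j,
        SumSpace.memℓp (((SumSpace.hasSum_norm z).summable.mul_left b).of_nonneg_of_le
          (fun _ => norm_nonneg _) (norm_linearField_term_le hlam z))⟩
      map_add' := fun z w => lp.ext (funext fun j => by
        change _ * (z + w) j = _ * z j + _ * w j
        rw [lp.coeFn_add, Pi.add_apply, mul_add])
      map_smul' := fun c z => lp.ext (funext fun j => by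
        change _ * (c • z) j = c * (_ * z j)
        rw [lp.coeFn_smul, Pi.smul_apply, smul_eq_mul]; ring) }
    b fun z => SumSpace.norm_le_mul (norm_linearField_term_le hlam z)

lemma linearField_apply (hlam : ∀ a, |lam a| ≤ b) (z : EllOne 𝒩) (j : ModeIndex 𝒩) :
    linearField hlam z j = -Complex.I * modeSign j * (lam j.1 : ℂ) * z j := rfl

lemma norm_linearField_le (hlam : ∀ a, |lam a| ≤ b) (z : EllOne 𝒩) :
    ‖linearField hlam z‖ ≤ b * ‖z‖ :=
  SumSpace.norm_le_mul (norm_linearField_term_le hlam z)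

lemma sympForm_linearField (hlam : ∀ a, |lam a| ≤ b) (u v : EllOne 𝒩) :
    sympForm (linearField hlam v) u = sympForm (linearField hlam u) v := by
  have h : sympForm (linearField hlam v) u = -sympForm u (linearField hlam v) :=
    (phaseSpace 𝒩).antisymm _ _
  rw [h, sympForm_apply, sympForm_apply, ← tsum_neg]
  refine tsum_congr fun j => ?_
  rw [linearField_apply, linearField_apply, modeSign_conjIndex]
  simp only [conjIndex]
  ring

/-- The quadratic Hamiltonian `∑_a lam_a ξ_a η_a` as a quadratic form. -/
def linearHam (hlam : ∀ a, |lam a| ≤ b) (z : EllOne 𝒩) : ℂ := 2⁻¹ * sympForm (linearField hlam z) z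

lemma linearHam_eq (hlam : ∀ a, |lam a| ≤ b) (z : EllOne 𝒩) :
    linearHam hlam z = ∑' a : 𝒩, (lam a : ℂ) * (z (a, 1) * z (a, -1)) := by
  have h0 := summable_form (linearField hlam z) z
  rw [linearHam, sympForm_apply, h0.tsum_prod, ← tsum_mul_left]
  refine tsum_congr fun a => ?_
  rw [tsum_fintype, Fintype.sum_eq_add (1 : ℤˣ) (-1) (by decide) fun s hs => by
    rcases Int.units_eq_one_or s with rfl | rfl
    · exact absurd rfl hs.1
    · exact absurd rfl hs.2]
  simp only [linearField_apply, conjIndex, modeSign, neg_neg, Units.val_one, Units.val_neg]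
  push_cast
  linear_combination (-(lam a : ℂ) * z (a, 1) * z (a, -1)) * Complex.I_mul_I

lemma isHam_linearHam (hlam : ∀ a, |lam a| ≤ b) :
    (phaseSpace 𝒩).IsHam (linearHam hlam) (linearField hlam) where
  mem_fst := by
    refine IsHomogeneousMap.mem_polyMaps (ℓ := 2) ⟨?_, fun t z => ?_⟩ le_rfl
    · exact contDiff_const.mul
        ((sympForm.contDiff.comp (linearField hlam).contDiff).clm_apply contDiff_id)
    · simp only [linearHam, map_smul, smul_eq_mul, smul_apply]
      ring
  mem_snd := IsHomogeneousMap.mem_polyMaps (ℓ := 1)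
    ⟨(linearField hlam).contDiff, fun t z => by rw [map_smul, pow_one]⟩ le_rfl
  fderiv_eq z v := by
    have h1 : HasFDerivAt (fun z => sympForm (linearField hlam z))
        (sympForm.comp (linearField hlam)) z :=
      sympForm.hasFDerivAt.comp z (linearField hlam).hasFDerivAt
    have h2 := (h1.clm_apply (hasFDerivAt_id z)).const_mul (2⁻¹ : ℂ)
    have h3 : fderiv ℂ (linearHam hlam) z = _ := h2.fderiv
    rw [h3]
    change 2⁻¹ * (sympForm (linearField hlam z) v + sympForm (linearField hlam v) z) =
      sympForm (linearField hlam z) v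
    rw [sympForm_linearField hlam z v]
    ring
  symm := by
    rintro _ ⟨k, θ, rfl⟩ z
    have h : linearField hlam (linearFlowCLM (fun a => θ * (a : Fin d → ℤ) k) z) =
        linearFlowCLM (fun a => θ * (a : Fin d → ℤ) k) (linearField hlam z) :=
      lp.ext (funext fun j => by
        rw [linearField_apply, linearFlowCLM_apply, linearFlowCLM_apply, linearFlow_apply,
          linearFlow_apply, linearField_apply]
        ring)
    rw [linearHam, h]
    exact congrArg _ ((phaseSpace 𝒩).form_symmetries _ ⟨k, θ, rfl⟩ _ _)
  conj z := by
    have h : linearField hlam (conjMap z) = conjMap (linearField hlam z) :=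
      lp.ext (funext fun j => by
        rw [linearField_apply, conjMap_apply, conjMap_apply, linearField_apply]
        simp only [map_mul, map_neg, Complex.conj_I, conj_modeSign, Complex.conj_ofReal,
          modeSign_conjIndex]
        simp only [conjIndex]
        ring)
    change 2⁻¹ * sympForm (linearField hlam (conjMap z)) (conjMap z) = _
    have h2 : sympForm (conjMap (linearField hlam z)) (conjMap z) =
      starRingEnd ℂ (sympForm (linearField hlam z) z) := (phaseSpace 𝒩).form_conj _ _
    rw [h, h2, linearHam, map_mul, map_inv₀, map_ofNat]

/-- The quadratic Hamiltonian with its vector field. -/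
def linearPair (hlam : ∀ a, |lam a| ≤ b) : HamAlg 𝒩 :=
  (isHam_linearHam hlam).toHam

lemma value_linearPair (hlam : ∀ a, |lam a| ≤ b) :
    (phaseSpace 𝒩).value (linearPair hlam) = linearHam hlam := rfl

lemma field_linearPair (hlam : ∀ a, |lam a| ≤ b) (z : EllOne 𝒩) :
    (phaseSpace 𝒩).field (linearPair hlam) z = linearField hlam z := rfl

lemma linearField_pow_apply (hlam : ∀ a, |lam a| ≤ b) (n : ℕ) (z : EllOne 𝒩) (j : ModeIndex 𝒩) :
    (linearField hlam ^ n) z j = (-Complex.I * modeSign j * (lam j.1 : ℂ)) ^ n * z j := by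
  induction n with
  | zero => simp
  | succ n ih =>
    rw [pow_succ', mul_apply_eq_comp, linearField_apply, ih]
    ring

/-- The explicit linear flow is the flow of the quadratic Hamiltonian. -/
lemma timeOne_linearFlow (hlam : ∀ a, |lam a| ≤ b) (z : EllOne 𝒩) :
    TimeOne ((phaseSpace 𝒩).field (linearPair hlam)) z (linearFlow lam z) := by
  set A := linearField hlam
  refine ⟨fun τ => NormedSpace.exp ((τ : ℂ) • A) z, by simp, ?_, fun τ _ => ?_⟩
  · have h1 := NormedSpace.exp_series_hasSum_exp' (𝕂 := ℂ) A
    have h2 := (h1.mapL (ContinuousLinearMap.apply ℂ (EllOne 𝒩) z))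
    refine lp.ext (funext fun j => ?_)
    have h3 := h2.mapL (lp.evalCLM ℂ (fun _ : ModeIndex 𝒩 => ℂ) 1 j)
    have h4 := (NormedSpace.exp_series_hasSum_exp' (𝕂 := ℂ)
      (-Complex.I * modeSign j * (lam j.1 : ℂ))).mul_right (z j)
    rw [← Complex.exp_eq_exp_ℂ] at h4
    change NormedSpace.exp (((1 : ℝ) : ℂ) • A) z j = _
    rw [linearFlow_apply, Complex.ofReal_one, one_smul]
    refine HasSum.unique h3 ?_
    have h5 : ∀ n : ℕ, lp.evalCLM ℂ (fun _ : ModeIndex 𝒩 => ℂ) 1 j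
        (ContinuousLinearMap.apply ℂ (EllOne 𝒩) z ((n.factorial : ℂ)⁻¹ • A ^ n)) =
        (n.factorial : ℂ)⁻¹ • (-Complex.I * modeSign j * (lam j.1 : ℂ)) ^ n * z j := fun n => by
      change ((n.factorial : ℂ)⁻¹) * (A ^ n) z j = _
      rw [linearField_pow_apply, smul_eq_mul]
      ring
    rwa [funext h5]
  · have h1 := (ContinuousLinearMap.apply ℂ (EllOne 𝒩) z).hasFDerivAt.comp_hasDerivAt (τ : ℂ)
      (hasDerivAt_exp_smul_const' (𝕂 := ℂ) A (τ : ℂ))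
    have h2 := h1.scomp τ Complex.ofRealCLM.hasDerivAt
    rw [Complex.ofRealCLM_apply, Complex.ofReal_one, one_smul] at h2
    exact h2.hasDerivWithinAt

end Linear

namespace PolyHam

variable {d : ℕ} {𝒩 : Set (Fin d → ℤ)} {k : ℕ} (P : PolyHam 𝒩 k) {lam : 𝒩 → ℝ} {b : ℝ}

lemma combFreq_conjIndex {ℓ : ℕ} (j : Fin ℓ → ModeIndex 𝒩) :
    combFreq lam (fun i => conjIndex (j i)) = -combFreq lam j := by
  simp [combFreq, conjIndex]

lemma abs_combFreq_le (hlam : ∀ a, |lam a| ≤ b) {ℓ : ℕ} (j : Fin ℓ → ModeIndex 𝒩) :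
    |combFreq lam j| ≤ ℓ * b := by
  refine (abs_sum_le_sum_abs _ _).trans ?_
  have : ∀ i ∈ (univ : Finset (Fin ℓ)), |((j i).2 : ℤ) * lam (j i).1| ≤ b := fun i _ => by
    rcases Int.units_eq_one_or (j i).2 with h | h <;> simpa [h] using hlam _
  simpa using sum_le_card_nsmul _ _ _ this

lemma norm_freq_pow_mul_le (hlam : ∀ a, |lam a| ≤ b) (hb : 0 ≤ b) (n ℓ : ℕ)
    (j : Fin ℓ → ModeIndex 𝒩) :
    ‖(Complex.I * combFreq lam j) ^ n * P.coeff ℓ j‖ ≤ (k * b) ^ n * P.degNorm ℓ := by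
  by_cases h0 : P.coeff ℓ j = 0
  · rw [h0, mul_zero, norm_zero]
    exact mul_nonneg (by positivity) (P.degNorm_nonneg ℓ)
  rw [norm_mul, norm_pow, norm_mul, Complex.norm_I, one_mul, Complex.norm_real, Real.norm_eq_abs]
  gcongr
  · refine (abs_combFreq_le hlam j).trans ?_
    gcongr
    exact (P.degree_mem ℓ j h0).2
  · exact P.norm_coeff_le ℓ j

/-- The coefficients multiplied by powers of the frequencies. -/
def freqPow (hlam : ∀ a, |lam a| ≤ b) (hb : 0 ≤ b) (n : ℕ) : PolyHam 𝒩 k where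
  coeff ℓ j := (Complex.I * combFreq lam j) ^ n * P.coeff ℓ j
  degree_mem ℓ j h := P.degree_mem ℓ j (right_ne_zero_of_mul h)
  momentum_eq_zero ℓ j h := P.momentum_eq_zero ℓ j (right_ne_zero_of_mul h)
  coeff_conj ℓ j := by
    rw [combFreq_conjIndex, P.coeff_conj]
    simp
  bounded := by
    obtain ⟨B, hB⟩ := P.bounded
    refine ⟨(k * b) ^ n * max B 0, fun ℓ j => (P.norm_freq_pow_mul_le hlam hb n ℓ j).trans ?_⟩
    gcongr
    exact Real.iSup_le (fun j => (hB ℓ j).trans (le_max_left _ _)) (le_max_right _ _)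

lemma freqPow_coeff (hlam : ∀ a, |lam a| ≤ b) (hb : 0 ≤ b) (n ℓ : ℕ) (j : Fin ℓ → ModeIndex 𝒩) :
    (P.freqPow hlam hb n).coeff ℓ j = (Complex.I * combFreq lam j) ^ n * P.coeff ℓ j := rfl

lemma summable_coeff_mul (ℓ : ℕ) (z : Fin ℓ → EllOne 𝒩) :
    Summable fun j : Fin ℓ → ModeIndex 𝒩 => P.coeff ℓ j * ∏ i, z i (j i) := by
  have h := summable_coeff (P.norm_coeff_le ℓ) z
  simpa only [smul_eq_mul, mul_comm] using h

/-- The linear field multiplies z_j by -iδλ_a. By the product rule each monomial is an eigenfunction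
with eigenvalue -iΛ(j). -/
lemma fderiv_eval_linearField (hlam : ∀ a, |lam a| ≤ b) (z : EllOne 𝒩) :
    fderiv ℂ P.eval z (linearField hlam z) =
      -∑ ℓ ∈ Icc 2 k, ∑' j : Fin ℓ → ModeIndex 𝒩,
        Complex.I * combFreq lam j * P.coeff ℓ j * ∏ i, z (j i) := by
  have hd : ∀ ℓ ∈ Icc 2 k, DifferentiableAt ℂ (fun z => P.part ℓ fun _ => z) z := fun ℓ _ =>
    (isHomogeneousMap_diag (P.part ℓ)).1.differentiable (by simp) z
  rw [eval_eq_sum, fderiv_sum hd, _root_.sum_apply, ← sum_neg_distrib]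
  refine sum_congr rfl fun ℓ _ => ?_
  rw [fderiv_diag]
  simp only [part_apply]
  rw [← Summable.tsum_finsetSum fun i _ => P.summable_coeff_mul ℓ _, ← tsum_neg]
  refine tsum_congr fun j => ?_
  have h : ∀ i, P.coeff ℓ j * ∏ i', Function.update (fun _ => z) i (linearField hlam z) i' (j i') =
      -(Complex.I * P.coeff ℓ j * ∏ i', z (j i')) * (((j i).2 : ℤ) * lam (j i).1 : ℝ) := by
    intro i
    rw [prod_update_apply, linearField_apply, ← mul_prod_erase univ _ (mem_univ i), modeSign]
    push_cast
    ring
  rw [sum_congr rfl fun i _ => h i, ← mul_sum, ← Complex.ofReal_sum]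
  change _ * (combFreq lam j : ℂ) = _
  ring

/-- Thus -ad A is diagonal on coefficients with entries iΛ(j), and its iterates preserve the degree
bound and zero momentum. -/
lemma bracket_freqPow (hlam : ∀ a, |lam a| ≤ b) (hb : 0 ≤ b) (n : ℕ) :
    (phaseSpace 𝒩).bracket (linearPair hlam) (P.freqPow hlam hb n).toPair =
      -(P.freqPow hlam hb (n + 1)).toPair := by
  refine SymplecticSpace.value_injective (funext fun z => ?_)
  rw [SymplecticSpace.value_bracket, map_neg, Pi.neg_apply, value_toPair, value_toPair,
    field_linearPair, fderiv_eval_linearField, eval]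
  congr 1
  refine sum_congr rfl fun ℓ _ => tsum_congr fun j => ?_
  rw [freqPow_coeff, freqPow_coeff]
  ring

lemma neg_bracket_pow (hlam : ∀ a, |lam a| ≤ b) (hb : 0 ≤ b) (n : ℕ) :
    ((-(phaseSpace 𝒩).bracket (linearPair hlam)) ^ n) P.toPair = (P.freqPow hlam hb n).toPair := by
  induction n with
  | zero =>
    refine SymplecticSpace.value_injective (funext fun z => ?_)
    rw [pow_zero, Module.End.one_apply, value_toPair, value_toPair, eval, eval]
    refine sum_congr rfl fun ℓ _ => tsum_congr fun j => ?_
    rw [freqPow_coeff, pow_zero, one_mul]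
  | succ n ih =>
    rw [pow_succ', Module.End.mul_apply, ih, LinearMap.neg_apply, bracket_freqPow, neg_neg]

/-- The part of the Baker–Campbell–Hausdorff series that is linear in `P` is given by the Bernoulli
factors, up to an exponentially small error. -/
lemma norm_bernoulli_sub_le (hlam : ∀ a, |lam a| ≤ b) (hb : 0 ≤ b) (hkb : k * b ≤ 1 / 2) (N : ℕ)
    {R : ℝ} {z : EllOne 𝒩} (hz : ‖z‖ ≤ R) :
    ‖∑ n ∈ range N, (bernoulliCoeff n : ℂ) * (P.freqPow hlam hb n).eval z -
      ∑ ℓ ∈ Icc 2 k, ∑' j : Fin ℓ → ModeIndex 𝒩,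
        bernoulliFactor (combFreq lam j) * P.coeff ℓ j * ∏ i, z (j i)‖ ≤
      2 * 2⁻¹ ^ N * ((1 + R) ^ k * P.coeffNorm) := by
  have hdiff : ∀ ℓ (j : Fin ℓ → ModeIndex 𝒩),
      ‖(∑ n ∈ range N, (bernoulliCoeff n : ℂ) * (Complex.I * combFreq lam j) ^ n -
        bernoulliFactor (combFreq lam j)) * P.coeff ℓ j‖ ≤ 2 * 2⁻¹ ^ N * P.degNorm ℓ := by
    intro ℓ j
    by_cases h0 : P.coeff ℓ j = 0
    · rw [h0, mul_zero, norm_zero]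
      exact mul_nonneg (by positivity) (P.degNorm_nonneg ℓ)
    rw [norm_mul]
    gcongr
    · refine norm_sum_bernoulliCoeff_sub_le ((abs_combFreq_le hlam j).trans (le_trans ?_ hkb)) N
      gcongr
      exact (P.degree_mem ℓ j h0).2
    · exact P.norm_coeff_le ℓ j
  have hR : 0 ≤ R := (norm_nonneg z).trans hz
  -- The error is one multilinear map whose coefficients are the scalar differences. The sum with
  -- the Bernoulli factors is treated as a difference of two families known to be summable.
  have hterm : ∀ ℓ, ∑ n ∈ range N, (bernoulliCoeff n : ℂ) *
        (∑' j : Fin ℓ → ModeIndex 𝒩, (P.freqPow hlam hb n).coeff ℓ j * ∏ i, z (j i)) -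
      ∑' j : Fin ℓ → ModeIndex 𝒩, bernoulliFactor (combFreq lam j) * P.coeff ℓ j * ∏ i, z (j i) =
      coeffMap (fun j => (∑ n ∈ range N, (bernoulliCoeff n : ℂ) * (Complex.I * combFreq lam j) ^ n -
        bernoulliFactor (combFreq lam j)) * P.coeff ℓ j) _ (hdiff ℓ) fun _ => z := by
    intro ℓ
    have hs : ∀ n ∈ range N, Summable fun j : Fin ℓ → ModeIndex 𝒩 =>
        (bernoulliCoeff n : ℂ) * ((P.freqPow hlam hb n).coeff ℓ j * ∏ i, z (j i)) := fun n _ =>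
      ((P.freqPow hlam hb n).summable_coeff_mul ℓ fun _ => z).mul_left _
    have hD := summable_coeff (hdiff ℓ) fun _ => z
    simp only [← tsum_mul_left]
    rw [← Summable.tsum_finsetSum hs, coeffMap_apply, sub_eq_iff_eq_add]
    have hB : ∀ j : Fin ℓ → ModeIndex 𝒩,
        bernoulliFactor (combFreq lam j) * P.coeff ℓ j * ∏ i, z (j i) =
        ∑ n ∈ range N, (bernoulliCoeff n : ℂ) * ((P.freqPow hlam hb n).coeff ℓ j * ∏ i, z (j i)) -
        (∏ i, z (j i)) • ((∑ n ∈ range N, (bernoulliCoeff n : ℂ) *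
          (Complex.I * combFreq lam j) ^ n - bernoulliFactor (combFreq lam j)) * P.coeff ℓ j) := by
      intro j
      have : ∑ n ∈ range N, (bernoulliCoeff n : ℂ) *
          ((P.freqPow hlam hb n).coeff ℓ j * ∏ i, z (j i)) =
          (∑ n ∈ range N, (bernoulliCoeff n : ℂ) * (Complex.I * combFreq lam j) ^ n) *
            (P.coeff ℓ j * ∏ i, z (j i)) := by
        rw [sum_mul]
        exact sum_congr rfl fun n _ => by rw [freqPow_coeff]; ring
      rw [this, smul_eq_mul]
      ring
    rw [tsum_congr hB, (summable_sum hs).tsum_sub hD]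
    ring
  have h1 : ∑ n ∈ range N, (bernoulliCoeff n : ℂ) * (P.freqPow hlam hb n).eval z =
      ∑ ℓ ∈ Icc 2 k, ∑ n ∈ range N, (bernoulliCoeff n : ℂ) *
        (∑' j : Fin ℓ → ModeIndex 𝒩, (P.freqPow hlam hb n).coeff ℓ j * ∏ i, z (j i)) := by
    rw [sum_comm]
    exact sum_congr rfl fun n _ => by rw [eval, mul_sum]
  rw [h1, ← sum_sub_distrib, sum_congr rfl fun ℓ _ => hterm ℓ, coeffNorm, mul_sum, mul_sum]
  refine norm_sum_le_of_le _ fun ℓ hℓ => ?_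
  refine (norm_coeffMap_le (hdiff ℓ) fun _ => z).trans ?_
  have h2 : ∏ _i : Fin ℓ, ‖z‖ ≤ (1 + R) ^ k := by
    rw [prod_const, card_univ, Fintype.card_fin]
    have h0 := norm_nonneg z
    calc ‖z‖ ^ ℓ ≤ (1 + R) ^ ℓ := by gcongr; linarith
      _ ≤ (1 + R) ^ k := pow_le_pow_right₀ (by linarith) (mem_Icc.1 hℓ).2
  have h3 := P.degNorm_nonneg ℓ
  calc 2 * 2⁻¹ ^ N * P.degNorm ℓ * ∏ _i : Fin ℓ, ‖z‖
      ≤ 2 * 2⁻¹ ^ N * P.degNorm ℓ * (1 + R) ^ k := by gcongr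
    _ = _ := by rw [degNorm]; ring

end PolyHam

end

end SplittingBEA

namespace SplittingBEA

open Finset Filter Topology
open scoped ENNReal ContDiff

noncomputable section

/-! ### The modified Hamiltonian -/

namespace SymplecticSpace

variable {E : Type*} [NormedAddCommGroup E] [NormedSpace ℂ E] {S : SymplecticSpace E}

lemma norm_field_smul (x : S.Ham) (c : ℝ) (z : E) :
    ‖S.field (c • x) z‖ = |c| * ‖S.field x z‖ := by
  rw [map_smul, SmoothMap.smul_apply, norm_smul, Real.norm_eq_abs]

/-- The modified Hamiltonian of the composition of the time-one map of `A` and the time-`h` map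
of `P`. -/
def modifiedHam (A P : S.Ham) (h : ℝ) (N : ℕ) : S.Ham :=
  h⁻¹ • bchSum S.bracket A (h • P) N

/-- The smallness assumptions on the data of one step. -/
structure StepBounds (A P : S.Ham) (a h M D : ℝ) (N : ℕ) : Prop where
  a_pos : 0 < a
  h_pos : 0 < h
  M_pos : 0 < M
  D_pos : 0 < D
  N_pos : 1 ≤ N
  norm_fst_le : ∀ z : E, ‖z‖ < 4 * M → ‖S.field A z‖ ≤ a
  norm_snd_le : ∀ z : E, ‖z‖ < 4 * M → ‖S.field P z‖ ≤ D
  a_le : 64 * N * a ≤ M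
  h_le : 128 * N * (h * D) ≤ M

variable {A P : S.Ham} {a h M D : ℝ} {N : ℕ}

namespace StepBounds

lemma ballNorm_fst_le (hS : StepBounds A P a h M D N) :
    ballNorm (4 * M) (S.field A) ≤ ENNReal.ofReal a := ballNorm_le_ofReal hS.norm_fst_le

lemma ballNorm_snd_le (hS : StepBounds A P a h M D N) :
    ballNorm (4 * M) (S.field (h • P)) ≤ ENNReal.ofReal (h * D) :=
  ballNorm_le_ofReal fun z hz => by
    have hh := hS.h_pos
    rw [norm_field_smul, abs_of_pos hh]
    gcongr
    exact hS.norm_snd_le z hz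

lemma ballNorm_fst_le' (hS : StepBounds A P a h M D N) :
    ballNorm (4 * M) (S.field A) ≤ ENNReal.ofReal (M / (16 * N)) := by
  have hN : (0 : ℝ) < N := by exact_mod_cast hS.N_pos
  refine hS.ballNorm_fst_le.trans (ENNReal.ofReal_le_ofReal ?_)
  rw [le_div_iff₀ (by positivity)]
  nlinarith [hS.a_le, mul_pos hN hS.a_pos]

lemma ballNorm_snd_le' (hS : StepBounds A P a h M D N) :
    ballNorm (4 * M) (S.field (h • P)) ≤ ENNReal.ofReal (M / (32 * N)) := by
  have hN : (0 : ℝ) < N := by exact_mod_cast hS.N_pos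
  refine hS.ballNorm_snd_le.trans (ENNReal.ofReal_le_ofReal ?_)
  rw [le_div_iff₀ (by positivity)]
  nlinarith [hS.h_le, mul_pos hN (mul_pos hS.h_pos hS.D_pos)]

lemma norm_bch_le (hS : StepBounds A P a h M D N) {z : E} (hz : ‖z‖ < 3 * M) :
    ‖S.field (bchSum S.bracket A (h • P) N) z‖ ≤ M / 4 := by
  have hM := hS.M_pos
  have hN : (1 : ℝ) ≤ N := by exact_mod_cast hS.N_pos
  refine (norm_le_of_ballNorm_le (by positivity) (ballNorm_bchSum_le field_bracket hS.M_pos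
    hS.N_pos hS.ballNorm_fst_le' hS.ballNorm_snd_le') hz).trans ?_
  gcongr
  linarith

lemma smul_modifiedHam (hS : StepBounds A P a h M D N) :
    h • modifiedHam A P h N = bchSum S.bracket A (h • P) N := by
  rw [modifiedHam, smul_smul, mul_inv_cancel₀ hS.h_pos.ne', one_smul]

lemma exists_timeOne_snd [CompleteSpace E] (hS : StepBounds A P a h M D N) {z : E} (hz : ‖z‖ ≤ M) :
    ∃ y, TimeOne (S.field (h • P)) z y := by
  have hM := hS.M_pos
  have hN : (1 : ℝ) ≤ N := by exact_mod_cast hS.N_pos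
  refine exists_timeOne _ (m := M) (r := 4 * M) (by positivity) hS.ballNorm_snd_le' ?_ hz
  have : M / (32 * N) ≤ M := div_le_self hM.le (by linarith)
  linarith

lemma exists_timeOne_modifiedHam [CompleteSpace E] (hS : StepBounds A P a h M D N) {z : E}
    (hz : ‖z‖ ≤ M) : ∃ w, TimeOne (S.field (h • modifiedHam A P h N)) z w := by
  have hM := hS.M_pos
  rw [hS.smul_modifiedHam]
  exact exists_timeOne _ (m := M) (r := 3 * M) (by positivity)
    (ballNorm_le_ofReal fun _ hz => hS.norm_bch_le hz) (by linarith) hz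

lemma norm_sub_le (hS : StepBounds A P a h M D N) {z x y w : E} (hz : ‖z‖ ≤ M)
    (hx : TimeOne (S.field A) z x) (hy : TimeOne (S.field (h • P)) x y)
    (hw : TimeOne (S.field (h • modifiedHam A P h N)) z w) : ‖y - w‖ ≤ 12 * M * 2⁻¹ ^ N :=
  splitting_error field_bracket hS.M_pos hS.N_pos hS.ballNorm_fst_le' hS.ballNorm_snd_le' hz hx hy
    (hS.smul_modifiedHam ▸ hw)

/-- The modified energy is almost conserved in one step. -/
lemma norm_value_sub_le [CompleteSpace E] (hS : StepBounds A P a h M D N) {z x y : E}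
    (hz : ‖z‖ ≤ M) (hyM : ‖y‖ ≤ M) (hx : TimeOne (S.field A) z x)
    (hy : TimeOne (S.field (h • P)) x y) :
    ‖S.value (modifiedHam A P h N) y - S.value (modifiedHam A P h N) z‖ ≤
      M / (4 * h) * (12 * M * 2⁻¹ ^ N) := by
  have hM := hS.M_pos
  have hh := hS.h_pos
  obtain ⟨w, hw⟩ := hS.exists_timeOne_modifiedHam hz
  have hyw := hS.norm_sub_le hz hx hy hw
  rw [hS.smul_modifiedHam] at hw
  -- The interpolating flow conserves its Hamiltonian exactly, so the energy defect of the scheme is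
  -- only the distance from `y` to `w` times the Lipschitz constant M/4, divided by h.
  have hcons := value_eq_of_timeOne _ hw
  have hw3 : ‖w‖ < 3 * M := by
    obtain ⟨u, hu0, hu1, hu⟩ := hw
    rw [← hu1]
    exact norm_lt_of_solution (m := M) (c := M / 4) (by positivity) hu (hu0 ▸ hz)
      (fun _ hz => hS.norm_bch_le hz) (by linarith) ⟨zero_le_one, le_rfl⟩
  have h1 := SymplecticSpace.norm_value_sub_le (bchSum S.bracket A (h • P) N) (r := 3 * M)
    (c := M / 4) (fun u hu => hS.norm_bch_le hu) hw3 (v := y) (by linarith)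
  rw [hcons] at h1
  simp only [modifiedHam, map_smul, Pi.smul_apply]
  rw [← smul_sub, norm_smul, norm_inv, Real.norm_of_nonneg hh.le]
  calc h⁻¹ * _ ≤ h⁻¹ * (M / 4 * (12 * M * 2⁻¹ ^ N)) := by gcongr; exact h1.trans (by gcongr)
    _ = M / (4 * h) * (12 * M * 2⁻¹ ^ N) := by field_simp

/-- The modified energy up to terms of second order in `P`. -/
lemma norm_value_modifiedHam_sub_le (hS : StepBounds A P a h M D N) {z : E} (hz : ‖z‖ ≤ M) :
    ‖S.value (modifiedHam A P h N) z - ((h : ℂ)⁻¹ * S.value A z +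
      ∑ n ∈ range N, (bernoulliCoeff n : ℂ) * S.value (((-S.bracket A) ^ n) P) z)‖ ≤
      8192 * D ^ 2 * h := by
  have hM := hS.M_pos
  have hh := hS.h_pos
  have hD := hS.D_pos
  set R := bchRemainder S.bracket A (h • P) N
  -- The remainder is quadratic in hP, so it has size (hD)²; the factor h⁻¹ in the modified
  -- Hamiltonian leaves one power of h.
  have hR : ‖S.value R z‖ ≤ 8192 * (h * D) ^ 2 / M * M := by
    refine (norm_value_le R (r := 3 * M) (c := 8192 * (h * D) ^ 2 / M)
      (by positivity) (fun u hu => ?_) (by linarith)).trans (by gcongr)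
    refine norm_le_of_ballNorm_le (by positivity) ?_ hu
    exact ballNorm_bchRemainder_le field_bracket hM hS.a_pos (mul_pos hh hD) hS.ballNorm_fst_le
      hS.ballNorm_snd_le hS.a_le hS.h_le
  have hne : (h : ℂ) ≠ 0 := by exact_mod_cast hh.ne'
  have hval : S.value (modifiedHam A P h N) z = ((h : ℂ)⁻¹ * S.value A z +
      ∑ n ∈ range N, (bernoulliCoeff n : ℂ) * S.value (((-S.bracket A) ^ n) P) z) +
        (h : ℂ)⁻¹ * S.value R z := by
    rw [modifiedHam, bchSum_eq _ _ hS.N_pos, map_smul, map_add, map_add, map_sum, Pi.smul_apply,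
      Pi.add_apply, Pi.add_apply, Finset.sum_apply, ← Complex.coe_smul,
      smul_eq_mul, mul_add, mul_add, mul_sum, Complex.ofReal_inv]
    congr 2
    refine sum_congr rfl fun n _ => ?_
    rw [map_smul, map_smul, map_smul, Pi.smul_apply, Pi.smul_apply,
      ← Complex.coe_smul, ← Complex.coe_smul, smul_eq_mul, smul_eq_mul]
    field_simp
  rw [hval, add_sub_cancel_left, norm_mul, norm_inv, Complex.norm_real, Real.norm_of_nonneg hh.le]
  calc h⁻¹ * ‖S.value R z‖ ≤ h⁻¹ * (8192 * (h * D) ^ 2 / M * M) := by gcongr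
    _ = 8192 * D ^ 2 * h := by field_simp

end StepBounds

end SymplecticSpace

section Scheme

variable {d : ℕ} {𝒩 : Set (Fin d → ℤ)} {k : ℕ} {P : PolyHam 𝒩 k} {lam : 𝒩 → ℝ} {b h M D a : ℝ}
  {N : ℕ} {hlam : ∀ a, |lam a| ≤ b}

lemma schemeStep_iff (hh : 0 < h) (z y : EllOne 𝒩) :
    SchemeStep P lam h z y ↔
      TimeOne ((phaseSpace 𝒩).field (h • P.toPair)) (linearFlow lam z) y :=
  flowsTo_iff P.toPair P.value_toPair hh _ _

/-- Two errors: the part at least quadratic in P, of order h, and the truncation of the Bernoulli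
series in the linear part, of order 2^(-N). -/
lemma norm_firstModifiedEnergy_sub_le
    (hS : SymplecticSpace.StepBounds (linearPair hlam) P.toPair a h M D N) (hb : 0 ≤ b)
    (hkb : k * b ≤ 1 / 2) {z : EllOne 𝒩} (hz : ‖z‖ ≤ M) :
    ‖(phaseSpace 𝒩).value (SymplecticSpace.modifiedHam (linearPair hlam) P.toPair h N) z -
      firstModifiedEnergy P lam h z‖ ≤
      8192 * D ^ 2 * h + 2 * 2⁻¹ ^ N * ((1 + M) ^ k * P.coeffNorm) := by
  have hfirst : firstModifiedEnergy P lam h z = (h : ℂ)⁻¹ * linearHam hlam z +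
      ∑ ℓ ∈ Icc 2 k, ∑' j : Fin ℓ → ModeIndex 𝒩,
        bernoulliFactor (combFreq lam j) * P.coeff ℓ j * ∏ i, z (j i) := by
    rw [firstModifiedEnergy, linearHam_eq, ← tsum_mul_left]
    congr 1
    refine tsum_congr fun a => ?_
    push_cast
    ring
  have h1 := hS.norm_value_modifiedHam_sub_le hz
  simp only [P.neg_bracket_pow hlam hb, PolyHam.value_toPair, value_linearPair] at h1
  have h2 := P.norm_bernoulli_sub_le hlam hb hkb N hz
  refine le_trans (le_of_eq ?_) ((norm_add_le _ _).trans (add_le_add h1 h2))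
  rw [hfirst]
  congr 1
  ring

end Scheme

/-! ### The choice of the constants -/

/-- With x = h^(-β), the last claim is that x^(1/β) exp(-c₂x) tends to zero as x tends to infinity:
the exponential beats every power of h. -/
lemma exists_step_size {β c₁ c₂ c₃ : ℝ} (hβ : 0 < β) (h1 : 0 < c₁) (h2 : 0 < c₂) :
    ∃ h₀ : ℝ, 0 < h₀ ∧ ∀ h, 0 < h → h ≤ h₀ →
      h ≤ 1 ∧ h ^ β ≤ c₁ ∧ c₃ * Real.exp (-(c₂ * h ^ (-β))) ≤ h := by
  have e1 : ∀ᶠ h : ℝ in 𝓝[>] 0, h ≤ 1 :=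
    (eventually_le_nhds (zero_lt_one : (0 : ℝ) < 1)).filter_mono nhdsWithin_le_nhds
  have e2 : ∀ᶠ h : ℝ in 𝓝[>] 0, h ^ β ≤ c₁ := by
    have h0 : Tendsto (fun h : ℝ => h ^ β) (𝓝[>] 0) (𝓝 0) := by
      have := (Real.continuousAt_rpow_const 0 β (Or.inr hβ.le)).tendsto
      rw [Real.zero_rpow hβ.ne'] at this
      exact this.mono_left nhdsWithin_le_nhds
    exact h0.eventually_le_const h1
  have e3 : ∀ᶠ h : ℝ in 𝓝[>] 0, c₃ * Real.exp (-(c₂ * h ^ (-β))) ≤ h := by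
    have h0 : Tendsto (fun h : ℝ => h ^ (-β)) (𝓝[>] 0) atTop :=
      tendsto_rpow_neg_nhdsGT_zero (neg_lt_zero.2 hβ)
    have h3 := ((tendsto_rpow_mul_exp_neg_mul_atTop_nhds_zero (1 / β) c₂ h2).comp h0).const_mul c₃
    rw [mul_zero] at h3
    filter_upwards [h3.eventually_le_const zero_lt_one, self_mem_nhdsWithin] with h hle hpos
    have hpos : 0 < h := hpos
    have h4 : (h ^ (-β)) ^ (1 / β) = h⁻¹ := by
      rw [← Real.rpow_mul hpos.le, ← Real.rpow_neg_one]
      congr 1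
      field_simp
    simp only [Function.comp_apply, h4] at hle
    calc c₃ * Real.exp (-(c₂ * h ^ (-β))) =
          h * (c₃ * (h⁻¹ * Real.exp (-c₂ * h ^ (-β)))) := by
          rw [neg_mul]; field_simp
      _ ≤ h * 1 := by gcongr
      _ = h := mul_one h
  obtain ⟨δ, hδ, hsub⟩ := mem_nhdsGT_iff_exists_Ioc_subset.1 ((e1.and e2).and e3)
  exact ⟨δ, hδ, fun h hh hle => ⟨(hsub ⟨hh, hle⟩).1.1, (hsub ⟨hh, hle⟩).1.2, (hsub ⟨hh, hle⟩).2⟩⟩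

end

end SplittingBEA

namespace SplittingBEA

open Finset Filter Topology
open scoped ENNReal ContDiff

noncomputable section

lemma two_inv_pow_floor_le (x : ℝ) : (2⁻¹ : ℝ) ^ ⌊x⌋₊ ≤ 2 * Real.exp (-(Real.log 2 * x)) := by
  have h2 : (2⁻¹ : ℝ) ^ ⌊x⌋₊ = Real.exp (-(Real.log 2 * ⌊x⌋₊)) := by
    rw [Real.exp_neg, Real.exp_mul, Real.exp_log two_pos, Real.rpow_natCast, inv_pow]
  rw [h2, show (2 : ℝ) * Real.exp (-(Real.log 2 * x)) = Real.exp (Real.log 2 + -(Real.log 2 * x)) by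
    rw [Real.exp_add, Real.exp_log two_pos]]
  refine Real.exp_le_exp.2 ?_
  have hlog : 0 < Real.log 2 := Real.log_pos (by norm_num)
  nlinarith [Nat.lt_floor_add_one x]

lemma norm_sub_le_of_steps {E : Type*} [SeminormedAddCommGroup E] {f : ℕ → E} {c : ℝ}
    (h : ∀ n, ‖f (n + 1) - f n‖ ≤ c) (n : ℕ) : ‖f n - f 0‖ ≤ n * c := by
  induction n with
  | zero => simp
  | succ n ih =>
    calc ‖f (n + 1) - f 0‖ ≤ ‖f (n + 1) - f n‖ + ‖f n - f 0‖ := norm_sub_le_norm_sub_add_norm_sub _ _ _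
      _ ≤ c + n * c := add_le_add (h n) ih
      _ = ((n + 1 : ℕ) : ℝ) * c := by push_cast; ring

lemma norm_sub_le_of_near {E : Type*} [SeminormedAddCommGroup E] {a b a' b' : E} {c δ : ℝ}
    (h : ‖a - b‖ ≤ c) (ha : ‖a - a'‖ ≤ δ) (hb : ‖b - b'‖ ≤ δ) : ‖a' - b'‖ ≤ c + 2 * δ := by
  have h1 : a' - b' = (a - b) - (a - a') + (b - b') := by abel
  rw [h1]
  have h2 := norm_add_le ((a - b) - (a - a')) (b - b')
  have h3 := norm_sub_le (a - b) (a - a')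
  linarith

end

end SplittingBEA

/-! ### The main theorem: constants and conclusion -/

open SplittingBEA in
theorem mainTheorem4 (r₀ : ℕ) (hr₀ : 3 ≤ r₀) (β γ M K : ℝ) (hβ₀ : 0 < β) (hβ₁ : β < 1)
    (hγ : 0 < γ) (hM : 0 < M) :
    ∃ h₀ c C : ℝ, 0 < h₀ ∧ 0 < c ∧ 0 < C ∧
      ∀ (d : ℕ), 1 ≤ d →
      ∀ (𝒩 : Set (Fin d → ℤ)), (𝒩 = Set.univ ∨ 𝒩 = {a | ∀ i, 0 ≤ a i}) →
      ∀ (ω : 𝒩 → ℝ) (P : SplittingBEA.PolyHam 𝒩 r₀), P.coeffNorm ≤ K →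
      ∀ (α : ℝ → ℝ → ℝ) (h : ℝ), 0 < h → h ≤ h₀ → (∀ x : ℝ, |α h x| ≤ γ * h ^ β) →
      ∃ (k : ℕ) (H : SplittingBEA.PolyHam 𝒩 k),
        (∀ z : SplittingBEA.EllOne 𝒩, ‖z‖ ≤ M → ∃ y w : SplittingBEA.EllOne 𝒩,
          SplittingBEA.SchemeStep P (fun a => α h (h * ω a)) h z y ∧
          SplittingBEA.FlowsTo H.eval h z w ∧
          ‖y - w‖ ≤ h * Real.exp (-((h₀ / h) ^ β))) ∧
        ∀ z : ℕ → SplittingBEA.EllOne 𝒩,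
          SplittingBEA.IsRealPoint (z 0) →
          (∀ n, SplittingBEA.SchemeStep P (fun a => α h (h * ω a)) h (z n) (z (n + 1))) →
          (∀ n, ‖z n‖ ≤ M) →
          ∀ n : ℕ, n * h ≤ Real.exp (c * h ^ (-β)) →
            ‖H.eval (z n) - H.eval (z 0)‖ ≤ C * Real.exp (-(c * h ^ (-β))) ∧
            ‖SplittingBEA.firstModifiedEnergy P (fun a => α h (h * ω a)) h (z n) -
              SplittingBEA.firstModifiedEnergy P (fun a => α h (h * ω a)) h (z 0)‖ ≤ C * h := by
  -- The maximum keeps `D` positive. `D` below bounds the field of P on the ball of radius 4M.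
  set K' := max K 1
  have hK' : 1 ≤ K' := le_max_right _ _
  have hr : (0 : ℝ) < r₀ := by exact_mod_cast (by lia : 0 < r₀)
  set D : ℝ := 2 * r₀ * (1 + 4 * M) ^ r₀ * K' with hD
  have hD0 : 0 < D := by positivity
  -- With Nε ≤ c₁ and ε = h^β ≤ c₁, the three entries give in turn 64·N·a ≤ M for a = 4γεM, 128·N·hD
  -- ≤ M (using h ≤ ε), and r₀γε ≤ 1/2, the range in which the Bernoulli series is estimated.
  set c₁ : ℝ := min (min (1 / (256 * γ)) (M / (128 * D))) (1 / (2 * (r₀ * γ)))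
  have hc₁ : 0 < c₁ := by positivity
  have hc₁a : 256 * γ * c₁ ≤ 1 := by
    have h : c₁ ≤ 1 / (256 * γ) := (min_le_left _ _).trans (min_le_left _ _)
    rwa [le_div_iff₀ (by positivity), mul_comm] at h
  have hc₁b : 128 * D * c₁ ≤ M := by
    have h : c₁ ≤ M / (128 * D) := (min_le_left _ _).trans (min_le_right _ _)
    rwa [le_div_iff₀ (by positivity), mul_comm] at h
  have hc₁c : 2 * (r₀ * γ) * c₁ ≤ 1 := by
    have h : c₁ ≤ 1 / (2 * (r₀ * γ)) := min_le_right _ _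
    rwa [le_div_iff₀ (by positivity), mul_comm] at h
  -- With e = exp(-cε⁻¹), the factor 1/6 gives 2^(-N) ≤ 2e⁶. One power of e is traded for a power of
  -- h; the other five serve the one-step estimate and the growth of the error over exponentially
  -- many steps.
  set c : ℝ := Real.log 2 * c₁ / 6 with hc
  have hlog : 0 < Real.log 2 := Real.log_pos (by norm_num)
  have hc0 : 0 < c := by positivity
  obtain ⟨h₁, hh₁, hsize⟩ := exists_step_size (c₃ := 24 * M) hβ₀ hc₁ hc0
  -- The second entry makes h₀^β ≤ 2c, so that exp(-(h₀/h)^β) is at least e².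
  set h₀ : ℝ := min h₁ ((2 * c) ^ (1 / β))
  have hh₀ : 0 < h₀ := lt_min hh₁ (by positivity)
  have hh₀β : h₀ ^ β ≤ 2 * c := by
    calc h₀ ^ β ≤ ((2 * c) ^ (1 / β)) ^ β := by gcongr; exact min_le_right _ _
      _ = 2 * c := by
        rw [← Real.rpow_mul (by positivity), one_div_mul_cancel hβ₀.ne', Real.rpow_one]
  set C₁ : ℝ := 8192 * D ^ 2 + (1 + M) ^ r₀ * K' / (6 * M) with hC₁
  have hC₁0 : 0 < C₁ := by positivity
  -- The term 2C₁ is for comparing the two energies at both ends, and 1/(24M) for the drift e ≤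
  -- h/(24M); the 1 makes C ≥ 1.
  set C : ℝ := 1 + 2 * C₁ + 1 / (24 * M) with hC
  have hM24 : 0 < 1 / (24 * M) := by positivity
  refine ⟨h₀, c, C, hh₀, hc0, by positivity, ?_⟩
  intro d _ 𝒩 _ ω P hPK α h hh hhle hα
  obtain ⟨hh1, hε, hsmall⟩ := hsize h hh (hhle.trans (min_le_left _ _))
  set ε := h ^ β with hεdef
  have hε0 : 0 < ε := Real.rpow_pos_of_pos hh β
  have hhε : h ≤ ε := by
    calc h = h ^ (1 : ℝ) := (Real.rpow_one h).symm
      _ ≤ h ^ β := Real.rpow_le_rpow_of_exponent_ge hh hh1 hβ₁.le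
  have ht : h ^ (-β) = ε⁻¹ := Real.rpow_neg hh.le β
  rw [ht] at hsmall ⊢
  set e := Real.exp (-(c * ε⁻¹)) with he
  have he0 : 0 < e := Real.exp_pos _
  have he1 : e ≤ 1 := Real.exp_le_one_iff.2 (by have := inv_pos.2 hε0; nlinarith)
  set N := ⌊c₁ / ε⌋₊
  have hN1 : 1 ≤ N := (Nat.one_le_floor_iff _).2 ((one_le_div hε0).2 hε)
  have hNε : N * ε ≤ c₁ := by
    have := Nat.floor_le (div_pos hc₁ hε0).le
    rwa [le_div_iff₀ hε0] at this
  have hN2 : (2⁻¹ : ℝ) ^ N ≤ 2 * e ^ 6 := by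
    refine (two_inv_pow_floor_le _).trans (le_of_eq ?_)
    rw [he, ← Real.exp_nat_mul]
    congr 2
    rw [hc]
    push_cast
    field_simp
  set lam : 𝒩 → ℝ := fun a => α h (h * ω a)
  have hlam : ∀ a, |lam a| ≤ γ * ε := fun a => hα _
  have hPD : ∀ z : EllOne 𝒩, ‖z‖ < 4 * M → ‖(phaseSpace 𝒩).field P.toPair z‖ ≤ D := fun z hz => by
    refine (P.norm_field_toPair_le hz.le).trans ?_
    rw [hD]
    gcongr
    exact hPK.trans (le_max_left _ _)
  have hS : SymplecticSpace.StepBounds (linearPair hlam) P.toPair (γ * ε * (4 * M)) h M D N :=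
    { a_pos := by positivity
      h_pos := hh
      M_pos := hM
      D_pos := hD0
      N_pos := hN1
      norm_fst_le := fun z hz => by
        rw [field_linearPair]
        exact (norm_linearField_le hlam z).trans (by gcongr)
      norm_snd_le := hPD
      a_le := by
        calc 64 * N * (γ * ε * (4 * M)) = 256 * γ * (N * ε) * M := by ring
          _ ≤ 256 * γ * c₁ * M := by gcongr
          _ ≤ 1 * M := by gcongr
          _ = M := one_mul M
      h_le := by
        calc 128 * N * (h * D) ≤ 128 * N * (ε * D) := by gcongr
          _ = 128 * D * (N * ε) := by ring
          _ ≤ 128 * D * c₁ := by gcongr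
          _ ≤ M := hc₁b }
  set x := SymplecticSpace.modifiedHam (linearPair hlam) P.toPair h N
  obtain ⟨k, H, hH⟩ := exists_polyHam x
  -- Uses 24Me ≤ h, from the choice of h₁: one of the six exponential factors becomes the factor h
  -- of the claim.
  have herr : 12 * M * 2⁻¹ ^ N ≤ h * e ^ 5 := by
    calc 12 * M * 2⁻¹ ^ N ≤ 12 * M * (2 * e ^ 6) := by gcongr
      _ = 24 * M * e * e ^ 5 := by ring
      _ ≤ h * e ^ 5 := by gcongr
  refine ⟨k, H, fun z hz => ?_, fun z _ hstep hz n hn => ?_⟩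
  · obtain ⟨y, hy⟩ := hS.exists_timeOne_snd (z := linearFlow lam z) ((norm_linearFlow lam z).le.trans hz)
    obtain ⟨w, hw⟩ := hS.exists_timeOne_modifiedHam hz
    refine ⟨y, w, (schemeStep_iff hh z y).2 hy, (flowsTo_iff x hH.symm hh z w).2 hw, ?_⟩
    refine (hS.norm_sub_le hz (timeOne_linearFlow hlam z) hy hw).trans (herr.trans ?_)
    gcongr
    rw [Real.div_rpow hh₀.le hh.le, ← hεdef]
    calc e ^ 5 ≤ e ^ 2 := pow_le_pow_of_le_one he0.le he1 (by norm_num)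
      _ = Real.exp (-(2 * c / ε)) := by
        rw [he, ← Real.exp_nat_mul]
        congr 1
        push_cast
        ring
      _ ≤ Real.exp (-(h₀ ^ β / ε)) := by gcongr
  have hHz : ∀ n, ‖H.eval (z (n + 1)) - H.eval (z n)‖ ≤ M / 4 * e ^ 5 := fun n => by
    rw [hH]
    refine (hS.norm_value_sub_le (hz n) (hz (n + 1)) (timeOne_linearFlow hlam _)
      ((schemeStep_iff hh _ _).1 (hstep n))).trans ?_
    calc M / (4 * h) * (12 * M * 2⁻¹ ^ N) ≤ M / (4 * h) * (h * e ^ 5) := by gcongr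
      _ = M / 4 * e ^ 5 := by field_simp
  have hexp : Real.exp (c * ε⁻¹) = e⁻¹ := by rw [he, Real.exp_neg, inv_inv]
  have henergy : ‖H.eval (z n) - H.eval (z 0)‖ ≤ e := by
    refine (norm_sub_le_of_steps (f := fun n => H.eval (z n)) hHz n).trans ?_
    rw [hexp] at hn
    -- The inequality 24Me ≤ h also bounds the number of steps: nh ≤ e⁻¹ gives n ≤ e⁻²/(24M), so n
    -- steps with drift e⁵M/4 each stay below e³/96.
    have hn1 : n * (24 * M * e) ≤ e⁻¹ := by
      refine le_trans ?_ hn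
      gcongr
    have hn2 : n * (24 * M) * e ^ 2 ≤ 1 := by
      calc n * (24 * M) * e ^ 2 = n * (24 * M * e) * e := by ring
        _ ≤ e⁻¹ * e := by gcongr
        _ = 1 := inv_mul_cancel₀ he0.ne'
    calc n * (M / 4 * e ^ 5) = (n * (24 * M) * e ^ 2) * (e ^ 3 / 96) := by ring
      _ ≤ 1 * (e ^ 3 / 96) := by gcongr
      _ ≤ e := by
        have : e ^ 3 ≤ e := by
          simpa using pow_le_pow_of_le_one he0.le he1 (by norm_num : 1 ≤ 3)
        linarith
  have hfirst : ∀ n, ‖H.eval (z n) - firstModifiedEnergy P lam h (z n)‖ ≤ C₁ * h := fun n => by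
    rw [hH]
    refine (norm_firstModifiedEnergy_sub_le hS (by positivity) ?_ (hz n)).trans ?_
    · have : 2 * (r₀ * γ) * ε ≤ 1 := le_trans (by gcongr) hc₁c
      linarith
    · have h1 : 2 * 2⁻¹ ^ N ≤ h / (6 * M) := by
        rw [le_div_iff₀ (by positivity)]
        calc 2 * 2⁻¹ ^ N * (6 * M) = 12 * M * 2⁻¹ ^ N := by ring
          _ ≤ h * e ^ 5 := herr
          _ ≤ h * 1 := by gcongr; exact pow_le_one₀ he0.le he1
          _ = h := mul_one h
      have hQ : 0 ≤ (1 + M) ^ r₀ * P.coeffNorm :=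
        mul_nonneg (by positivity) (Finset.sum_nonneg fun ℓ _ => P.degNorm_nonneg ℓ)
      calc 8192 * D ^ 2 * h + 2 * 2⁻¹ ^ N * ((1 + M) ^ r₀ * P.coeffNorm)
          ≤ 8192 * D ^ 2 * h + h / (6 * M) * ((1 + M) ^ r₀ * K') := by
            gcongr
            exact hPK.trans (le_max_left _ _)
        _ = C₁ * h := by rw [hC₁]; ring
  refine ⟨henergy.trans ?_, ?_⟩
  · exact le_mul_of_one_le_left he0.le (by rw [hC]; linarith)
  · have h1 := hfirst n
    have h2 := hfirst 0
    have h3 : e ≤ 1 / (24 * M) * h := by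
      rw [div_mul_eq_mul_div, one_mul, le_div_iff₀ (by positivity)]
      linarith
    have h4 := norm_sub_le_of_near henergy h1 h2
    have h5 : C * h = h + 2 * (C₁ * h) + 1 / (24 * M) * h := by rw [hC]; ring
    linarith
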